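/- Let $n\ge 2$ and let $Y$ be a set of exactly $n-1$ points in the boundary circle $\partial H^2=\mathbb{R}\cup\{\infty\}$ of the hyperbolic plane $H^2$ (upper half-plane model). Then there are infinitely many subgroups $\Gamma\le \mathrm{PSL}_2(\mathbb{R})=\mathrm{Isom}^+(H^2)$ with all of the following properties. 1. $\Gamma$ is Fuchsian (i.e. discrete) and has finite covolume, i.e. $H^2/\Gamma$ has finite hyperbolic area. 2. $\Gamma$ has signature $(0:\underbrace{2,\dots,2}_{n+1};1;0)$. That is, the quotient space $H^2/\Gamma$ is homeomorphic to a sphere with one point removed; there are exactly $n+1$ $\Gamma$-orbits of points of $H^2$ with non-trivial stabilizer in $\Gamma$, and each of these stabilizers has order $2$; there is exactly one $\Gamma$-orbit of cusps (boundary points fixed by a parabolic element of $\Gamma$); and there are no boundary curves, i.e. no open interval of $\partial H^2$ on which $\Gamma$ acts discontinuously. 3. $Y\subset \operatorname{HFix}(\Gamma)$, i.e. every $y\in Y$ is fixed by some hyperbolic element of $\Gamma$. 4. There are $n+1$ distinct points $v_0,v_1,\dots,v_n\in\partial H^2$ in cyclic order (that is, $v_0<v_1<\dots<v_{n-1}$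 in $\partial H^2\setminus\{v_n\}$, with the order of the real line in an upper half-plane model that has $v_n$ at infinity) and, for each $0\le i\le n$, a point $f_i\in H^2$ on the geodesic line with end points $v_{i-1}$ and $v_i$ (where $v_{-1}=v_n$), such that $\Gamma$ is generated by the rotations by $\pi$ about $f_0,\dots,f_n$, and the interior of the ideal convex $(n+1)$-gon with vertices $v_0,\dots,v_n$ is a fundamental domain for $\Gamma$: its $\Gamma$-images are pairwise disjoint, its boundary has area zero, and the $\Gamma$-images of its closure cover $H^2$ in a locally finite way. -/

import Mathlib

open scoped MatrixGroups UpperHalfPlane Pointwise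

noncomputable section

namespace HypPlane

/-- The group of orientation preserving isometries of the hyperbolic plane, acting on the upper
half plane by Möbius transformations. -/
instance pslActionPlane : MulAction PSL(2, ℝ) ℍ :=
  MulAction.compHom ℍ
    (Matrix.ProjectiveSpecialLinearGroup.toPGL : PSL(2, ℝ) →* PGL(2, ℝ))

/-- The Möbius action on the boundary circle `∂H² = ℝ ∪ {∞}`. -/
instance pslActionBoundary : MulAction PSL(2, ℝ) (OnePoint ℝ) :=
  (OnePoint.equivProjectivization ℝ).mulAction PSL(2, ℝ)

/-- The isometry given by a matrix of determinant one. -/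
def isom (A : SL(2, ℝ)) : PSL(2, ℝ) := QuotientGroup.mk A

theorem isom_smul_plane (A : SL(2, ℝ)) (z : ℍ) : isom A • z = A • z := rfl

theorem isom_smul_boundary (A : SL(2, ℝ)) (x : OnePoint ℝ) :
    isom A • x = (A : GL (Fin 2) ℝ) • x := rfl

/-- `γ` is parabolic: non-trivial, with `tr² = 4`. -/
def IsParabolic (γ : PSL(2, ℝ)) : Prop :=
  ∃ A : SL(2, ℝ), isom A = γ ∧ (A : Matrix (Fin 2) (Fin 2) ℝ).IsParabolic

/-- `γ` is hyperbolic: `tr² > 4`. -/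
def IsHyperbolic (γ : PSL(2, ℝ)) : Prop :=
  ∃ A : SL(2, ℝ), isom A = γ ∧ (A : Matrix (Fin 2) (Fin 2) ℝ).IsHyperbolic

/-- A Fuchsian group: a discrete subgroup of `PSL(2, ℝ)` (with the quotient topology). -/
def IsFuchsian (Γ : Subgroup PSL(2, ℝ)) : Prop := DiscreteTopology Γ

/-- The quotient `H²/Γ` has finite hyperbolic area. -/
def HasFiniteCovolume (Γ : Subgroup PSL(2, ℝ)) : Prop :=
  ∃ D : Set ℍ, MeasureTheory.IsFundamentalDomain Γ D ∧ MeasureTheory.volume D < ⊤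

/-- The set of hyperbolic fixed points of `Γ`. -/
def HFix (Γ : Subgroup PSL(2, ℝ)) : Set (OnePoint ℝ) :=
  {y | ∃ γ ∈ Γ, IsHyperbolic γ ∧ γ • y = y}

/-- The cusps of `Γ`: boundary points fixed by a parabolic element of `Γ`. -/
def cusps (Γ : Subgroup PSL(2, ℝ)) : Set (OnePoint ℝ) :=
  {x | ∃ γ ∈ Γ, IsParabolic γ ∧ γ • x = x}

/-- The set of boundary points near which `Γ` acts discontinuously. -/
def ordinarySet (Γ : Subgroup PSL(2, ℝ)) : Set (OnePoint ℝ) :=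
  {x | ∃ U ∈ nhds x, {γ : Γ | ((γ • U) ∩ U).Nonempty}.Finite}

/-- The intervals of discontinuity of `Γ`: the connected components of the ordinary set. Their
`Γ`-orbits are the ideal boundary curves (funnels) of `H²/Γ`. -/
def boundaryIntervals (Γ : Subgroup PSL(2, ℝ)) : Set (Set (OnePoint ℝ)) :=
  {J | ∃ x ∈ ordinarySet Γ, J = connectedComponentIn (ordinarySet Γ) x}

/-- The points of `H²` fixed by a non-trivial element of `Γ`. -/
def ellipticPoints (Γ : Subgroup PSL(2, ℝ)) : Set ℍ :=
  {z | ∃ γ ∈ Γ, γ ≠ 1 ∧ γ • z = z}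

/-- The family `c` lists each `Γ`-orbit in the (`Γ`-invariant) set `S` exactly once. -/
def ListsOrbits {X : Type*} [MulAction PSL(2, ℝ) X] (Γ : Subgroup PSL(2, ℝ)) (S : Set X)
    {r : ℕ} (c : Fin r → X) : Prop :=
  (∀ i, c i ∈ S) ∧ ∀ x ∈ S, ∃! i, ∃ γ ∈ Γ, γ • c i = x

/-- `Γ` is a Fuchsian group of signature `(0 : m₁, …, mᵣ ; s ; t)`: the quotient space `H²/Γ` is
homeomorphic to a sphere with `s + t` points removed, it has exactly `r` cone points, of orders
`m₁, …, mᵣ`, and there are exactly `s` cusps and exactly `t` boundary curves modulo `Γ`. -/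
structure HasGenusZeroSignature (Γ : Subgroup PSL(2, ℝ)) {r : ℕ} (m : Fin r → ℕ) (s t : ℕ) :
    Prop where
  fuchsian : IsFuchsian Γ
  genus_zero : ∃ F : Finset (OnePoint ℂ), F.card = s + t ∧
    Nonempty (Quotient (MulAction.orbitRel Γ ℍ) ≃ₜ {p : OnePoint ℂ // p ∉ F})
  cone_points : ∃ c : Fin r → ℍ, ListsOrbits Γ (ellipticPoints Γ) c ∧
    ∀ i, 2 ≤ m i ∧ Nat.card (MulAction.stabilizer Γ (c i)) = m i
  punctures : ∃ c : Fin s → OnePoint ℝ, ListsOrbits Γ (cusps Γ) c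
  boundary_curves : ∃ c : Fin t → Set (OnePoint ℝ), ListsOrbits Γ (boundaryIntervals Γ) c

/-- The matrix `b⁻¹ * !![a, -(a ^ 2 + b ^ 2); 1, -a]`, where `f = a + b i`. -/
def rhoMatrix (f : ℍ) : SL(2, ℝ) :=
  ⟨!![f.re / f.im, -(f.re ^ 2 + f.im ^ 2) / f.im; 1 / f.im, -f.re / f.im], by
    have h := f.im_ne_zero
    rw [Matrix.det_fin_two_of]
    field_simp
    ring⟩

/-- The rotation by `π` about `f`: the isometry of order two that fixes `f`. -/
def rho (f : ℍ) : PSL(2, ℝ) := isom (rhoMatrix f)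

/-- The geodesic line with end points `x ≠ y`: the image of the imaginary axis under an isometry
that takes `0` to `x` and `∞` to `y`. -/
def geodesic (x y : OnePoint ℝ) : Set ℍ :=
  {z | ∃ γ : PSL(2, ℝ), γ • ((0 : ℝ) : OnePoint ℝ) = x ∧ γ • OnePoint.infty = y ∧
    ∃ w : ℍ, w.re = 0 ∧ γ • w = z}

/-- The open half plane to the left of the geodesic line directed from `x` to `y`. -/
def leftSide (x y : OnePoint ℝ) : Set ℍ :=
  {z | ∃ γ : PSL(2, ℝ), γ • ((0 : ℝ) : OnePoint ℝ) = x ∧ γ • OnePoint.infty = y ∧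
    ∃ w : ℍ, w.re < 0 ∧ γ • w = z}

/-- `v₀ < v₁ < ⋯ < vₙ₋₁` in `∂H² ∖ {vₙ}`, for the order of the real line in an upper half plane
model in which `vₙ` is the point at infinity. -/
def InCyclicOrder {n : ℕ} (v : Fin (n + 1) → OnePoint ℝ) : Prop :=
  ∃ (γ : PSL(2, ℝ)) (t : Fin n → ℝ), StrictMono t ∧
    (∀ i : Fin n, γ • v i.castSucc = (t i : OnePoint ℝ)) ∧ γ • v (Fin.last n) = OnePoint.infty

/-- The interior of the ideal convex polygon with vertices `v₀, …, vₙ` in cyclic order; its sides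
are the lines from `v (i - 1)` to `v i`, where `0 - 1` is read as `n`. -/
def idealPolygon {n : ℕ} (v : Fin (n + 1) → OnePoint ℝ) : Set ℍ :=
  {z | ∀ i, z ∈ leftSide (v (i - 1)) (v i)}

/-- `D` is a (locally finite) fundamental domain for `Γ`: a connected open set with boundary of
area zero, whose `Γ`-images are pairwise disjoint, and whose closure has `Γ`-images that cover the
plane in a locally finite way. -/
structure IsFundamentalDomain (Γ : Subgroup PSL(2, ℝ)) (D : Set ℍ) : Prop where
  isOpen : IsOpen D
  isConnected : IsConnected D
  null_frontier : MeasureTheory.volume (frontier D) = 0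
  disjoint : ∀ γ ∈ Γ, γ ≠ 1 → Disjoint (γ • D) D
  covers : ∀ z : ℍ, ∃ γ ∈ Γ, z ∈ γ • closure D
  locally_finite : ∀ K : Set ℍ, IsCompact K → {γ : Γ | ((γ • closure D) ∩ K).Nonempty}.Finite

end HypPlane

end

/-! ### Half-turns, half planes and geodesics in coordinates. -/

namespace HypPlane

open UpperHalfPlane

/-! The groups are built from decorated ideal polygons. Put `N = n - 1`, take vertices `v 0 < ⋯ < v
N` and `∞`, a horodisc of diameter `h k` at `v k` and the horodisc of height one at `∞`. On each
side there is a unique point whose half-turn exchanges the horodiscs at the two ends. Let Γ be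
generated by these `N + 2` half-turns.

The closed half planes cut off by the sides are pairwise disjoint in the plane, so ping-pong on
reduced words (`SidePairing.wordProd_smul`) shows that Γ-images of the open polygon are disjoint and
that a closed polygon meets itself only under half-turns (`SidePairing.eq_of_smul_mem`). This gives
discreteness and the cone points. Covering the plane needs completeness at the cusp: since the
half-turns respect the horodiscs, their product around the vertices is a translation
(`cuspElt_last_smul`), and the images of the polygon at `∞` fill a period of it. A Lebesgue number
argument then makes the union of all images clopen (`exists_smul_mem_cuspPoly`).

The quotient is found explicitly: vertical lines cut the polygon into ideal triangles, each triangle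
is folded along its bottom side, the folded triangles form a strip, and the complex cosine folds the
two edges of the strip (`foldMap`). So the quotient is a plane, that is, a once punctured sphere.
Cusps are located by cyclically reduced words (`mem_cusps_iff`); the orbit of `∞` is dense in the
boundary, so there are no intervals of discontinuity (`ordinarySet_eq_empty`).

For the hyperbolic fixed points, move `Y` into `ℝ` and interlace: `v k < y k < v (k + 1)`. If the
translation length is `C`, the point `y k` is fixed by the translation after the half-turn on the
side from `v k` to `v (k + 1)` as soon as this half-turn moves `y k` to `y k + C`. That condition
prescribes the ratio `h (k + 1) / h k`, and the free common factor of the `h k` adjusts the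
translation length to any `C > v N - v 0` (`exists_weights`). Every such `C` yields a group
containing the translation by `-C`; these are uncountably many elements, while each group is
countable, so infinitely many groups occur. -/

theorem isom_surjective (γ : PSL(2, ℝ)) : ∃ A : SL(2, ℝ), isom A = γ :=
  QuotientGroup.mk_surjective γ

theorem isom_mul (A B : SL(2, ℝ)) : isom (A * B) = isom A * isom B := rfl

theorem isom_inv (A : SL(2, ℝ)) : isom A⁻¹ = (isom A)⁻¹ := rfl

theorem coe_isom_smul (A : SL(2, ℝ)) (z : ℍ) :
    ((isom A • z : ℍ) : ℂ) = (A 0 0 * z + A 0 1) / (A 1 0 * z + A 1 1) := by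
  rw [isom_smul_plane, coe_specialLinearGroup_apply]
  simp

theorem denom_ne_zero_of_sl (A : SL(2, ℝ)) (z : ℍ) : (A 1 0 * z + A 1 1 : ℂ) ≠ 0 := by
  have := UpperHalfPlane.denom_ne_zero (A : GL (Fin 2) ℝ) z
  simpa [denom] using this

theorem det_sl (A : SL(2, ℝ)) : A 0 0 * A 1 1 - A 0 1 * A 1 0 = 1 := by
  have := A.det_coe
  rwa [Matrix.det_fin_two] at this

/-- Allows equalities in `PSL(2, ℝ)` to be checked on points of the plane, without choosing signs of
matrices. -/
instance : FaithfulSMul PSL(2, ℝ) ℍ where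
  eq_of_smul_eq_smul h := Matrix.ProjectiveSpecialLinearGroup.toPGL_injective
    (FaithfulSMul.eq_of_smul_eq_smul (α := ℍ) h)

instance : IsIsometricSMul PSL(2, ℝ) ℍ where
  isometry_smul γ := by
    obtain ⟨A, rfl⟩ := isom_surjective γ
    exact isometry_smul ℍ A

instance : MeasureTheory.SMulInvariantMeasure PSL(2, ℝ) ℍ MeasureTheory.volume where
  measure_preimage_smul γ s hs := by
    obtain ⟨A, rfl⟩ := isom_surjective γ
    exact MeasureTheory.measure_preimage_smul_of_nullMeasurableSet
      (G := GL (Fin 2) ℝ) (c := (A : GL (Fin 2) ℝ)) hs.nullMeasurableSet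

theorem continuous_smul_const (z : ℍ) : Continuous fun γ : PSL(2, ℝ) => γ • z := by
  refine continuous_coinduced_dom.2 ?_
  exact continuous_id.smul (continuous_const (y := z))

theorem isom_smul_infty (A : SL(2, ℝ)) :
    isom A • (OnePoint.infty : OnePoint ℝ) =
      if A 1 0 = 0 then OnePoint.infty else ((A 0 0 / A 1 0 : ℝ) : OnePoint ℝ) := by
  rw [isom_smul_boundary, OnePoint.smul_infty_eq_ite]
  by_cases h : A 1 0 = 0
  · rw [if_pos h]
    exact if_pos h
  · rw [if_neg h]
    exact if_neg h

theorem isom_smul_coe (A : SL(2, ℝ)) (x : ℝ) :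
    isom A • (x : OnePoint ℝ) = if A 1 0 * x + A 1 1 = 0 then OnePoint.infty
      else (((A 0 0 * x + A 0 1) / (A 1 0 * x + A 1 1) : ℝ) : OnePoint ℝ) := by
  rw [isom_smul_boundary, OnePoint.smul_some_eq_ite]
  by_cases h : A 1 0 * x + A 1 1 = 0
  · rw [if_pos h]
    exact if_pos h
  · rw [if_neg h]
    exact if_neg h

theorem isom_neg (A : SL(2, ℝ)) : isom (-A) = isom A := by
  refine FaithfulSMul.eq_of_smul_eq_smul (α := ℍ) fun z => ?_
  apply UpperHalfPlane.ext
  rw [coe_isom_smul, coe_isom_smul]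
  simp only [Matrix.SpecialLinearGroup.coe_neg, Matrix.neg_apply, Complex.ofReal_neg]
  rw [← neg_div_neg_eq]
  congr 1 <;> ring

theorem coe_rho_smul (f z : ℍ) : ((rho f • z : ℍ) : ℂ) = f.re - f.im ^ 2 / (z - f.re) := by
  have h1 : (z - f.re : ℂ) ≠ 0 := sub_ne_zero.2 (ne_ofReal z _)
  have h2 : (f.im : ℂ) ≠ 0 := by exact_mod_cast f.im_ne_zero
  rw [rho, coe_isom_smul]
  simp only [rhoMatrix, Matrix.of_apply, Matrix.cons_val', Matrix.cons_val_zero,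
    Matrix.cons_val_one, Matrix.cons_val_fin_one]
  push_cast
  have h3 : (1 / (f.im : ℂ) * z + -f.re / f.im) = (z - f.re) / f.im := by field_simp; ring
  rw [h3]
  field_simp
  ring

theorem normSq_sub_ofReal (z : ℍ) (a : ℝ) :
    Complex.normSq (z - a : ℂ) = (z.re - a) ^ 2 + z.im ^ 2 := by
  rw [Complex.normSq_apply]
  simp
  ring

theorem sq_add_sq_im_pos (z : ℍ) (a : ℝ) : 0 < (z.re - a) ^ 2 + z.im ^ 2 := by
  have := z.im_pos
  positivity

theorem rho_smul_re (f z : ℍ) : (rho f • z).re =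
    f.re - f.im ^ 2 * (z.re - f.re) / ((z.re - f.re) ^ 2 + z.im ^ 2) := by
  have := congrArg Complex.re (coe_rho_smul f z)
  rw [coe_re] at this
  rw [this, Complex.sub_re, ← Complex.ofReal_pow, Complex.div_re, normSq_sub_ofReal]
  simp [-Complex.ofReal_pow]

theorem rho_smul_im (f z : ℍ) : (rho f • z).im =
    f.im ^ 2 * z.im / ((z.re - f.re) ^ 2 + z.im ^ 2) := by
  have := congrArg Complex.im (coe_rho_smul f z)
  rw [coe_im] at this
  rw [this, Complex.sub_im, ← Complex.ofReal_pow, Complex.div_im, normSq_sub_ofReal]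
  simp [-Complex.ofReal_pow]

theorem rho_smul_self (f : ℍ) : rho f • f = f := by
  have := f.im_ne_zero
  apply ext_re_im
  · rw [rho_smul_re]; simp
  · rw [rho_smul_im]; field_simp; simp

theorem rho_smul_rho_smul (f z : ℍ) : rho f • rho f • z = z := by
  apply UpperHalfPlane.ext
  rw [coe_rho_smul, coe_rho_smul]
  have h1 : (z - f.re : ℂ) ≠ 0 := sub_ne_zero.2 (ne_ofReal z _)
  have h2 : (f.im : ℂ) ≠ 0 := by exact_mod_cast f.im_ne_zero
  field_simp
  ring

theorem rho_mul_self (f : ℍ) : rho f * rho f = 1 := by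
  refine FaithfulSMul.eq_of_smul_eq_smul (α := ℍ) fun z => ?_
  rw [mul_smul, rho_smul_rho_smul, one_smul]

theorem rho_inv (f : ℍ) : (rho f)⁻¹ = rho f := inv_eq_of_mul_eq_one_left (rho_mul_self f)

theorem rho_smul_eq_self_iff {f z : ℍ} : rho f • z = z ↔ z = f := by
  refine ⟨fun h => ?_, fun h => h ▸ rho_smul_self f⟩
  have h1 := congrArg UpperHalfPlane.re h
  have h2 := congrArg UpperHalfPlane.im h
  rw [rho_smul_re] at h1
  rw [rho_smul_im] at h2
  have hp := sq_add_sq_im_pos z f.re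
  have hz := z.im_pos
  have hf := f.im_pos
  have h3 : f.im ^ 2 = (z.re - f.re) ^ 2 + z.im ^ 2 := by
    field_simp at h2
    exact h2
  rw [← h3] at h1
  have h4 : z.re = f.re := by
    field_simp at h1
    linarith
  refine ext_re_im h4 ?_
  rw [h4] at h3
  have : f.im ^ 2 = z.im ^ 2 := by linarith
  exact ((sq_eq_sq₀ hf.le hz.le).1 this).symm

theorem rho_ne_one (f : ℍ) : rho f ≠ 1 := by
  intro h
  have h1 : ∀ z, z = f := fun z => rho_smul_eq_self_iff.1 (by rw [h, one_smul])
  have h2 := congrArg UpperHalfPlane.re (h1 ((1 : ℝ) +ᵥ f))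
  simp at h2

/-- Trace zero and the fixed point determine the matrix up to a scalar, and the determinant leaves
only its sign, which is invisible in `PSL(2, ℝ)`. -/
theorem rho_eq_of_trace_eq_zero (B : SL(2, ℝ)) (g : ℍ)
    (ht : B 0 0 + B 1 1 = 0) (hg : isom B • g = g) : isom B = rho g := by
  have hd := det_sl B
  have hB := denom_ne_zero_of_sl B g
  have h1 := coe_isom_smul B g
  rw [hg, eq_div_iff hB] at h1
  have hre := congrArg Complex.re h1
  have him := congrArg Complex.im h1
  simp at hre him
  have hy := g.im_pos
  have hy0 := hy.ne'
  have h11 : B 1 1 = -B 0 0 := by linarith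
  rw [h11] at hre him hd
  have hp : B 0 0 = B 1 0 * g.re := by
    have : g.im * (2 * (B 1 0 * g.re - B 0 0)) = 0 := by linarith
    have := (mul_eq_zero.1 this).resolve_left hy0
    linarith
  have hq : B 0 1 = -B 1 0 * (g.re ^ 2 + g.im ^ 2) := by
    rw [hp] at hre; linarith
  rw [hq, hp] at hd
  have hr : (B 1 0 * g.im - 1) * (B 1 0 * g.im + 1) = 0 := by linarith
  have key : ∀ C : SL(2, ℝ), C 1 0 = 1 / g.im → C 0 0 = C 1 0 * g.re →
      C 0 1 = -C 1 0 * (g.re ^ 2 + g.im ^ 2) → C 1 1 = -C 0 0 → isom C = rho g := by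
    intro C h10 hp hq h11
    have : C = rhoMatrix g := by
      ext i j
      fin_cases i <;> fin_cases j <;>
        simp only [rhoMatrix, Fin.mk_one, Fin.zero_eta, Fin.isValue, Matrix.of_apply,
          Matrix.cons_val', Matrix.cons_val_zero, Matrix.cons_val_one, Matrix.cons_val_fin_one]
      · rw [hp, h10]; ring
      · rw [hq, h10]; ring
      · exact h10
      · rw [h11, hp, h10]; ring
    rw [this, rho]
  rcases mul_eq_zero.1 hr with h | h
  · exact key B (by field_simp; linarith) hp hq h11
  · rw [← isom_neg]
    have e : ∀ i j, (-B) i j = -(B i j) := fun i j => by simp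
    refine key (-B) ?_ ?_ ?_ ?_ <;> simp only [e]
    · field_simp; linarith
    · rw [hp]; ring
    · rw [hq]; ring
    · rw [h11]

/-- A conjugate of the half-turn still has trace zero and fixes the moved center. -/
theorem rho_conj (γ : PSL(2, ℝ)) (f : ℍ) : γ * rho f * γ⁻¹ = rho (γ • f) := by
  obtain ⟨A, rfl⟩ := isom_surjective γ
  refine rho_eq_of_trace_eq_zero (A * rhoMatrix f * A⁻¹) _ ?_ ?_
  · have h1 : Matrix.trace ((A * rhoMatrix f * A⁻¹ : SL(2, ℝ)) : Matrix (Fin 2) (Fin 2) ℝ) = 0 := by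
      rw [Matrix.SpecialLinearGroup.coe_mul, Matrix.trace_mul_comm,
        ← Matrix.SpecialLinearGroup.coe_mul, ← mul_assoc, inv_mul_cancel, one_mul,
        Matrix.trace_fin_two]
      simp [rhoMatrix]
      ring
    rwa [Matrix.trace_fin_two] at h1
  · rw [isom_mul, isom_mul, isom_inv, mul_smul, mul_smul, inv_smul_smul]
    change isom A • rho f • f = _
    rw [rho_smul_self]

theorem smul_leftSide (γ : PSL(2, ℝ)) (x y : OnePoint ℝ) :
    γ • leftSide x y = leftSide (γ • x) (γ • y) := by
  ext z
  rw [Set.mem_smul_set_iff_inv_smul_mem]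
  constructor
  · rintro ⟨δ, h0, h1, w, hw, h⟩
    exact ⟨γ * δ, by rw [mul_smul, h0], by rw [mul_smul, h1], w, hw, by
      rw [mul_smul, h, smul_inv_smul]⟩
  · rintro ⟨δ, h0, h1, w, hw, h⟩
    exact ⟨γ⁻¹ * δ, by rw [mul_smul, h0, inv_smul_smul], by rw [mul_smul, h1, inv_smul_smul], w, hw,
      by rw [mul_smul, h]⟩

theorem smul_geodesic (γ : PSL(2, ℝ)) (x y : OnePoint ℝ) :
    γ • geodesic x y = geodesic (γ • x) (γ • y) := by
  ext z
  rw [Set.mem_smul_set_iff_inv_smul_mem]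
  constructor
  · rintro ⟨δ, h0, h1, w, hw, h⟩
    exact ⟨γ * δ, by rw [mul_smul, h0], by rw [mul_smul, h1], w, hw, by
      rw [mul_smul, h, smul_inv_smul]⟩
  · rintro ⟨δ, h0, h1, w, hw, h⟩
    exact ⟨γ⁻¹ * δ, by rw [mul_smul, h0, inv_smul_smul], by rw [mul_smul, h1, inv_smul_smul], w, hw,
      by rw [mul_smul, h]⟩

/-- An isometry fixing `0` and `∞` is a dilation and keeps the sign of the real part, so the
existential definition does not depend on the isometry chosen. The other half planes follow by
transport along explicit matrices. -/
theorem leftSide_zero_infty :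
    leftSide ((0 : ℝ) : OnePoint ℝ) OnePoint.infty = {z | z.re < 0} := by
  ext z
  constructor
  · rintro ⟨γ, h0, h1, w, hw, rfl⟩
    obtain ⟨A, rfl⟩ := isom_surjective γ
    rw [isom_smul_infty] at h1
    rw [isom_smul_coe] at h0
    split_ifs at h1 with h10
    · have hd := det_sl A
      rw [h10] at h0 hd
      simp only [mul_zero, zero_add, sub_zero] at h0 hd
      have h11 : A 1 1 ≠ 0 := by rintro h; simp [h] at hd
      rw [if_neg h11, OnePoint.coe_eq_coe, div_eq_zero_iff] at h0
      have h01 := h0.resolve_right h11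
      have := congrArg Complex.re (coe_isom_smul A w)
      rw [h10, h01] at this
      simp only [Complex.ofReal_zero, zero_mul, zero_add, add_zero, coe_re] at this
      rw [Complex.div_ofReal_re, Complex.re_ofReal_mul, coe_re] at this
      change (isom A • w).re < 0
      rw [this]
      have h2 : A 0 0 * w.re / A 1 1 = (w.re) * (A 0 0 * A 1 1) / A 1 1 ^ 2 := by field_simp
      rw [h2, hd, mul_one]
      exact div_neg_of_neg_of_pos hw (by positivity)
    · exact absurd h1 (OnePoint.coe_ne_infty _)
  · intro hz
    exact ⟨1, by rw [one_smul], by rw [one_smul], z, hz, by rw [one_smul]⟩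

theorem mem_geodesic_zero_infty {z : ℍ} (hz : z.re = 0) :
    z ∈ geodesic ((0 : ℝ) : OnePoint ℝ) OnePoint.infty :=
  ⟨1, by rw [one_smul], by rw [one_smul], z, hz, by rw [one_smul]⟩

theorem leftSide_smul (γ : PSL(2, ℝ)) :
    leftSide (γ • ((0 : ℝ) : OnePoint ℝ)) (γ • OnePoint.infty) = {z | (γ⁻¹ • z).re < 0} := by
  rw [← smul_leftSide, leftSide_zero_infty]
  ext z
  rw [Set.mem_smul_set_iff_inv_smul_mem]
  rfl

theorem mem_geodesic_smul {γ : PSL(2, ℝ)} {z : ℍ} (hz : (γ⁻¹ • z).re = 0) :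
    z ∈ geodesic (γ • ((0 : ℝ) : OnePoint ℝ)) (γ • OnePoint.infty) := by
  rw [← smul_geodesic, Set.mem_smul_set_iff_inv_smul_mem]
  exact mem_geodesic_zero_infty hz

/-- The matrix with the given entries, of determinant one. -/
def slMk (a b c d : ℝ) (h : a * d - b * c = 1) : SL(2, ℝ) :=
  ⟨!![a, b; c, d], by rw [Matrix.det_fin_two_of, h]⟩

theorem coe_slMk_inv_smul (a b c d : ℝ) (h : a * d - b * c = 1) (z : ℍ) :
    (((isom (slMk a b c d h))⁻¹ • z : ℍ) : ℂ) = (d * z - b) / (-c * z + a) := by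
  rw [← isom_inv, coe_isom_smul]
  have : (slMk a b c d h)⁻¹ = slMk d (-b) (-c) a (by linarith) := by
    ext i j
    rw [Matrix.SpecialLinearGroup.coe_inv, slMk, Matrix.adjugate_fin_two]
    fin_cases i <;> fin_cases j <;> simp [slMk]
  rw [this]
  simp [slMk, sub_eq_add_neg]

theorem re_slMk_inv_smul (a b c d : ℝ) (h : a * d - b * c = 1) (z : ℍ) :
    ((isom (slMk a b c d h))⁻¹ • z).re = ((d * z.re - b) * (-c * z.re + a) - d * c * z.im ^ 2) /
      ((-c * z.re + a) ^ 2 + (c * z.im) ^ 2) := by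
  rw [← coe_re, coe_slMk_inv_smul, Complex.div_re, Complex.normSq_apply]
  simp
  rw [← add_div]
  congr 1 <;> ring

theorem denom_pos_of_det (a b c d : ℝ) (h : a * d - b * c = 1) (z : ℍ) :
    0 < (-c * z.re + a) ^ 2 + (c * z.im) ^ 2 := by
  have hy := z.im_pos
  by_cases hc : c = 0
  · subst hc
    have : a ≠ 0 := by rintro rfl; simp at h
    simp only [neg_zero, zero_mul, zero_add]
    positivity
  · positivity

theorem slMk_smul_zero (a b c d : ℝ) (h : a * d - b * c = 1) :
    isom (slMk a b c d h) • ((0 : ℝ) : OnePoint ℝ) =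
      if d = 0 then OnePoint.infty else ((b / d : ℝ) : OnePoint ℝ) := by
  rw [isom_smul_coe]
  simp [slMk]

theorem slMk_smul_infty (a b c d : ℝ) (h : a * d - b * c = 1) :
    isom (slMk a b c d h) • (OnePoint.infty : OnePoint ℝ) =
      if c = 0 then OnePoint.infty else ((a / c : ℝ) : OnePoint ℝ) := by
  rw [isom_smul_infty]
  simp [slMk]

/-- The matrix takes `0` to `u` and `∞` to `w`. Because `u < w`, the left side is the outside of the
semicircle. -/
theorem leftSide_coe_coe {u w : ℝ} (huw : u < w) :
    leftSide (u : OnePoint ℝ) (w : OnePoint ℝ) =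
      {z | 0 < (z.re - u) * (z.re - w) + z.im ^ 2} := by
  have h0 : w - u ≠ 0 := by linarith
  have hd : w * (1 / (w - u)) - u / (w - u) * 1 = 1 := by field_simp
  have h := leftSide_smul (isom (slMk w (u / (w - u)) 1 (1 / (w - u)) hd))
  rw [slMk_smul_zero, slMk_smul_infty] at h
  rw [if_neg (one_div_ne_zero h0), if_neg one_ne_zero, div_one,
    show u / (w - u) / (1 / (w - u)) = u by field_simp] at h
  rw [h]
  ext z
  have hp := denom_pos_of_det _ _ _ _ hd z
  change ((isom (slMk w (u / (w - u)) 1 (1 / (w - u)) hd))⁻¹ • z).re < 0 ↔ _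
  rw [re_slMk_inv_smul, div_neg_iff]
  have e : (1 / (w - u) * z.re - u / (w - u)) * (-1 * z.re + w) - 1 / (w - u) * 1 * z.im ^ 2 =
    -(((z.re - u) * (z.re - w) + z.im ^ 2) / (w - u)) := by field_simp; ring
  rw [e]
  have hw : 0 < w - u := by linarith
  simp only [Set.mem_ofPred_eq]
  constructor
  · rintro (h | h)
    · linarith [h.2]
    · have := h.1
      rw [neg_lt_zero, div_pos_iff_of_pos_right hw] at this
      exact this
  · intro h
    exact Or.inr ⟨by rw [neg_lt_zero]; positivity, hp⟩

theorem mem_geodesic_coe_coe {u w : ℝ} (huw : u < w) {z : ℍ}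
    (hz : (z.re - u) * (z.re - w) + z.im ^ 2 = 0) :
    z ∈ geodesic (u : OnePoint ℝ) (w : OnePoint ℝ) := by
  have h0 : w - u ≠ 0 := by linarith
  have hd : w * (1 / (w - u)) - u / (w - u) * 1 = 1 := by field_simp
  have h := @mem_geodesic_smul (isom (slMk w (u / (w - u)) 1 (1 / (w - u)) hd)) z
  rw [slMk_smul_zero, slMk_smul_infty] at h
  rw [if_neg (one_div_ne_zero h0), if_neg one_ne_zero, div_one,
    show u / (w - u) / (1 / (w - u)) = u by field_simp] at h
  apply h
  have := re_slMk_inv_smul _ _ _ _ hd z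
  have e : (1 / (w - u) * z.re - u / (w - u)) * (-1 * z.re + w) - 1 / (w - u) * 1 * z.im ^ 2 =
    -(((z.re - u) * (z.re - w) + z.im ^ 2) / (w - u)) := by field_simp; ring
  rw [e, hz] at this
  simpa using this

theorem leftSide_infty_coe (u : ℝ) :
    leftSide OnePoint.infty (u : OnePoint ℝ) = {z | 0 < z.re - u} := by
  have hd : u * 0 - (-1) * 1 = (1 : ℝ) := by norm_num
  have h := leftSide_smul (isom (slMk u (-1) 1 0 hd))
  rw [slMk_smul_zero, slMk_smul_infty] at h
  simp only [if_true, one_ne_zero, if_false, div_one] at h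
  rw [h]
  ext z
  have hp := denom_pos_of_det _ _ _ _ hd z
  change ((isom (slMk u (-1) 1 0 hd))⁻¹ • z).re < 0 ↔ _
  rw [re_slMk_inv_smul, div_lt_iff₀ hp]
  simp only [Set.mem_ofPred_eq]
  constructor <;> intro h <;> linarith

theorem mem_geodesic_infty_coe {u : ℝ} {z : ℍ} (hz : z.re = u) :
    z ∈ geodesic OnePoint.infty (u : OnePoint ℝ) := by
  have hd : u * 0 - (-1) * 1 = (1 : ℝ) := by norm_num
  have h := @mem_geodesic_smul (isom (slMk u (-1) 1 0 hd)) z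
  rw [slMk_smul_zero, slMk_smul_infty] at h
  simp only [if_true, one_ne_zero, if_false, div_one] at h
  apply h
  have := re_slMk_inv_smul _ _ _ _ hd z
  simpa [hz] using this

theorem leftSide_coe_infty (u : ℝ) :
    leftSide (u : OnePoint ℝ) OnePoint.infty = {z | 0 < u - z.re} := by
  have hd : 1 * 1 - u * 0 = (1 : ℝ) := by norm_num
  have h := leftSide_smul (isom (slMk 1 u 0 1 hd))
  rw [slMk_smul_zero, slMk_smul_infty] at h
  simp only [if_true, one_ne_zero, if_false, div_one] at h
  rw [h]
  ext z
  have hp := denom_pos_of_det _ _ _ _ hd z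
  change ((isom (slMk 1 u 0 1 hd))⁻¹ • z).re < 0 ↔ _
  rw [re_slMk_inv_smul, div_lt_iff₀ hp]
  simp only [Set.mem_ofPred_eq]
  constructor <;> intro h <;> linarith

theorem mem_geodesic_coe_infty {u : ℝ} {z : ℍ} (hz : z.re = u) :
    z ∈ geodesic (u : OnePoint ℝ) OnePoint.infty := by
  have hd : 1 * 1 - u * 0 = (1 : ℝ) := by norm_num
  have h := @mem_geodesic_smul (isom (slMk 1 u 0 1 hd)) z
  rw [slMk_smul_zero, slMk_smul_infty] at h
  simp only [if_true, one_ne_zero, if_false, div_one] at h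
  apply h
  have := re_slMk_inv_smul _ _ _ _ hd z
  simpa [hz] using this

end HypPlane

/-! ### Ping-pong for half-turns with disjoint half planes. -/

namespace HypPlane

open UpperHalfPlane Topology

/-- Half-turns about the points `f i`, each exchanging the two sides of the line `s i = 0`, where the
closed half planes `s i ≤ 0` are pairwise disjoint. -/
structure SidePairing {ι : Type*} (f : ι → ℍ) (s : ι → ℍ → ℝ) : Prop where
  continuous : ∀ i, Continuous (s i)
  eq_of_nonpos : ∀ z i j, s i z ≤ 0 → s j z ≤ 0 → i = j
  center : ∀ i, s i (f i) = 0
  flip : ∀ i z, ∃ c > 0, s i (rho (f i) • z) = -(c * s i z)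

/-- The group generated by the half-turns about the points `f i`. -/
def halfTurnGroup {ι : Type*} (f : ι → ℍ) : Subgroup PSL(2, ℝ) :=
  Subgroup.closure (Set.range fun i => rho (f i))

/-- The open polygon cut out by the side functions `s i`. -/
def openPoly {ι : Type*} (s : ι → ℍ → ℝ) : Set ℍ := {z | ∀ i, 0 < s i z}

/-- The closed polygon cut out by the side functions `s i`. -/
def closedPoly {ι : Type*} (s : ι → ℍ → ℝ) : Set ℍ := {z | ∀ i, 0 ≤ s i z}

/-- The product of the half-turns listed by a word. -/
noncomputable def wordProd {ι : Type*} (f : ι → ℍ) (l : List ι) : PSL(2, ℝ) := (l.map fun i => rho (f i)).prod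

section

variable {ι : Type*} {f : ι → ℍ} {s : ι → ℍ → ℝ}

theorem rho_mem_halfTurnGroup (i : ι) : rho (f i) ∈ halfTurnGroup f :=
  Subgroup.subset_closure ⟨i, rfl⟩

theorem wordProd_cons (i : ι) (l : List ι) : wordProd f (i :: l) = rho (f i) * wordProd f l := by
  simp [wordProd]

theorem wordProd_append (l m : List ι) : wordProd f (l ++ m) = wordProd f l * wordProd f m := by
  simp [wordProd]

theorem wordProd_singleton (i : ι) : wordProd f [i] = rho (f i) := by
  simp [wordProd]

/-- The generators are involutions: inverses are superfluous and equal neighbours cancel. -/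
theorem exists_reduced_word {γ : PSL(2, ℝ)} (hγ : γ ∈ halfTurnGroup f) :
    ∃ l : List ι, l.IsChain (· ≠ ·) ∧ γ = wordProd f l := by
  have step : ∀ (i : ι) (y : PSL(2, ℝ)), (∃ l : List ι, l.IsChain (· ≠ ·) ∧ y = wordProd f l) →
      ∃ l : List ι, l.IsChain (· ≠ ·) ∧ rho (f i) * y = wordProd f l := by
    rintro i y ⟨l, hl, rfl⟩
    rcases l with _ | ⟨j, t⟩
    · exact ⟨[i], List.IsChain.singleton _, by rw [wordProd_cons]⟩
    · by_cases hij : i = j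
      · subst hij
        exact ⟨t, hl.tail, by rw [wordProd_cons, ← mul_assoc, rho_mul_self, one_mul]⟩
      · exact ⟨i :: j :: t, List.isChain_cons_cons.2 ⟨hij, hl⟩, by rw [wordProd_cons i]⟩
  unfold halfTurnGroup at hγ
  induction hγ using Subgroup.closure_induction_left with
  | one => exact ⟨[], List.IsChain.nil, rfl⟩
  | mul_left x hx y hy ih =>
    obtain ⟨i, rfl⟩ := hx
    exact step i y ih
  | inv_mul_cancel x hx y hy ih =>
    obtain ⟨i, rfl⟩ := hx
    simp only [rho_inv]
    exact step i y ih

theorem countable_halfTurnGroup [Countable ι] : (halfTurnGroup f : Set PSL(2, ℝ)).Countable := by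
  refine (Set.countable_range (wordProd f)).mono fun γ hγ => ?_
  obtain ⟨l, -, rfl⟩ := exists_reduced_word hγ
  exact ⟨l, rfl⟩

instance (Γ : Subgroup PSL(2, ℝ)) : ContinuousConstSMul Γ ℍ :=
  ⟨fun γ => continuous_const_smul (γ : PSL(2, ℝ))⟩

namespace SidePairing

variable (sp : SidePairing f s)
include sp

theorem flip_nonpos {i : ι} {z : ℍ} (h : 0 ≤ s i z) : s i (rho (f i) • z) ≤ 0 := by
  obtain ⟨c, hc, e⟩ := sp.flip i z
  rw [e]
  have := mul_nonneg hc.le h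
  linarith

theorem flip_neg {i : ι} {z : ℍ} (h : 0 < s i z) : s i (rho (f i) • z) < 0 := by
  obtain ⟨c, hc, e⟩ := sp.flip i z
  rw [e]
  have := mul_pos hc h
  linarith

theorem flip_pos {i : ι} {z : ℍ} (h : s i z < 0) : 0 < s i (rho (f i) • z) := by
  obtain ⟨c, hc, e⟩ := sp.flip i z
  rw [e]
  have := mul_neg_of_pos_of_neg hc h
  linarith

theorem flip_zero {i : ι} {z : ℍ} (h : s i z = 0) : s i (rho (f i) • z) = 0 := by
  obtain ⟨c, hc, e⟩ := sp.flip i z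
  rw [e, h]
  simp

theorem pos_of_nonpos {i j : ι} {z : ℍ} (hij : j ≠ i) (h : s i z ≤ 0) : 0 < s j z :=
  not_le.1 fun h' => hij (sp.eq_of_nonpos z j i h' h)

theorem center_mem_closedPoly (i : ι) : f i ∈ closedPoly s := fun j => by
  by_cases hj : j = i
  · rw [hj, sp.center]
  · exact (sp.pos_of_nonpos hj (sp.center i).le).le

/-- Ping-pong: each letter throws the point into its own half plane, which lies strictly on the
positive side of the next, different letter. The last letter alone only gives `≤ 0`; a second letter
makes the inequality strict. -/
theorem wordProd_smul (t : List ι) (i j : ι) (h : (i :: (t ++ [j])).IsChain (· ≠ ·)) {z : ℍ}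
    (hz : 0 ≤ s j z) : s i (wordProd f (i :: (t ++ [j])) • z) < 0 := by
  induction t generalizing i with
  | nil =>
    simp only [List.nil_append, List.isChain_cons_cons] at h
    rw [List.nil_append, wordProd_cons, wordProd_singleton, mul_smul]
    exact sp.flip_neg (sp.pos_of_nonpos h.1 (sp.flip_nonpos hz))
  | cons k t ih =>
    rw [List.cons_append, List.isChain_cons_cons] at h
    rw [List.cons_append, wordProd_cons, mul_smul]
    exact sp.flip_neg (sp.pos_of_nonpos h.1 (ih k h.2).le)

/-- A reduced word with at least two letters moves the whole closed polygon strictly off itself, and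
a single letter leaves only its own side on the polygon. -/
theorem eq_of_smul_mem {γ : PSL(2, ℝ)} (hγ : γ ∈ halfTurnGroup f) {z : ℍ}
    (hz : z ∈ closedPoly s) (hγz : γ • z ∈ closedPoly s) :
    γ = 1 ∨ ∃ i, γ = rho (f i) ∧ s i z = 0 := by
  obtain ⟨l, hl, rfl⟩ := exists_reduced_word hγ
  rcases l with _ | ⟨i, t⟩
  · exact Or.inl rfl
  rcases List.eq_nil_or_concat' t with rfl | ⟨t, j, rfl⟩
  · refine Or.inr ⟨i, wordProd_singleton i, le_antisymm ?_ (hz i)⟩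
    by_contra h
    rw [wordProd_singleton] at hγz
    exact absurd (hγz i) (not_le.2 (sp.flip_neg (not_le.1 h)))
  · exact absurd (hγz i) (not_le.2 (sp.wordProd_smul t i j hl (hz j)))

/-- Cyclic reduction: equal first and last letters are removed by conjugation until the word is
empty, a single letter, or has different ends. In the last case ping-pong controls all iterates. -/
theorem exists_conj {γ : PSL(2, ℝ)} (hγ : γ ∈ halfTurnGroup f) :
    ∃ δ ∈ halfTurnGroup f, δ * γ * δ⁻¹ = 1 ∨ (∃ i, δ * γ * δ⁻¹ = rho (f i)) ∨
      ∃ i j, i ≠ j ∧ ∀ z, 0 ≤ s j z → s i ((δ * γ * δ⁻¹) • z) < 0 := by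
  obtain ⟨l, hl, rfl⟩ := exists_reduced_word hγ
  clear hγ
  induction hn : l.length using Nat.strong_induction_on generalizing l with
  | _ n ih =>
    rcases l with _ | ⟨i, t⟩
    · exact ⟨1, one_mem _, Or.inl (by simp [wordProd])⟩
    rcases List.eq_nil_or_concat' t with rfl | ⟨t, j, rfl⟩
    · exact ⟨1, one_mem _, Or.inr (Or.inl ⟨i, by simp [wordProd_singleton]⟩)⟩
    by_cases hij : i = j
    · subst hij
      have ht : t.IsChain (· ≠ ·) := (List.IsChain.tail hl).left_of_append
      obtain ⟨δ, hδ, h⟩ := ih t.length (by rw [← hn]; simp) t ht rfl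
      refine ⟨δ * rho (f i), mul_mem hδ (rho_mem_halfTurnGroup i), ?_⟩
      have e : δ * rho (f i) * wordProd f (i :: (t ++ [i])) * (δ * rho (f i))⁻¹ =
          δ * wordProd f t * δ⁻¹ := by
        rw [wordProd_cons, wordProd_append, wordProd_singleton, mul_inv_rev, rho_inv,
          show δ * rho (f i) * (rho (f i) * (wordProd f t * rho (f i))) * (rho (f i) * δ⁻¹) =
            δ * (rho (f i) * rho (f i)) * wordProd f t * (rho (f i) * rho (f i)) * δ⁻¹ by
              simp only [mul_assoc], rho_mul_self, mul_one, mul_one]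
      rw [e]
      exact h
    · refine ⟨1, one_mem _, Or.inr (Or.inr ⟨i, j, hij, fun z hz => ?_⟩)⟩
      rw [one_mul, inv_one, mul_one]
      exact sp.wordProd_smul t i j hl hz

theorem isOpen_openPoly [Finite ι] : IsOpen (openPoly s) := by
  have : openPoly s = ⋂ i, {z | 0 < s i z} := by ext; simp [openPoly]
  rw [this]
  exact isOpen_iInter_of_finite fun i => isOpen_lt continuous_const (sp.continuous i)

theorem isClosed_closedPoly : IsClosed (closedPoly s) := by
  have : closedPoly s = ⋂ i, {z | 0 ≤ s i z} := by ext; simp [closedPoly]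
  rw [this]
  exact isClosed_iInter fun i => isClosed_le continuous_const (sp.continuous i)

theorem disjoint_smul {γ : PSL(2, ℝ)} (hγ : γ ∈ halfTurnGroup f) (h1 : γ ≠ 1) :
    Disjoint (γ • openPoly s) (openPoly s) := by
  rw [Set.disjoint_left]
  rintro _ ⟨z, hz, rfl⟩ hγz
  rcases sp.eq_of_smul_mem hγ (fun i => (hz i).le) (fun i => (hγz i).le) with h | ⟨i, -, h⟩
  · exact h1 h
  · exact (hz i).ne' h

/-- Every point of the closed polygon has a neighbourhood `N` all of whose points are taken back to
the closed polygon by `1` or by a single half-turn. -/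
theorem exists_nhds [Finite ι] {z : ℍ} (hz : z ∈ closedPoly s) :
    ∃ N ∈ 𝓝 z, ∃ γ ∈ halfTurnGroup f, ∀ w ∈ N, w ∈ closedPoly s ∨ γ • w ∈ closedPoly s := by
  by_cases h : ∃ i, s i z = 0
  · obtain ⟨i, hi⟩ := h
    -- Both `z` and its image under the half-turn lie on side `i`, away from the other sides; this
    -- persists nearby, so only the sign of `s i w` matters.
    have h1 : ∀ᶠ w in 𝓝 z, ∀ j, j ≠ i → 0 < s j w := by
      refine Filter.eventually_all.2 fun j => ?_
      by_cases hj : j = i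
      · exact Filter.Eventually.of_forall fun w h => absurd hj h
      · exact ((sp.continuous j).tendsto z).eventually_const_lt
          (sp.pos_of_nonpos hj hi.le) |>.mono fun w h _ => h
    have h2 : ∀ᶠ w in 𝓝 z, ∀ j, j ≠ i → 0 < s j (rho (f i) • w) := by
      refine Filter.eventually_all.2 fun j => ?_
      by_cases hj : j = i
      · exact Filter.Eventually.of_forall fun w h => absurd hj h
      · exact (((sp.continuous j).comp (continuous_const_smul (rho (f i)))).tendsto
          z).eventually_const_lt (sp.pos_of_nonpos hj (sp.flip_zero hi).le) |>.mono fun w h _ => h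
    refine ⟨_, h1.and h2, rho (f i), rho_mem_halfTurnGroup i, ?_⟩
    rintro w ⟨hw1, hw2⟩
    rcases le_or_gt 0 (s i w) with h | h
    · left
      intro j
      by_cases hj : j = i
      · rwa [hj]
      · exact (hw1 j hj).le
    · right
      intro j
      by_cases hj : j = i
      · rw [hj]
        exact (sp.flip_pos h).le
      · exact (hw2 j hj).le
  · push Not at h
    refine ⟨openPoly s, sp.isOpen_openPoly.mem_nhds fun i => (hz i).lt_of_ne' (h i), 1, one_mem _, ?_⟩
    intro w hw
    exact Or.inl fun i => (hw i).le

variable (hcov : ∀ z, ∃ γ ∈ halfTurnGroup f, γ • z ∈ closedPoly s)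
include hcov

/-- After moving `z` into the polygon, a nearby point is brought back by `1` or by one fixed
element, and `eq_of_smul_mem` leaves finitely many candidates in each case. -/
theorem exists_nhds_finite [Finite ι] (z : ℍ) :
    ∃ N ∈ 𝓝 z, {γ : halfTurnGroup f | ((γ • closedPoly s) ∩ N).Nonempty}.Finite := by
  obtain ⟨δ, hδ, hz⟩ := hcov z
  obtain ⟨N, hN, ε, hε, h⟩ := sp.exists_nhds hz
  refine ⟨(δ • ·) ⁻¹' N, (continuous_const_smul δ).continuousAt.preimage_mem_nhds hN, ?_⟩
  set R : Set (halfTurnGroup f) := insert 1 (Set.range fun i =>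
    (⟨rho (f i), rho_mem_halfTurnGroup i⟩ : halfTurnGroup f)) with hR
  have hRf : R.Finite := (Set.finite_range _).insert 1
  have key : ∀ (γ : halfTurnGroup f) (q : ℍ), q ∈ closedPoly s → γ • q ∈ closedPoly s → γ ∈ R := by
    rintro ⟨γ, hγ⟩ q hq hw
    rcases sp.eq_of_smul_mem hγ hq hw with h | ⟨i, h, -⟩
    · left
      exact Subtype.ext h
    · right
      exact ⟨i, Subtype.ext h.symm⟩
  let d : halfTurnGroup f := ⟨δ, hδ⟩
  let e : halfTurnGroup f := ⟨ε, hε⟩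
  refine ((hRf.image fun r => d⁻¹ * r).union (hRf.image fun r => d⁻¹ * e⁻¹ * r)).subset ?_
  rintro γ ⟨w, ⟨q, hq, rfl⟩, hw⟩
  rcases h _ hw with h | h
  · left
    refine ⟨d * γ, key _ q hq ?_, by simp⟩
    rw [mul_smul]
    exact h
  · right
    refine ⟨e * d * γ, key _ q hq ?_, by group⟩
    rw [mul_smul, mul_smul]
    exact h

theorem locallyFinite [Finite ι] :
    LocallyFinite fun γ : halfTurnGroup f => γ • closedPoly s := fun z => by
  obtain ⟨N, hN, h⟩ := sp.exists_nhds_finite hcov z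
  exact ⟨N, hN, h⟩

theorem isFundamentalDomain [Finite ι] (hcl : closure (openPoly s) = closedPoly s)
    (hconn : IsConnected (openPoly s))
    (hnull : MeasureTheory.volume (frontier (openPoly s)) = 0) :
    IsFundamentalDomain (halfTurnGroup f) (openPoly s) where
  isOpen := sp.isOpen_openPoly
  isConnected := hconn
  null_frontier := hnull
  disjoint γ hγ h1 := sp.disjoint_smul hγ h1
  covers z := by
    obtain ⟨γ, hγ, h⟩ := hcov z
    refine ⟨γ⁻¹, inv_mem hγ, ?_⟩
    rwa [hcl, Set.mem_inv_smul_set_iff]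
  locally_finite K hK := by
    rw [hcl]
    exact (sp.locallyFinite hcov).finite_nonempty_inter_compact hK

/-- Move the fixed point into the polygon: there the conjugated element can only be a half-turn,
which fixes nothing but its center. -/
theorem mem_ellipticPoints_iff {z : ℍ} :
    z ∈ ellipticPoints (halfTurnGroup f) ↔ ∃ i, ∃ γ ∈ halfTurnGroup f, γ • f i = z := by
  constructor
  · rintro ⟨γ, hγ, h1, h⟩
    obtain ⟨δ, hδ, hz⟩ := hcov z
    have h2 : (δ * γ * δ⁻¹) • δ • z = δ • z := by
      rw [mul_smul, mul_smul, inv_smul_smul, h]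
    have h3 := sp.eq_of_smul_mem (mul_mem (mul_mem hδ hγ) (inv_mem hδ)) hz (by rwa [h2])
    rcases h3 with h3 | ⟨i, h3, -⟩
    · refine absurd ?_ h1
      rw [mul_inv_eq_one] at h3
      exact mul_eq_left.1 h3
    · rw [h3, rho_smul_eq_self_iff] at h2
      exact ⟨i, δ⁻¹, inv_mem hδ, by rw [← h2, inv_smul_smul]⟩
  · rintro ⟨i, γ, hγ, rfl⟩
    refine ⟨γ * rho (f i) * γ⁻¹, mul_mem (mul_mem hγ (rho_mem_halfTurnGroup i)) (inv_mem hγ), ?_, ?_⟩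
    · rw [rho_conj]
      exact rho_ne_one _
    · rw [rho_conj, rho_smul_self]

omit hcov in
theorem eq_of_smul_center {i j : ι} {γ : PSL(2, ℝ)} (hγ : γ ∈ halfTurnGroup f)
    (h : γ • f i = f j) : i = j := by
  have h1 := sp.eq_of_smul_mem hγ (sp.center_mem_closedPoly i)
    (by rw [h]; exact sp.center_mem_closedPoly j)
  rcases h1 with h1 | ⟨k, h1, hk⟩
  · rw [h1, one_smul] at h
    exact sp.eq_of_nonpos (f i) i j (sp.center i).le (by rw [h]; exact (sp.center j).le)
  · have : k = i := sp.eq_of_nonpos (f i) k i hk.le (sp.center i).le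
    rw [h1, this, rho_smul_self] at h
    exact sp.eq_of_nonpos (f i) i j (sp.center i).le (by rw [h]; exact (sp.center j).le)

omit hcov in
theorem card_stabilizer (i : ι) : Nat.card (MulAction.stabilizer (halfTurnGroup f) (f i)) = 2 := by
  let a : MulAction.stabilizer (halfTurnGroup f) (f i) :=
    ⟨⟨rho (f i), rho_mem_halfTurnGroup i⟩, rho_smul_self (f i)⟩
  rw [Nat.card_eq_two_iff' 1]
  refine ⟨a, ?_, ?_⟩
  · intro h
    exact rho_ne_one (f i) (congrArg (fun x : MulAction.stabilizer (halfTurnGroup f) (f i) =>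
      (x : PSL(2, ℝ))) h)
  · rintro ⟨⟨γ, hγ⟩, hs⟩ h1
    have hs' : γ • f i = f i := hs
    have h2 := sp.eq_of_smul_mem hγ (sp.center_mem_closedPoly i)
      (by rw [hs']; exact sp.center_mem_closedPoly i)
    rcases h2 with h2 | ⟨k, h2, hk⟩
    · exact absurd (Subtype.ext (Subtype.ext h2)) h1
    · have : k = i := sp.eq_of_nonpos (f i) k i hk.le (sp.center i).le
      subst this
      exact Subtype.ext (Subtype.ext h2)

/-- If `F` is a closed continuous surjection from the closed polygon onto the plane whose fibers are
the orbits of the side pairing, then the quotient is homeomorphic to the plane. -/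
theorem nonempty_quotient_homeomorph [Finite ι] (F : ℍ → ℂ) (hF : ContinuousOn F (closedPoly s))
    (hclosed : ∀ A ⊆ closedPoly s, IsClosed A → IsClosed (F '' A))
    (hsurj : ∀ w, ∃ z ∈ closedPoly s, F z = w)
    (hpair : ∀ i z, s i z = 0 → F (rho (f i) • z) = F z)
    (hinj : ∀ z ∈ closedPoly s, ∀ z' ∈ closedPoly s, F z = F z' →
      z = z' ∨ ∃ i, z' = rho (f i) • z) :
    Nonempty (Quotient (MulAction.orbitRel (halfTurnGroup f) ℍ) ≃ₜ ℂ) := by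
  choose g hgm hg using hcov
  -- The invariant extension of `F`; it does not depend on the choice of `g z`, because two choices
  -- differ by a side pairing.
  let G : ℍ → ℂ := fun z => F (g z • z)
  have hG : ∀ γ ∈ halfTurnGroup f, ∀ z, γ • z ∈ closedPoly s → G z = F (γ • z) := by
    intro γ hγ z hz
    have h1 : (γ * (g z)⁻¹) • (g z • z) = γ • z := by rw [mul_smul, inv_smul_smul]
    rcases sp.eq_of_smul_mem (mul_mem hγ (inv_mem (hgm z))) (hg z) (by rwa [h1]) with h | ⟨i, h, hi⟩
    · rw [← h1, h, one_smul]
    · rw [← h1, h, hpair i _ hi]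
  have hinv : ∀ (γ : halfTurnGroup f) z, G (γ • z) = G z := by
    rintro ⟨γ, hγ⟩ z
    rw [hG (g (γ • z) * γ) (mul_mem (hgm _) hγ) z (by rw [mul_smul]; exact hg _), mul_smul]
    rfl
  -- A preimage is a locally finite union of translates of closed sets, which yields continuity.
  have hpre : ∀ C : Set ℂ, G ⁻¹' C =
      ⋃ γ : halfTurnGroup f, γ • (closedPoly s ∩ F ⁻¹' C) := by
    intro C
    ext z
    simp only [Set.mem_preimage, Set.mem_iUnion, Set.mem_smul_set_iff_inv_smul_mem]
    constructor
    · intro h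
      exact ⟨⟨g z, hgm z⟩⁻¹, by rw [inv_inv]; exact ⟨hg z, h⟩⟩
    · rintro ⟨γ, h1, h2⟩
      have := hG γ⁻¹ (inv_mem γ.2) z h1
      rw [this]
      exact h2
  have hcont : Continuous G := by
    refine continuous_iff_isClosed.2 fun C hC => ?_
    rw [hpre]
    refine LocallyFinite.isClosed_iUnion ?_ fun γ => ?_
    · exact (sp.locallyFinite fun z => ⟨g z, hgm z, hg z⟩).subset
        fun γ => Set.smul_set_mono Set.inter_subset_left
    · exact (hF.preimage_isClosed_of_isClosed sp.isClosed_closedPoly hC).smul γ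
  let Φ : Quotient (MulAction.orbitRel (halfTurnGroup f) ℍ) → ℂ := Quotient.lift G (by
    rintro z _ ⟨γ, rfl⟩
    exact hinv γ _)
  have hbij : Function.Bijective Φ := by
    constructor
    · intro a b
      induction a using Quotient.inductionOn with | _ z
      induction b using Quotient.inductionOn with | _ z'
      intro h
      refine Quotient.sound ?_
      change ∃ γ : halfTurnGroup f, γ • z' = z
      have h' : F (g z • z) = F (g z' • z') := h
      rcases hinj _ (hg z) _ (hg z') h' with h | ⟨i, h⟩
      · refine ⟨⟨(g z)⁻¹ * g z', mul_mem (inv_mem (hgm z)) (hgm z')⟩, ?_⟩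
        change ((g z)⁻¹ * g z') • z' = z
        rw [mul_smul, ← h, inv_smul_smul]
      · refine ⟨⟨(g z)⁻¹ * (rho (f i) * g z'), mul_mem (inv_mem (hgm z))
          (mul_mem (rho_mem_halfTurnGroup i) (hgm z'))⟩, ?_⟩
        change ((g z)⁻¹ * (rho (f i) * g z')) • z' = z
        rw [mul_smul, mul_smul, h, rho_smul_rho_smul, inv_smul_smul]
    · intro w
      obtain ⟨z, hz, rfl⟩ := hsurj w
      refine ⟨Quotient.mk _ z, ?_⟩
      change G z = _
      rw [hG 1 (one_mem _) z (by rwa [one_smul]), one_smul]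
  have hΦc : Continuous Φ := hcont.quotient_lift _
  -- A closed set of the quotient has the same image as its part in the polygon, where `F` is
  -- closed.
  have hΦcl : IsClosedMap Φ := by
    intro C hC
    have hA : IsClosed (Quotient.mk (MulAction.orbitRel (halfTurnGroup f) ℍ) ⁻¹' C) :=
      hC.preimage continuous_quotient_mk'
    have : Φ '' C = F '' (closedPoly s ∩
        Quotient.mk (MulAction.orbitRel (halfTurnGroup f) ℍ) ⁻¹' C) := by
      ext w
      constructor
      · rintro ⟨a, ha, rfl⟩
        induction a using Quotient.inductionOn with | _ z
        refine ⟨g z • z, ⟨hg z, ?_⟩, rfl⟩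
        have : Quotient.mk (MulAction.orbitRel (halfTurnGroup f) ℍ) (g z • z) = Quotient.mk _ z :=
          Quotient.sound ⟨⟨g z, hgm z⟩, rfl⟩
        rw [Set.mem_preimage, this]
        exact ha
      · rintro ⟨z, ⟨hz, hz'⟩, rfl⟩
        refine ⟨_, hz', ?_⟩
        change G z = _
        rw [hG 1 (one_mem _) z (by rwa [one_smul]), one_smul]
    rw [this]
    exact hclosed _ Set.inter_subset_left (sp.isClosed_closedPoly.inter hA)
  exact ⟨(Equiv.ofBijective Φ hbij).toHomeomorphOfContinuousClosed hΦc hΦcl⟩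

end SidePairing

end

/-- The complement of the point at infinity in the Riemann sphere is the plane. -/
theorem nonempty_homeomorph_compl_infty :
    Nonempty (ℂ ≃ₜ {p : OnePoint ℂ // p ∉ ({OnePoint.infty} : Finset (OnePoint ℂ))}) := by
  have e := (OnePoint.isOpenEmbedding_coe (X := ℂ)).isEmbedding.toHomeomorph
  refine ⟨e.trans (Homeomorph.setCongr ?_)⟩
  ext p
  change _ ↔ p ∉ ({OnePoint.infty} : Finset (OnePoint ℂ))
  rw [Finset.mem_singleton, Set.mem_range, ← OnePoint.ne_infty_iff_exists]

end HypPlane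

/-! ### The ideal polygon and its half-turns; convexity in the coordinates `(x, x² + y²)`. -/

namespace HypPlane

open UpperHalfPlane Topology

/-- The point `a + b i` of the upper half plane with `b ^ 2 = c`. -/
noncomputable def ptOfSq (a c : ℝ) : ℍ := ofComplex ⟨a, √c⟩

theorem ptOfSq_re {a c : ℝ} (hc : 0 < c) : (ptOfSq a c).re = a := by
  rw [ptOfSq, ofComplex_apply_of_im_pos (by simpa using hc)]
  rfl

theorem ptOfSq_im {a c : ℝ} (hc : 0 < c) : (ptOfSq a c).im = √c := by
  rw [ptOfSq, ofComplex_apply_of_im_pos (by simpa using hc)]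
  rfl

theorem ptOfSq_im_sq {a c : ℝ} (hc : 0 < c) : (ptOfSq a c).im ^ 2 = c := by
  rw [ptOfSq_im hc, Real.sq_sqrt hc.le]

theorem ptOfSq_re_im (z : ℍ) : ptOfSq z.re (z.im ^ 2) = z := by
  have := z.im_pos
  refine ext_re_im (ptOfSq_re (by positivity)) ?_
  rw [ptOfSq_im (by positivity), Real.sqrt_sq this.le]

/-- Inverse of the chart `z ↦ (x, x² + y²)`, in which geodesics become straight; it carries
convexity arguments back to `ℍ`. -/
theorem continuousOn_ptOfSq :
    ContinuousOn (fun p : ℝ × ℝ => ptOfSq p.1 (p.2 - p.1 ^ 2)) {p | p.1 ^ 2 < p.2} := by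
  unfold ptOfSq
  have h1 : Continuous fun p : ℝ × ℝ => (⟨p.1, √(p.2 - p.1 ^ 2)⟩ : ℂ) := by
    have : (fun p : ℝ × ℝ => (⟨p.1, √(p.2 - p.1 ^ 2)⟩ : ℂ)) =
        fun p : ℝ × ℝ => ((p.1 : ℂ) + (√(p.2 - p.1 ^ 2) : ℝ) * Complex.I) := by
      funext p
      exact Complex.ext (by simp) (by simp)
    rw [this]
    fun_prop
  refine ContinuousOn.comp (t := {w : ℂ | 0 < w.im}) ?_ h1.continuousOn ?_
  · have := ofComplex.continuousOn
    refine this.mono fun w hw => ?_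
    have : ofComplex.source = Set.range UpperHalfPlane.coe := by
      simp [ofComplex]
    rw [this, range_coe]
    exact hw
  · intro p hp
    have : p.1 ^ 2 < p.2 := hp
    simpa using this

/-- The sides of the ideal polygon with vertices `v 0 < ⋯ < v N` and `∞`, given by functions that are
positive on the polygon. -/
def side (N : ℕ) (v : ℕ → ℝ) : ℕ → ℍ → ℝ
  | 0, z => z.re - v 0
  | k + 1, z => if k < N then (z.re - v k) * (z.re - v (k + 1)) + z.im ^ 2 else v N - z.re

/-- The centers of the half-turns: the half-turns permute the horodiscs of diameter `h k` at `v k` and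
the horodisc of height one at `∞`. -/
noncomputable def center (N : ℕ) (v h : ℕ → ℝ) : ℕ → ℍ
  | 0 => ptOfSq (v 0) (h 0)
  | k + 1 => if k < N then
      ptOfSq ((h (k + 1) * v k + h k * v (k + 1)) / (h k + h (k + 1)))
        (h k * h (k + 1) * (v (k + 1) - v k) ^ 2 / (h k + h (k + 1)) ^ 2)
      else ptOfSq (v N) (h N)

section

variable {N : ℕ} {v h : ℕ → ℝ}

theorem side_zero (z : ℍ) : side N v 0 z = z.re - v 0 := rfl

theorem side_succ {k : ℕ} (hk : k < N) (z : ℍ) :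
    side N v (k + 1) z = (z.re - v k) * (z.re - v (k + 1)) + z.im ^ 2 := if_pos hk

theorem side_last (z : ℍ) : side N v (N + 1) z = v N - z.re := if_neg (lt_irrefl N)

theorem center_zero_def : center N v h 0 = ptOfSq (v 0) (h 0) := rfl

theorem center_succ {k : ℕ} (hk : k < N) : center N v h (k + 1) =
    ptOfSq ((h (k + 1) * v k + h k * v (k + 1)) / (h k + h (k + 1)))
        (h k * h (k + 1) * (v (k + 1) - v k) ^ 2 / (h k + h (k + 1)) ^ 2) := if_pos hk

theorem center_last : center N v h (N + 1) = ptOfSq (v N) (h N) := if_neg (lt_irrefl N)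

theorem forall_fin_add_two {p : ℕ → Prop} (h0 : p 0) (hs : ∀ k < N, p (k + 1)) (hl : p (N + 1))
    (i : Fin (N + 2)) : p i := by
  obtain ⟨i, hi⟩ := i
  rcases i with _ | k
  · exact h0
  · rcases (show k < N ∨ k = N by omega) with hk | rfl
    · exact hs k hk
    · exact hl

theorem continuous_side (i : ℕ) : Continuous (side N v i) := by
  rcases i with _ | k
  · exact continuous_re.sub continuous_const
  · by_cases hk : k < N
    · have : side N v (k + 1) = fun z => (z.re - v k) * (z.re - v (k + 1)) + z.im ^ 2 :=
        funext (side_succ hk)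
      rw [this]
      exact ((continuous_re.sub continuous_const).mul (continuous_re.sub continuous_const)).add
        (continuous_im.pow 2)
    · have : side N v (k + 1) = fun z => v N - z.re := funext fun z => if_neg hk
      rw [this]
      exact continuous_const.sub continuous_re

/-- Points of `ℍ` have positive height, so the half disc projects into the open interval between its
end points. -/
theorem re_lt_of_side_nonpos (hv : StrictMono v) {k : ℕ} (hk : k < N) {z : ℍ}
    (hz : side N v (k + 1) z ≤ 0) : v k < z.re ∧ z.re < v (k + 1) := by
  rw [side_succ hk] at hz
  have h1 := z.im_pos
  have h2 : v k < v (k + 1) := hv (Nat.lt_succ_self k)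
  constructor <;> by_contra h3 <;> nlinarith

variable (hv : StrictMono v) (hh : ∀ k, 0 < h k)
include hv hh

theorem center_sq_pos (k : ℕ) :
    0 < h k * h (k + 1) * (v (k + 1) - v k) ^ 2 / (h k + h (k + 1)) ^ 2 := by
  have h1 := hh k
  have h2 := hh (k + 1)
  have h3 : 0 < v (k + 1) - v k := sub_pos.2 (hv (Nat.lt_succ_self k))
  positivity

theorem center_succ_re {k : ℕ} (hk : k < N) : (center N v h (k + 1)).re =
    (h (k + 1) * v k + h k * v (k + 1)) / (h k + h (k + 1)) := by
  rw [center_succ hk, ptOfSq_re (center_sq_pos hv hh k)]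

theorem center_succ_im_sq {k : ℕ} (hk : k < N) : (center N v h (k + 1)).im ^ 2 =
    h k * h (k + 1) * (v (k + 1) - v k) ^ 2 / (h k + h (k + 1)) ^ 2 := by
  rw [center_succ hk, ptOfSq_im_sq (center_sq_pos hv hh k)]

theorem side_center {i : ℕ} : side N v i (center N v h i) = 0 := by
  rcases i with _ | k
  · rw [side_zero, center_zero_def, ptOfSq_re (hh 0), sub_self]
  · by_cases hk : k < N
    · rw [side_succ hk, center_succ_re hv hh hk, center_succ_im_sq hv hh hk]
      have h1 := hh k
      have h2 := hh (k + 1)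
      have h3 : h k + h (k + 1) ≠ 0 := by positivity
      field_simp
      ring
    · have e1 : side N v (k + 1) = fun z => v N - z.re := funext fun z => if_neg hk
      have e2 : center N v h (k + 1) = ptOfSq (v N) (h N) := if_neg hk
      rw [e1, e2]
      simp only
      rw [ptOfSq_re (hh N), sub_self]

theorem side_rho_smul (i : ℕ) (z : ℍ) :
    ∃ c > 0, side N v i (rho (center N v h i) • z) = -(c * side N v i z) := by
  have hm := sq_add_sq_im_pos z (center N v h i).re
  have hb := (center N v h i).im_pos
  -- This factor is the quotient of the imaginary parts of the image point and of `z`.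
  refine ⟨(center N v h i).im ^ 2 / ((z.re - (center N v h i).re) ^ 2 + z.im ^ 2),
    by positivity, ?_⟩
  rcases i with _ | k
  · rw [side_zero, side_zero, rho_smul_re, center_zero_def, ptOfSq_re (hh 0)]
    ring
  · by_cases hk : k < N
    · rw [side_succ hk, side_succ hk, rho_smul_re, rho_smul_im]
      have e : (center N v h (k + 1)).im ^ 2 =
        ((center N v h (k + 1)).re - v k) * (v (k + 1) - (center N v h (k + 1)).re) := by
        have := side_center hv hh (i := k + 1) (N := N)
        rw [side_succ hk] at this
        linarith
      rw [e]
      generalize (center N v h (k + 1)).re = a at *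
      field_simp
      ring
    · have e1 : side N v (k + 1) = fun z => v N - z.re := funext fun z => if_neg hk
      have e2 : center N v h (k + 1) = ptOfSq (v N) (h N) := if_neg hk
      rw [e1, e2] at *
      simp only
      rw [rho_smul_re, ptOfSq_re (hh N)]
      ring

omit hh in
-- The half planes project to consecutive intervals of the real axis. Neighbours share at most an
-- end point, which the open interval under a semicircle excludes; `1 ≤ N` separates the two
-- vertical sides.
theorem eq_of_side_nonpos (hN : 1 ≤ N) (z : ℍ) {i j : ℕ} (hi : i < N + 2) (hj : j < N + 2)
    (h1 : side N v i z ≤ 0) (h2 : side N v j z ≤ 0) : i = j := by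
  wlog hij : i < j generalizing i j
  · rcases (not_lt.1 hij).lt_or_eq with h | h
    · exact (this hj hi h2 h1 h).symm
    · exact h.symm
  exfalso
  rcases j with _ | j
  · omega
  have hlow : v j ≤ z.re := by
    rcases (show j < N ∨ j = N by omega) with hk | rfl
    · exact (re_lt_of_side_nonpos hv hk h2).1.le
    · rw [side_last] at h2
      linarith
  rcases i with _ | i
  · rw [side_zero] at h1
    rcases (show j < N ∨ j = N by omega) with hk | rfl
    · have := (re_lt_of_side_nonpos hv hk h2).1
      have := hv.monotone (Nat.zero_le j)
      linarith
    · have := hv (show 0 < j by omega)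
      linarith
  · have h3 := (re_lt_of_side_nonpos hv (show i < N by omega) h1).2
    have := hv.monotone (show i + 1 ≤ j by omega)
    linarith

theorem sidePairing (hN : 1 ≤ N) :
    SidePairing (fun i : Fin (N + 2) => center N v h i) (fun i => side N v i) where
  continuous i := continuous_side i
  eq_of_nonpos z i j h1 h2 := Fin.ext (eq_of_side_nonpos hv hN z i.2 j.2 h1 h2)
  center _ := side_center hv hh
  flip i z := side_rho_smul hv hh i z

end

section

variable {N : ℕ} {v h : ℕ → ℝ}

/-- The sides of the polygon as affine functions of `(x, x ^ 2 + y ^ 2)`. -/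
def affineSide (N : ℕ) (v : ℕ → ℝ) : ℕ → ℝ × ℝ → ℝ
  | 0, p => p.1 - v 0
  | k + 1, p => if k < N then p.2 - (v k + v (k + 1)) * p.1 + v k * v (k + 1) else v N - p.1

theorem affineSide_re (i : ℕ) (z : ℍ) :
    affineSide N v i (z.re, z.re ^ 2 + z.im ^ 2) = side N v i z := by
  rcases i with _ | k
  · rfl
  · simp only [affineSide, side]
    split_ifs
    · ring
    · rfl

theorem affineSide_combo (i : ℕ) (p q : ℝ × ℝ) {a b : ℝ} (hab : a + b = 1) :
    affineSide N v i (a • p + b • q) = a * affineSide N v i p + b * affineSide N v i q := by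
  obtain rfl : a = 1 - b := by linarith
  rcases i with _ | k
  · simp [affineSide]
    ring
  · simp only [affineSide]
    split_ifs <;> simp <;> ring

/-- The open polygon in the coordinates `(x, x ^ 2 + y ^ 2)`. -/
def kleinPoly (N : ℕ) (v : ℕ → ℝ) : Set (ℝ × ℝ) :=
  {p | p.1 ^ 2 < p.2 ∧ ∀ i : Fin (N + 2), 0 < affineSide N v i p}

/-- The region above the parabola is convex and the sides are affine. The point `p` may lie on
sides, which serves for closures as well as for convexity. -/
theorem combo_mem_kleinPoly {p q : ℝ × ℝ} (hp : p.1 ^ 2 < p.2)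
    (hp' : ∀ i : Fin (N + 2), 0 ≤ affineSide N v i p) (hq : q ∈ kleinPoly N v) {a b : ℝ}
    (ha : 0 ≤ a) (hb : 0 < b) (hab : a + b = 1) : a • p + b • q ∈ kleinPoly N v := by
  constructor
  · have h1 := hq.1
    simp only [Prod.fst_add, Prod.snd_add, Prod.smul_fst, Prod.smul_snd, smul_eq_mul]
    obtain rfl : a = 1 - b := by linarith
    nlinarith [mul_nonneg (mul_nonneg ha hb.le) (sq_nonneg (p.1 - q.1)), mul_pos hb (sub_pos.2 h1),
      mul_nonneg ha (sub_pos.2 hp).le]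
  · intro i
    rw [affineSide_combo _ _ _ hab]
    have h1 := mul_nonneg ha (hp' i)
    have h2 := mul_pos hb (hq.2 i)
    linarith

theorem convex_kleinPoly : Convex ℝ (kleinPoly N v) := by
  intro p hp q hq a b ha hb hab
  rcases hb.eq_or_lt with rfl | hb
  · obtain rfl : a = 1 := by linarith
    simpa using hp
  · exact combo_mem_kleinPoly hp.1 (fun i => (hp.2 i).le) hq ha hb hab

theorem openPoly_eq_image : openPoly (fun i : Fin (N + 2) => side N v i) =
    (fun p : ℝ × ℝ => ptOfSq p.1 (p.2 - p.1 ^ 2)) '' kleinPoly N v := by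
  ext z
  constructor
  · intro hz
    refine ⟨(z.re, z.re ^ 2 + z.im ^ 2), ⟨?_, fun i => ?_⟩, ?_⟩
    · have := z.im_pos
      simp only
      nlinarith
    · rw [affineSide_re]
      exact hz i
    · simp only [add_sub_cancel_left]
      exact ptOfSq_re_im z
  · rintro ⟨p, hp, rfl⟩ i
    have h1 : 0 < p.2 - p.1 ^ 2 := sub_pos.2 hp.1
    simp only
    rw [← affineSide_re, ptOfSq_re h1, ptOfSq_im_sq h1]
    simpa using hp.2 i

theorem openPoly_nonempty (hv : StrictMono v) (hN : 1 ≤ N) :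
    (openPoly (fun i : Fin (N + 2) => side N v i)).Nonempty := by
  have h0 : v 0 < v N := hv (by omega)
  have h1 : 0 < (v N - v 0) ^ 2 := by
    have : 0 < v N - v 0 := by linarith
    positivity
  -- At height `v N - v 0` the midpoint is above every semicircle, as their radii are at most half
  -- of that.
  refine ⟨ptOfSq ((v 0 + v N) / 2) ((v N - v 0) ^ 2), ?_⟩
  refine forall_fin_add_two (p := fun i => 0 < side N v i _) ?_ (fun k hk => ?_) ?_
  · rw [side_zero, ptOfSq_re h1]
    linarith
  · rw [side_succ hk, ptOfSq_re h1, ptOfSq_im_sq h1]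
    have h2 := hv.monotone (Nat.zero_le k)
    have h3 : v k < v (k + 1) := hv (Nat.lt_succ_self k)
    have h4 := hv.monotone (show k + 1 ≤ N by omega)
    nlinarith [sq_nonneg ((v 0 + v N) / 2 - v k + ((v 0 + v N) / 2 - v (k + 1)))]
  · rw [side_last, ptOfSq_re h1]
    linarith

theorem isConnected_openPoly (hv : StrictMono v) (hN : 1 ≤ N) :
    IsConnected (openPoly (fun i : Fin (N + 2) => side N v i)) := by
  refine ⟨openPoly_nonempty hv hN, ?_⟩
  rw [openPoly_eq_image]
  exact convex_kleinPoly.isPreconnected.image _ (continuousOn_ptOfSq.mono fun p hp => hp.1)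

/-- In the straight coordinates, the segment from a point of the closed polygon to an interior point
runs in the open polygon. -/
theorem closure_openPoly (hv : StrictMono v) (hN : 1 ≤ N) :
    closure (openPoly (fun i : Fin (N + 2) => side N v i)) =
      closedPoly (fun i : Fin (N + 2) => side N v i) := by
  refine subset_antisymm ?_ fun z hz => ?_
  · have hcl : IsClosed (closedPoly (fun i : Fin (N + 2) => side N v i)) := by
      have : closedPoly (fun i : Fin (N + 2) => side N v i) =
          ⋂ i : Fin (N + 2), {z | 0 ≤ side N v i z} := by
        ext
        simp [closedPoly]
      rw [this]
      exact isClosed_iInter fun i => isClosed_le continuous_const (continuous_side _)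
    exact closure_minimal (fun z hz i => (hz i).le) hcl
  · obtain ⟨w, hw⟩ := openPoly_nonempty hv hN
    rw [openPoly_eq_image] at hw ⊢
    obtain ⟨q, hq, -⟩ := hw
    set p : ℝ × ℝ := (z.re, z.re ^ 2 + z.im ^ 2) with hp
    have hp1 : p.1 ^ 2 < p.2 := by
      have := z.im_pos
      rw [hp]
      simp only
      nlinarith
    have hp2 : ∀ i : Fin (N + 2), 0 ≤ affineSide N v i p := fun i => by
      rw [hp, affineSide_re]
      exact hz i
    have hpc : p ∈ closure (kleinPoly N v) := by
      have h1 : openSegment ℝ p q ⊆ kleinPoly N v := by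
        rintro _ ⟨a, b, ha, hb, hab, rfl⟩
        exact combo_mem_kleinPoly hp1 hp2 hq ha.le hb hab
      exact closure_mono h1 (by
        rw [closure_openSegment]
        exact left_mem_segment ℝ p q)
    have hz' : z = (fun p : ℝ × ℝ => ptOfSq p.1 (p.2 - p.1 ^ 2)) p := by
      simp only [hp, add_sub_cancel_left]
      exact (ptOfSq_re_im z).symm
    rw [hz']
    exact ((continuousOn_ptOfSq p hp1).mono fun p hp => hp.1).mem_closure_image hpc

theorem volume_setOf_re_eq (c : ℝ) : MeasureTheory.volume {z : ℍ | z.re = c} = 0 := by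
  rw [volume_eq_lintegral]
  refine MeasureTheory.setLIntegral_measure_zero _ _ ?_
  have h1 := (convex_halfSpace_re_le c).addHaar_frontier (MeasureTheory.volume : MeasureTheory.Measure ℂ)
  rw [Complex.frontier_setOfPred_re_le] at h1
  refine MeasureTheory.measure_mono_null ?_ h1
  rintro _ ⟨z, hz, rfl⟩
  exact hz

theorem volume_semicircle (u w : ℝ) :
    MeasureTheory.volume {z : ℍ | (z.re - u) * (z.re - w) + z.im ^ 2 = 0} = 0 := by
  rw [volume_eq_lintegral]
  refine MeasureTheory.setLIntegral_measure_zero _ _ ?_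
  refine MeasureTheory.measure_mono_null ?_
    (MeasureTheory.Measure.addHaar_sphere MeasureTheory.volume (((u + w) / 2 : ℝ) : ℂ)
      (|(w - u) / 2|))
  rintro _ ⟨z, hz, rfl⟩
  have hz' : (z.re - u) * (z.re - w) + z.im ^ 2 = 0 := hz
  rw [mem_sphere_iff_norm, ← sq_eq_sq₀ (norm_nonneg _) (abs_nonneg _), sq_abs,
    ← Complex.normSq_eq_norm_sq, normSq_sub_ofReal]
  linarith

theorem volume_frontier_openPoly (hv : StrictMono v) (hN : 1 ≤ N) :
    MeasureTheory.volume (frontier (openPoly (fun i : Fin (N + 2) => side N v i))) = 0 := by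
  have h1 : frontier (openPoly (fun i : Fin (N + 2) => side N v i)) ⊆
      ⋃ i : Fin (N + 2), {z | side N v i z = 0} := by
    have ho : IsOpen (openPoly (fun i : Fin (N + 2) => side N v i)) := by
      have : openPoly (fun i : Fin (N + 2) => side N v i) =
          ⋂ i : Fin (N + 2), {z | 0 < side N v i z} := by
        ext
        simp [openPoly]
      rw [this]
      exact isOpen_iInter_of_finite fun i => isOpen_lt continuous_const (continuous_side _)
    rw [ho.frontier_eq, closure_openPoly hv hN]
    rintro z ⟨hz, hz'⟩
    have : ∃ i : Fin (N + 2), ¬ 0 < side N v i z := by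
      by_contra h
      push Not at h
      exact hz' h
    obtain ⟨i, hi⟩ := this
    exact Set.mem_iUnion.2 ⟨i, le_antisymm (not_lt.1 hi) (hz i)⟩
  refine MeasureTheory.measure_mono_null h1 (MeasureTheory.measure_iUnion_null fun i => ?_)
  refine forall_fin_add_two (p := fun i => MeasureTheory.volume {z | side N v i z = 0} = 0)
    ?_ (fun k hk => ?_) ?_ i
  · simp only [side_zero, sub_eq_zero]
    exact volume_setOf_re_eq _
  · simp only [side_succ hk]
    exact volume_semicircle _ _
  · simp only [side_last, sub_eq_zero, eq_comm (a := v N)]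
    exact volume_setOf_re_eq _

end

end HypPlane

/-! ### Finite area of the polygon. -/

namespace HypPlane
open UpperHalfPlane Topology MeasureTheory

/-- The horizontal slice at height `y` has length at most `2 * min L (y ^ 2 / κ)` and density `1 / y
^ 2`: the product is bounded near the vertex and at most `2 * L / y ^ 2` towards `∞`. -/
theorem volume_lt_top_of_slices {S : Set ℍ} {κ L u : ℝ} (hκ : 0 < κ)
    (h : ∀ z ∈ S, |z.re - u| ≤ L ∧ κ * |z.re - u| ≤ z.im ^ 2) :
    volume S < ⊤ := by
  rw [volume_eq_lintegral]
  set R : Set (ℝ × ℝ) := {p | 0 < p.2 ∧ |p.1 - u| ≤ L ∧ κ * |p.1 - u| ≤ p.2 ^ 2} with hR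
  have hRm : MeasurableSet R := by
    have : R = {p : ℝ × ℝ | 0 < p.2} ∩ ({p | |p.1 - u| ≤ L} ∩
      {p | κ * |p.1 - u| ≤ p.2 ^ 2}) := rfl
    rw [this]
    refine (isOpen_lt (by fun_prop) (by fun_prop)).measurableSet.inter
      ((isClosed_le (by fun_prop) (by fun_prop)).measurableSet.inter
      (isClosed_le (by fun_prop) (by fun_prop)).measurableSet)
  have h1 : ∫⁻ z : ℂ in UpperHalfPlane.coe '' S, ↑((1 / ‖z.im‖₊) ^ 2 : NNReal) ≤
      ∫⁻ z : ℂ in Complex.measurableEquivRealProd ⁻¹' R, ↑((1 / ‖z.im‖₊) ^ 2 : NNReal) := by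
    refine lintegral_mono_set ?_
    rintro _ ⟨z, hz, rfl⟩
    exact ⟨z.im_pos, h z hz⟩
  have h2 := Complex.volume_preserving_equiv_real_prod.setLIntegral_comp_preimage_emb
    Complex.measurableEquivRealProd.measurableEmbedding
    (fun p : ℝ × ℝ => (((1 / ‖p.2‖₊) ^ 2 : NNReal) : ENNReal)) R
  have h3 : ∫⁻ p in R, (((1 / ‖p.2‖₊) ^ 2 : NNReal) : ENNReal) =
      ∫⁻ y : ℝ, ∫⁻ x : ℝ, R.indicator (fun p => (((1 / ‖p.2‖₊) ^ 2 : NNReal) : ENNReal)) (x, y) := by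
    rw [← lintegral_indicator hRm, Measure.volume_eq_prod, lintegral_prod_symm]
    refine (Measurable.indicator ?_ hRm).aemeasurable
    fun_prop
  refine lt_of_le_of_lt h1 ?_
  refine lt_of_eq_of_lt h2 ?_
  rw [h3]
  have h4 : ∀ y : ℝ, ∫⁻ x : ℝ, R.indicator
      (fun p => (((1 / ‖p.2‖₊) ^ 2 : NNReal) : ENNReal)) (x, y) ≤
      (Set.Ioc (0 : ℝ) 1).indicator (fun _ => ENNReal.ofReal (2 / κ)) y +
      (Set.Ioi (1 : ℝ)).indicator (fun y => ENNReal.ofReal (2 * L * y ^ (-2 : ℝ))) y := by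
    intro y
    by_cases hy : 0 < y
    · have e : ∀ x, R.indicator (fun p => (((1 / ‖p.2‖₊) ^ 2 : NNReal) : ENNReal)) (x, y) ≤
          (Set.Icc (u - min L (y ^ 2 / κ)) (u + min L (y ^ 2 / κ))).indicator
            (fun _ => ENNReal.ofReal (1 / y ^ 2)) x := by
        intro x
        by_cases hx : (x, y) ∈ R
        · have hx' : x ∈ Set.Icc (u - min L (y ^ 2 / κ)) (u + min L (y ^ 2 / κ)) := by
            obtain ⟨-, h1, h2⟩ := hx
            simp only at h1 h2
            have : |x - u| ≤ min L (y ^ 2 / κ) := le_min h1 (by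
              rw [le_div_iff₀ hκ]
              linarith)
            rw [abs_le] at this
            constructor <;> linarith
          rw [Set.indicator_of_mem hx, Set.indicator_of_mem hx']
          apply le_of_eq
          rw [ENNReal.ofReal]
          congr 1
          ext
          simp
          positivity
        · rw [Set.indicator_of_notMem hx]
          exact zero_le
      refine (lintegral_mono e).trans ?_
      rw [lintegral_indicator measurableSet_Icc, setLIntegral_const, Real.volume_Icc,
        ← ENNReal.ofReal_mul (by positivity),
        show u + min L (y ^ 2 / κ) - (u - min L (y ^ 2 / κ)) = 2 * min L (y ^ 2 / κ) by ring]
      by_cases hy1 : y ≤ 1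
      · rw [Set.indicator_of_mem (show y ∈ Set.Ioc (0 : ℝ) 1 from ⟨hy, hy1⟩)]
        refine le_add_right (ENNReal.ofReal_le_ofReal ?_)
        calc 1 / y ^ 2 * (2 * min L (y ^ 2 / κ)) ≤ 1 / y ^ 2 * (2 * (y ^ 2 / κ)) := by
              gcongr
              exact min_le_right _ _
          _ = 2 / κ := by field_simp
      · rw [Set.indicator_of_mem (show y ∈ Set.Ioi (1 : ℝ) from not_le.1 hy1)]
        refine le_add_left (ENNReal.ofReal_le_ofReal ?_)
        calc 1 / y ^ 2 * (2 * min L (y ^ 2 / κ)) ≤ 1 / y ^ 2 * (2 * L) := by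
              gcongr
              exact min_le_left _ _
          _ = 2 * L * y ^ (-2 : ℝ) := by
              rw [Real.rpow_neg hy.le, Real.rpow_two]
              field_simp
    · have e : ∀ x, R.indicator (fun p => (((1 / ‖p.2‖₊) ^ 2 : NNReal) : ENNReal)) (x, y) = 0 :=
        fun x => Set.indicator_of_notMem (fun h => hy h.1) _
      simp only [e, lintegral_zero]
      exact zero_le
  refine lt_of_le_of_lt (lintegral_mono h4) ?_
  rw [lintegral_add_left ((measurable_const).indicator measurableSet_Ioc),
    lintegral_indicator measurableSet_Ioc, lintegral_indicator measurableSet_Ioi]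
  refine ENNReal.add_lt_top.2 ⟨?_, ?_⟩
  · rw [setLIntegral_const]
    simp
  · have := ((integrableOn_Ioi_rpow_of_lt (show (-2 : ℝ) < -1 by norm_num) one_pos).const_mul (2 * L))
    have h5 := this.hasFiniteIntegral
    refine lt_of_le_of_lt (lintegral_mono fun y => ?_) h5
    exact Real.ofReal_le_enorm _

theorem exists_gap {v : ℕ → ℝ} (hv : StrictMono v) (N : ℕ) :
    ∃ δ > 0, ∀ k < N, δ ≤ v (k + 1) - v k := by
  induction N with
  | zero => exact ⟨1, one_pos, fun k hk => absurd hk (Nat.not_lt_zero k)⟩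
  | succ N ih =>
    obtain ⟨δ, hδ, h⟩ := ih
    have h1 : 0 < v (N + 1) - v N := sub_pos.2 (hv (Nat.lt_succ_self N))
    refine ⟨min δ (v (N + 1) - v N), lt_min hδ h1, fun k hk => ?_⟩
    rcases Nat.lt_succ_iff_lt_or_eq.1 hk with hk | rfl
    · exact (min_le_left _ _).trans (h k hk)
    · exact min_le_right _ _

theorem exists_strip {v : ℕ → ℝ} {N : ℕ} (hN : 1 ≤ N) {x : ℝ} (h0 : v 0 ≤ x) (h1 : x ≤ v N) :
    ∃ k < N, v k ≤ x ∧ x ≤ v (k + 1) := by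
  induction N, hN using Nat.le_induction with
  | base => exact ⟨0, one_pos, h0, h1⟩
  | succ N hN ih =>
    rcases le_total x (v N) with h | h
    · obtain ⟨k, hk, h2⟩ := ih h
      exact ⟨k, by omega, h2⟩
    · exact ⟨N, by omega, h, h1⟩

theorem closedPoly_re {N : ℕ} {v : ℕ → ℝ} {z : ℍ}
    (hz : z ∈ closedPoly (fun i : Fin (N + 2) => side N v i)) : v 0 ≤ z.re ∧ z.re ≤ v N := by
  have h0 : 0 ≤ side N v 0 z := hz 0
  have h1 : 0 ≤ side N v (N + 1) z := hz (Fin.last (N + 1))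
  rw [side_zero] at h0
  rw [side_last] at h1
  constructor <;> linarith

theorem closedPoly_side {N : ℕ} {v : ℕ → ℝ} {z : ℍ}
    (hz : z ∈ closedPoly (fun i : Fin (N + 2) => side N v i)) {k : ℕ} (hk : k < N) :
    (z.re - v k) * (v (k + 1) - z.re) ≤ z.im ^ 2 := by
  have h0 : 0 ≤ side N v (k + 1) z := hz ⟨k + 1, by omega⟩
  rw [side_succ hk] at h0
  linarith

/-- Near an ideal vertex the polygon is thin. -/
theorem exists_vertex_near {N : ℕ} {v : ℕ → ℝ} (hv : StrictMono v) (hN : 1 ≤ N) {δ : ℝ}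
    (hδ : ∀ k < N, δ ≤ v (k + 1) - v k) {z : ℍ}
    (hz : z ∈ closedPoly (fun i : Fin (N + 2) => side N v i)) :
    ∃ k ≤ N, δ * |z.re - v k| ≤ 2 * z.im ^ 2 ∧ |z.re - v k| ≤ v N - v 0 := by
  obtain ⟨h0, h1⟩ := closedPoly_re hz
  obtain ⟨k, hk, h2, h3⟩ := exists_strip hN h0 h1
  have h4 := closedPoly_side hz hk
  have h5 := hδ k hk
  have hmono : v 0 ≤ v k ∧ v (k + 1) ≤ v N :=
    ⟨hv.monotone (Nat.zero_le k), hv.monotone hk⟩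
  rcases le_total (z.re - v k) (v (k + 1) - z.re) with h | h
  · refine ⟨k, hk.le, ?_, ?_⟩
    · rw [abs_of_nonneg (by linarith)]
      nlinarith
    · rw [abs_of_nonneg (by linarith)]
      linarith
  · refine ⟨k + 1, hk, ?_, ?_⟩
    · rw [abs_of_nonpos (by linarith)]
      nlinarith
    · rw [abs_of_nonpos (by linarith)]
      linarith

theorem volume_openPoly_lt_top {N : ℕ} {v : ℕ → ℝ} (hv : StrictMono v) (hN : 1 ≤ N) :
    volume (openPoly (fun i : Fin (N + 2) => side N v i)) < ⊤ := by
  obtain ⟨δ, hδ, hδ'⟩ := exists_gap hv N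
  -- Each piece treats the cusp at `v k` and, through the bound on its width, part of the cusp at
  -- `∞`.
  have h1 : openPoly (fun i : Fin (N + 2) => side N v i) ⊆ ⋃ k : Fin (N + 1),
      {z : ℍ | |z.re - v k| ≤ v N - v 0 ∧ δ / 2 * |z.re - v k| ≤ z.im ^ 2} := by
    intro z hz
    obtain ⟨k, hk, h1, h2⟩ := exists_vertex_near hv hN hδ' fun i => (hz i).le
    exact Set.mem_iUnion.2 ⟨⟨k, by omega⟩, h2, by simp only; linarith⟩
  refine (measure_mono h1).trans_lt ((measure_iUnion_le _).trans_lt ?_)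
  rw [tsum_fintype]
  exact ENNReal.sum_lt_top.2 fun k _ => volume_lt_top_of_slices (half_pos hδ) fun z hz => hz

end HypPlane

/-! ### The cusp at infinity and the covering of the plane. -/

namespace HypPlane

open UpperHalfPlane Topology MeasureTheory

theorem re_of_coe_eq {z w : ℍ} {X c a : ℝ} (hw : (w : ℂ) = X - c / (z - a)) :
    w.re = X - c * (z.re - a) / ((z.re - a) ^ 2 + z.im ^ 2) := by
  have := congrArg Complex.re hw
  rw [coe_re] at this
  rw [this, Complex.sub_re, Complex.div_re, normSq_sub_ofReal]
  simp

theorem im_of_coe_eq {z w : ℍ} {X c a : ℝ} (hw : (w : ℂ) = X - c / (z - a)) :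
    w.im = c * z.im / ((z.re - a) ^ 2 + z.im ^ 2) := by
  have := congrArg Complex.im hw
  rw [coe_im] at this
  rw [this, Complex.sub_im, Complex.div_im, normSq_sub_ofReal]
  simp

/-- The group element carrying the cusp `v j` to `∞`. -/
noncomputable def cuspElt (N : ℕ) (v h : ℕ → ℝ) : ℕ → PSL(2, ℝ)
  | 0 => rho (center N v h 0)
  | j + 1 => cuspElt N v h j * rho (center N v h (j + 1))

/-- The image of `∞` under `cuspElt N v h j`. -/
noncomputable def cuspX (v h : ℕ → ℝ) : ℕ → ℝ
  | 0 => v 0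
  | j + 1 => cuspX v h j - (h j + h (j + 1)) / (v (j + 1) - v j)

/-- The group of the decorated polygon. -/
noncomputable def cuspGroup (N : ℕ) (v h : ℕ → ℝ) : Subgroup PSL(2, ℝ) :=
  halfTurnGroup fun i : Fin (N + 2) => center N v h i

/-- The closed ideal polygon with vertices `v 0 < ⋯ < v N` and `∞`. -/
abbrev cuspPoly (N : ℕ) (v : ℕ → ℝ) : Set ℍ := closedPoly fun i : Fin (N + 2) => side N v i

/-- The width of the cusp `∞`. -/
noncomputable def cuspWidth (N : ℕ) (v h : ℕ → ℝ) : ℝ := v N - cuspX v h N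

section

variable {N : ℕ} {v h : ℕ → ℝ}

theorem rho_center_mem {i : ℕ} (hi : i < N + 2) : rho (center N v h i) ∈ cuspGroup N v h :=
  Subgroup.subset_closure ⟨⟨i, hi⟩, rfl⟩

theorem cuspElt_mem {j : ℕ} (hj : j < N + 2) : cuspElt N v h j ∈ cuspGroup N v h := by
  induction j with
  | zero => exact rho_center_mem hj
  | succ j ih => exact mul_mem (ih (by omega)) (rho_center_mem hj)

variable (hv : StrictMono v) (hh : ∀ k, 0 < h k)
include hv hh

/-- The half-turn number `j + 1` takes `v (j + 1)` to `v j` and matches their horodiscs, so the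
composite takes the horodisc at `v j` to height one. Hence `h j` is the only scale that enters. -/
theorem coe_cuspElt_smul {j : ℕ} (hj : j ≤ N) (z : ℍ) :
    ((cuspElt N v h j • z : ℍ) : ℂ) = cuspX v h j - h j / (z - v j) := by
  induction j generalizing z with
  | zero =>
    rw [cuspElt, coe_rho_smul, center_zero_def, ptOfSq_re (hh 0), cuspX]
    norm_cast
    rw [ptOfSq_im_sq (hh 0)]
  | succ j ih =>
    rw [cuspElt, mul_smul, ih (by omega), coe_rho_smul, cuspX, center_succ_re hv hh hj]
    have e : ((center N v h (j + 1)).im : ℂ) ^ 2 =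
        h j * h (j + 1) * (v (j + 1) - v j) ^ 2 / (h j + h (j + 1)) ^ 2 := by
      have := center_succ_im_sq hv hh hj
      exact_mod_cast this
    rw [e]
    have h1 := hh j
    have h2 := hh (j + 1)
    set a : ℝ := (h (j + 1) * v j + h j * v (j + 1)) / (h j + h (j + 1)) with ha
    have hs : ((h j : ℂ) + h (j + 1)) ≠ 0 := by
      have : h j + h (j + 1) ≠ 0 := by positivity
      exact_mod_cast this
    have hL : ((v (j + 1) : ℂ) - v j) ≠ 0 := by
      have : v (j + 1) - v j ≠ 0 := (sub_pos.2 (hv (Nat.lt_succ_self j))).ne'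
      exact_mod_cast this
    have hza : (z - a : ℂ) ≠ 0 := sub_ne_zero.2 (ne_ofReal z _)
    have hzw : (z - v (j + 1) : ℂ) ≠ 0 := sub_ne_zero.2 (ne_ofReal z _)
    have hj0 : (h j : ℂ) ≠ 0 := by exact_mod_cast h1.ne'
    have hsa : ((h j : ℂ) + h (j + 1)) * a = h (j + 1) * v j + h j * v (j + 1) := by
      have : (h j + h (j + 1)) * a = h (j + 1) * v j + h j * v (j + 1) := by
        rw [ha]
        field_simp
      exact_mod_cast this
    generalize (a : ℂ) = a at *
    -- The half-turn exchanges `v j` and `v (j + 1)`, so its value minus `v j` is a multiple of `z -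
    -- v (j + 1)`.
    have key : a - (h j : ℂ) * h (j + 1) * (v (j + 1) - v j) ^ 2 / (h j + h (j + 1)) ^ 2 /
        (z - a) - v j = h j * (v (j + 1) - v j) * (z - v (j + 1)) /
          ((h j + h (j + 1)) * (z - a)) := by
      have e1 : (h j + h (j + 1) : ℂ) * (a - v j) = h j * (v (j + 1) - v j) := by
        linear_combination hsa
      have e2 : (h j + h (j + 1) : ℂ) * (z - v (j + 1)) =
          (h j + h (j + 1)) * (z - a) - h (j + 1) * (v (j + 1) - v j) := by
        linear_combination hsa
      have e3 : a - v j = h j * (v (j + 1) - v j) / (h j + h (j + 1)) := by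
        rw [eq_div_iff hs]
        linear_combination e1
      have e4 : (z : ℂ) - v (j + 1) = (z - a) - h (j + 1) * (v (j + 1) - v j) / (h j + h (j + 1)) := by
        field_simp
        linear_combination e2
      rw [e4, sub_right_comm, e3]
      field_simp
    rw [key, div_div_eq_mul_div]
    push_cast
    field_simp
    linear_combination hsa

theorem cuspElt_smul_im {j : ℕ} (hj : j ≤ N) (z : ℍ) : (cuspElt N v h j • z).im =
    h j * z.im / ((z.re - v j) ^ 2 + z.im ^ 2) :=
  im_of_coe_eq (coe_cuspElt_smul hv hh hj z)

theorem coe_cuspElt_inv_smul {j : ℕ} (hj : j ≤ N) (z : ℍ) :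
    (((cuspElt N v h j)⁻¹ • z : ℍ) : ℂ) = v j - h j / (z - cuspX v h j) := by
  have h1 := coe_cuspElt_smul hv hh hj ((cuspElt N v h j)⁻¹ • z)
  rw [smul_inv_smul] at h1
  have h2 : (((cuspElt N v h j)⁻¹ • z : ℍ) - v j : ℂ) ≠ 0 := sub_ne_zero.2 (ne_ofReal _ _)
  have h3 : (h j : ℂ) ≠ 0 := by exact_mod_cast (hh j).ne'
  rw [h1, sub_sub_cancel_left, div_neg, sub_neg_eq_add, div_div_cancel₀ h3]
  ring

/-- The product of all half-turns fixes `∞` and preserves its horodisc, hence is a translation with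
no dilation factor. This is the completeness condition for the polygon. -/
theorem cuspElt_last_smul (z : ℍ) :
    cuspElt N v h (N + 1) • z = (-cuspWidth N v h) +ᵥ z := by
  apply UpperHalfPlane.ext
  rw [cuspElt, mul_smul, coe_cuspElt_smul hv hh le_rfl, coe_rho_smul, center_last,
    ptOfSq_re (hh N), coe_vadd, cuspWidth]
  have e : ((ptOfSq (v N) (h N)).im : ℂ) ^ 2 = h N := by
    have := ptOfSq_im_sq (a := v N) (hh N)
    exact_mod_cast this
  rw [e]
  have h1 : (z - v N : ℂ) ≠ 0 := sub_ne_zero.2 (ne_ofReal z _)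
  have h2 : (h N : ℂ) ≠ 0 := by exact_mod_cast (hh N).ne'
  push_cast
  rw [sub_right_comm, sub_self, zero_sub, div_neg, div_div_cancel₀ h2]
  ring

theorem cuspX_le (j : ℕ) : cuspX v h j ≤ v 0 := by
  induction j with
  | zero => exact le_rfl
  | succ j ih =>
    rw [cuspX]
    have h1 := hh j
    have h2 := hh (j + 1)
    have h3 : 0 < v (j + 1) - v j := sub_pos.2 (hv (Nat.lt_succ_self j))
    have : 0 ≤ (h j + h (j + 1)) / (v (j + 1) - v j) := by positivity
    linarith

theorem cuspWidth_pos (hN : 1 ≤ N) : 0 < cuspWidth N v h := by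
  have h1 := cuspX_le hv hh N
  have h2 : v 0 < v N := hv (by omega)
  rw [cuspWidth]
  linarith

theorem cuspElt_last_zpow_smul (m : ℤ) (z : ℍ) :
    cuspElt N v h (N + 1) ^ m • z = (-(m * cuspWidth N v h)) +ᵥ z := by
  have hinv : ∀ z : ℍ, (cuspElt N v h (N + 1))⁻¹ • z = cuspWidth N v h +ᵥ z := by
    intro z
    rw [inv_smul_eq_iff, cuspElt_last_smul hv hh, vadd_vadd, neg_add_cancel, zero_vadd]
  induction m with
  | zero => simp
  | succ n ih =>
    rw [zpow_add_one, (Commute.zpow_self _ _).eq, mul_smul, ih, cuspElt_last_smul hv hh, vadd_vadd]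
    congr 1
    push_cast
    ring
  | pred n ih =>
    rw [zpow_sub_one, (Commute.inv_left (Commute.self_zpow _ _)).symm.eq, mul_smul, ih, hinv,
      vadd_vadd]
    congr 1
    push_cast
    ring

/-- The part of the polygon near the vertex `v j` is carried to a half strip. -/
theorem cuspElt_inv_smul_mem {δ : ℝ} (hδ : ∀ k < N, δ ≤ v (k + 1) - v k) {M : ℝ} (hM : 0 < M)
    {j : ℕ} (hj : j ≤ N) (hMj : h j < δ * M) {z : ℍ} (hz : M ≤ z.im)
    (hlo : if j < N then cuspX v h j - h j / (v (j + 1) - v j) ≤ z.re else cuspX v h j ≤ z.re)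
    (hhi : if 0 < j then z.re ≤ cuspX v h j + h j / (v j - v (j - 1)) else z.re ≤ cuspX v h j) :
    (cuspElt N v h j)⁻¹ • z ∈ cuspPoly N v := by
  have hre := re_of_coe_eq (coe_cuspElt_inv_smul hv hh hj z)
  have him := im_of_coe_eq (coe_cuspElt_inv_smul hv hh hj z)
  have hm := sq_add_sq_im_pos z (cuspX v h j)
  have hy := z.im_pos
  have hj0 := hh j
  set w := (cuspElt N v h j)⁻¹ • z with hw
  set ξ := z.re - cuspX v h j with hξ
  set m := ξ ^ 2 + z.im ^ 2 with hm'
  -- The height `M` brings the point within `δ` of `v j`, so only the sides ending at `v j` remain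
  -- to be checked.
  have habs : |w.re - v j| < δ := by
    have h1 : w.re - v j = -(h j * ξ / m) := by rw [hre]; ring
    rw [h1, abs_neg, abs_div, abs_mul, abs_of_pos hj0, abs_of_pos hm, div_lt_iff₀ hm]
    have h2 : |ξ| * z.im ≤ m := by
      rw [hm', ← sq_abs ξ]
      nlinarith [sq_nonneg (|ξ| - z.im), abs_nonneg ξ]
    have hδ0 : 0 < δ := by
      by_contra hneg
      have := mul_nonpos_of_nonpos_of_nonneg (not_lt.1 hneg) hM.le
      linarith
    rcases (abs_nonneg ξ).eq_or_lt with h0 | h0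
    · rw [← h0, mul_zero]
      positivity
    · have h3 : h j * |ξ| < δ * M * |ξ| := mul_lt_mul_of_pos_right hMj h0
      have h4 : δ * M * |ξ| ≤ δ * (|ξ| * z.im) := by
        rw [mul_assoc, mul_comm M]
        gcongr
      have h5 : δ * (|ξ| * z.im) ≤ δ * m := by gcongr
      linarith
  rw [abs_lt] at habs
  have hδ' : ∀ k l, k < l → l ≤ N → v k + δ ≤ v l := by
    intro k l hkl hl
    have h1 := hδ k (by omega)
    have h2 := hv.monotone (show k + 1 ≤ l by omega)
    linarith
  refine forall_fin_add_two (p := fun i => 0 ≤ side N v i _) ?_ (fun k hk => ?_) ?_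
  · rw [side_zero]
    rcases Nat.eq_zero_or_pos j with rfl | hj1
    · rw [if_neg (lt_irrefl 0)] at hhi
      have h1 : ξ ≤ 0 := by rw [hξ]; linarith
      rw [hre, sub_sub_cancel_left, neg_nonneg]
      exact div_nonpos_of_nonpos_of_nonneg (mul_nonpos_of_nonneg_of_nonpos hj0.le h1) hm.le
    · have := hδ' 0 j hj1 hj
      linarith
  · rw [side_succ hk]
    rcases lt_trichotomy k j with hkj | rfl | hkj
    · rcases (show k + 1 < j ∨ j = k + 1 by omega) with hk1 | rfl
      · have h1 := hδ' (k + 1) j hk1 hj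
        have h2 := hv (Nat.lt_succ_self k)
        have h3 : 0 < w.re - v (k + 1) := by linarith
        have h4 : 0 < w.re - v k := by simp only [Nat.succ_eq_add_one] at h2; linarith
        positivity
      · rw [if_pos (by omega), Nat.add_sub_cancel] at hhi
        have hL : 0 < v (k + 1) - v k := sub_pos.2 (hv (Nat.lt_succ_self k))
        have h1 : ξ ≤ h (k + 1) / (v (k + 1) - v k) := by rw [hξ]; linarith
        rw [le_div_iff₀ hL] at h1
        have e : (w.re - v k) * (w.re - v (k + 1)) + w.im ^ 2 =
            h (k + 1) / m * (h (k + 1) - ξ * (v (k + 1) - v k)) := by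
          rw [hre, him]
          field_simp
          rw [hm']
          ring
        rw [e]
        have : 0 ≤ h (k + 1) - ξ * (v (k + 1) - v k) := by linarith
        positivity
    · rw [if_pos hk] at hlo
      have hL : 0 < v (k + 1) - v k := sub_pos.2 (hv (Nat.lt_succ_self k))
      have h1 : -ξ ≤ h k / (v (k + 1) - v k) := by rw [hξ]; linarith
      rw [le_div_iff₀ hL] at h1
      have e : (w.re - v k) * (w.re - v (k + 1)) + w.im ^ 2 =
          h k / m * (h k + ξ * (v (k + 1) - v k)) := by
        rw [hre, him]
        field_simp
        rw [hm']
        ring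
      rw [e]
      have : 0 ≤ h k + ξ * (v (k + 1) - v k) := by linarith
      positivity
    · have h1 := hδ' j k hkj hk.le
      have h2 := hv (Nat.lt_succ_self k)
      have h3 : w.re - v k < 0 := by linarith
      have h4 : w.re - v (k + 1) < 0 := by simp only [Nat.succ_eq_add_one] at h2; linarith
      have := mul_pos_of_neg_of_neg h3 h4
      positivity
  · rw [side_last]
    rcases hj.eq_or_lt with rfl | hj1
    · rw [if_neg (lt_irrefl _)] at hlo
      have h1 : 0 ≤ ξ := by rw [hξ]; linarith
      rw [hre, sub_sub_cancel]
      positivity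
    · have := hδ' j N hj1 le_rfl
      linarith

/-- At large height the images `cuspElt N v h j • cuspPoly N v` contain adjacent vertical half
strips, ordered from right to left from `v 0` to `cuspX v h N`. Together with the polygon over `[v
0, v N]` they fill one period of the translation. -/
theorem exists_smul_mem_of_im_ge (hN : 1 ≤ N) {δ : ℝ} (hδ : ∀ k < N, δ ≤ v (k + 1) - v k) {M : ℝ}
    (hM : 0 < M) (hMj : ∀ j ≤ N, h j < δ * M) (hMv : v N - v 0 ≤ M) {z : ℍ} (hz : M ≤ z.im) :
    ∃ γ ∈ cuspGroup N v h, γ • z ∈ cuspPoly N v := by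
  have main : ∀ j ≤ N, ∀ z : ℍ, M ≤ z.im →
      (if j < N then cuspX v h j - h j / (v (j + 1) - v j) ≤ z.re else cuspX v h j ≤ z.re) →
      z.re ≤ v N → ∃ γ ∈ cuspGroup N v h, γ • z ∈ cuspPoly N v := by
    intro j
    induction j with
    | zero =>
      intro hj z hz hlo hhi
      rcases le_total (v 0) z.re with h0 | h0
      · refine ⟨1, one_mem _, ?_⟩
        rw [one_smul]
        refine forall_fin_add_two (p := fun i => 0 ≤ side N v i _) ?_ (fun k hk => ?_) ?_
        · rw [side_zero]; linarith
        · rw [side_succ hk]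
          have h1 := hv.monotone (Nat.zero_le k)
          have h2 : v k < v (k + 1) := hv (Nat.lt_succ_self k)
          have h3 := hv.monotone (show k + 1 ≤ N by omega)
          nlinarith [sq_nonneg (z.re - v k + (z.re - v (k + 1)))]
        · rw [side_last]; linarith
      · exact ⟨_, inv_mem (cuspElt_mem (by omega)),
          cuspElt_inv_smul_mem hv hh hδ hM hj (hMj 0 hj) hz hlo
            (by rw [if_neg (lt_irrefl 0)]; exact h0)⟩
    | succ j ih =>
      intro hj z hz hlo hhi
      rcases le_total (cuspX v h j - h j / (v (j + 1) - v j)) z.re with h0 | h0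
      · exact ih (by omega) z hz (by rw [if_pos (by omega)]; exact h0) hhi
      · refine ⟨_, inv_mem (cuspElt_mem (by omega)),
          cuspElt_inv_smul_mem hv hh hδ hM hj (hMj _ hj) hz hlo ?_⟩
        -- The right edge of strip `j + 1` is the left edge of strip `j`.
        rw [if_pos (by omega), Nat.add_sub_cancel, cuspX]
        refine h0.trans (le_of_eq ?_)
        ring
  have hc := cuspWidth_pos hv hh hN
  obtain ⟨m, hm, -⟩ := existsUnique_sub_zsmul_mem_Ico hc z.re (v N - cuspWidth N v h)
  rw [sub_add_cancel, zsmul_eq_mul] at hm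
  have h1 := cuspElt_last_zpow_smul hv hh (N := N) m z
  obtain ⟨γ, hγ, h2⟩ := main N le_rfl (cuspElt N v h (N + 1) ^ m • z) (by rw [h1, vadd_im]; exact hz)
    (by
      rw [if_neg (lt_irrefl _), h1, vadd_re]
      have := hm.1
      rw [cuspWidth] at this ⊢
      linarith) (by
      rw [h1, vadd_re]
      linarith [hm.2])
  exact ⟨γ * cuspElt N v h (N + 1) ^ m, mul_mem hγ (zpow_mem (cuspElt_mem (by omega)) m),
    by rwa [mul_smul]⟩

omit hv in
theorem exists_bounds (N : ℕ) : ∃ a > 0, ∃ b, ∀ k ≤ N, a ≤ h k ∧ h k ≤ b := by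
  induction N with
  | zero =>
    refine ⟨h 0, hh 0, h 0, fun k hk => ?_⟩
    rw [Nat.le_zero.1 hk]
    exact ⟨le_rfl, le_rfl⟩
  | succ N ih =>
    obtain ⟨a, ha, b, hab⟩ := ih
    refine ⟨min a (h (N + 1)), lt_min ha (hh _), max b (h (N + 1)), fun k hk => ?_⟩
    rcases Nat.le_succ_iff.1 hk with hk | rfl
    · exact ⟨(min_le_left _ _).trans (hab k hk).1, (hab k hk).2.trans (le_max_left _ _)⟩
    · exact ⟨min_le_right _ _, le_max_right _ _⟩

omit hv hh in
theorem isCompact_box (a b c d : ℝ) (hc : 0 < c) :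
    IsCompact {z : ℍ | (a ≤ z.re ∧ z.re ≤ b) ∧ c ≤ z.im ∧ z.im ≤ d} := by
  rw [isEmbedding_coe.isCompact_iff]
  have : UpperHalfPlane.coe '' {z : ℍ | (a ≤ z.re ∧ z.re ≤ b) ∧ c ≤ z.im ∧ z.im ≤ d} =
      Set.Icc a b ×ℂ Set.Icc c d := by
    ext w
    constructor
    · rintro ⟨z, ⟨h1, h2⟩, rfl⟩
      exact ⟨h1, h2⟩
    · rintro ⟨h1, h2⟩
      exact ⟨⟨w, hc.trans_le h2.1⟩, ⟨h1, h2⟩, rfl⟩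
  rw [this]
  exact isCompact_Icc.reProdIm isCompact_Icc

/-- The images of the polygon cover the plane. -/
theorem exists_smul_mem_cuspPoly (hN : 1 ≤ N) (z : ℍ) :
    ∃ γ ∈ cuspGroup N v h, γ • z ∈ cuspPoly N v := by
  have sp := sidePairing hv hh hN
  obtain ⟨δ, hδ, hδv⟩ := exists_gap hv N
  obtain ⟨a, ha, b, hab⟩ := exists_bounds hh N
  have hb : 0 < b := (hh 0).trans_le (hab 0 (Nat.zero_le N)).2
  have hL : 0 < v N - v 0 := sub_pos.2 (hv (by omega))
  -- High enough for `exists_smul_mem_of_im_ge`: above all semicircles and with `h j < δ * M`.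
  set M := v N - v 0 + (b + 1) / δ with hMdef
  have hM : 0 < M := by positivity
  have hMj : ∀ j ≤ N, h j < δ * M := by
    intro j hj
    have h1 := (hab j hj).2
    have h2 : δ * M = δ * (v N - v 0) + (b + 1) := by
      rw [hMdef]
      field_simp
    have := mul_pos hδ hL
    linarith
  have hMv : v N - v 0 ≤ M := by
    rw [hMdef]
    have : 0 ≤ (b + 1) / δ := by positivity
    linarith
  set U : Set ℍ := {z | ∃ γ ∈ cuspGroup N v h, γ • z ∈ cuspPoly N v} with hU
  have hUsmul : ∀ γ ∈ cuspGroup N v h, ∀ z, γ • z ∈ U → z ∈ U := by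
    rintro γ hγ z ⟨ε, hε, h1⟩
    exact ⟨ε * γ, mul_mem hε hγ, by rwa [mul_smul]⟩
  have hUhigh : ∀ z : ℍ, M ≤ z.im → z ∈ U := fun z hz =>
    exists_smul_mem_of_im_ge hv hh hN hδv hM hMj hMv hz
  have hUint : ∀ z ∈ cuspPoly N v, z ∈ interior U := by
    intro z hz
    obtain ⟨n, hn, γ, hγ, h1⟩ := sp.exists_nhds hz
    refine mem_interior_iff_mem_nhds.2 (Filter.mem_of_superset hn fun w hw => ?_)
    rcases h1 w hw with h2 | h2
    · exact ⟨1, one_mem _, by rwa [one_smul]⟩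
    · exact ⟨γ, hγ, h2⟩
  -- Thinness near the vertex `v k` gives `|z - v k|² ≤ B * z.im ^ 2`. So if `cuspElt` brings `z`
  -- only to height at most `2 * M`, then `z` itself has height at least `a / (2 * M * B)`.
  set B := 2 * (v N - v 0) / δ + 1 with hB
  have hB0 : 0 < B := by positivity
  set K : Set ℍ := cuspPoly N v ∩
    {z : ℍ | (v 0 ≤ z.re ∧ z.re ≤ v N) ∧ a / (2 * M * B) ≤ z.im ∧ z.im ≤ 2 * M} with hK
  have hKc : IsCompact K := (isCompact_box _ _ _ _ (by positivity)).inter_left sp.isClosed_closedPoly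
  obtain ⟨ε, hε, hεK⟩ := hKc.exists_thickening_subset_open isOpen_interior fun z hz => hUint z hz.1
  -- A move of length less than `log 2` divides the height by less than two.
  have hstep : ∀ z w : ℍ, 2 * M < z.im → dist z w < Real.log 2 → M ≤ w.im := by
    intro z w h1 h2
    have h3 := im_div_exp_dist_le z w
    have h4 : Real.exp (dist z w) < 2 := (Real.lt_log_iff_exp_lt two_pos).1 h2
    refine le_trans ?_ h3
    rw [le_div_iff₀ (Real.exp_pos _)]
    nlinarith
  -- A radius uniform over the polygon: points high at `∞`, or high after a vertex is moved to `∞`,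
  -- are handled by the cusp; the rest lies in the compact set `K` with Lebesgue number `ε`.
  have hball : ∀ z ∈ cuspPoly N v, ∀ w, dist z w < min ε (Real.log 2) → w ∈ U := by
    intro z hz w hw
    have hw1 := hw.trans_le (min_le_left _ _)
    have hw2 := hw.trans_le (min_le_right _ _)
    rcases lt_or_ge (2 * M) z.im with h1 | h1
    · exact hUhigh w (hstep z w h1 hw2)
    obtain ⟨k, hk, h2, h3⟩ := exists_vertex_near hv hN hδv hz
    rcases lt_or_ge (2 * M) (cuspElt N v h k • z).im with h4 | h4
    · refine hUsmul (cuspElt N v h k) (cuspElt_mem (by omega)) w (hUhigh _ (hstep _ _ h4 ?_))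
      rwa [dist_smul]
    · refine interior_subset (hεK (Metric.mem_thickening_iff.2 ⟨z, ⟨hz, closedPoly_re hz, ?_, h1⟩, ?_⟩))
      · rw [cuspElt_smul_im hv hh hk, div_le_iff₀ (sq_add_sq_im_pos z _)] at h4
        have h5 : (z.re - v k) ^ 2 ≤ (v N - v 0) * (2 * z.im ^ 2 / δ) := by
          rw [← sq_abs, sq]
          refine mul_le_mul h3 ?_ (abs_nonneg _) hL.le
          rw [le_div_iff₀ hδ]
          linarith
        have h6 : (z.re - v k) ^ 2 + z.im ^ 2 ≤ B * z.im ^ 2 := by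
          have : B * z.im ^ 2 = (v N - v 0) * (2 * z.im ^ 2 / δ) + z.im ^ 2 := by
            rw [hB]
            ring
          linarith
        rw [div_le_iff₀ (by positivity)]
        have h7 : h k * z.im ≤ 2 * M * (B * z.im ^ 2) := h4.trans (by gcongr)
        have h8 : z.im * h k ≤ z.im * (z.im * (2 * M * B)) := by linarith
        exact (hab k hk).1.trans (le_of_mul_le_mul_left h8 z.im_pos)
      · rwa [dist_comm]
  have hε' : 0 < min ε (Real.log 2) := lt_min hε (Real.log_pos one_lt_two)
  have hballU : ∀ z ∈ U, ∀ w, dist z w < min ε (Real.log 2) → w ∈ U := by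
    rintro z ⟨γ, hγ, hz⟩ w hw
    exact hUsmul γ hγ w (hball _ hz _ (by rwa [dist_smul]))
  -- The uniform radius makes both `U` and its complement open.
  have hclopen : IsClopen U := by
    constructor
    · rw [← isOpen_compl_iff, Metric.isOpen_iff]
      intro z hz
      refine ⟨_, hε', fun w hw hwU => hz (hballU w hwU z hw)⟩
    · rw [Metric.isOpen_iff]
      intro z hz
      refine ⟨_, hε', fun w hw => hballU z hz w (by rwa [dist_comm])⟩
  have : U = Set.univ := hclopen.eq_univ ⟨⟨⟨0, M⟩, hM⟩, hUhigh _ le_rfl⟩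
  change z ∈ U
  rw [this]
  trivial

end

end HypPlane

/-! ### Parabolic fixed points and absence of intervals of discontinuity. -/

namespace HypPlane

open UpperHalfPlane Topology Filter

theorem IsParabolic.conj {γ : PSL(2, ℝ)} (hγ : IsParabolic γ) (δ : PSL(2, ℝ)) :
    IsParabolic (δ * γ * δ⁻¹) := by
  obtain ⟨A, rfl, hA⟩ := hγ
  obtain ⟨B, rfl⟩ := isom_surjective δ
  refine ⟨B * A * B⁻¹, by rw [isom_mul, isom_mul, isom_inv], ?_⟩
  have := (Matrix.isParabolic_conj_iff (m := (A : Matrix (Fin 2) (Fin 2) ℝ))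
    (g := (B : GL (Fin 2) ℝ))).2 hA
  convert! this using 1
  rw [Matrix.SpecialLinearGroup.coe_mul, Matrix.SpecialLinearGroup.coe_mul]
  congr 1
  rw [← Matrix.coe_units_inv, ← Matrix.SpecialLinearGroup.coe_GL_coe_matrix]
  rfl

theorem IsHyperbolic.conj {γ : PSL(2, ℝ)} (hγ : IsHyperbolic γ) (δ : PSL(2, ℝ)) :
    IsHyperbolic (δ * γ * δ⁻¹) := by
  obtain ⟨A, rfl, hA⟩ := hγ
  obtain ⟨B, rfl⟩ := isom_surjective δ
  refine ⟨B * A * B⁻¹, by rw [isom_mul, isom_mul, isom_inv], ?_⟩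
  have := (Matrix.isHyperbolic_conj_iff (m := (A : Matrix (Fin 2) (Fin 2) ℝ))
    (g := (B : GL (Fin 2) ℝ))).2 hA
  convert! this using 1
  rw [Matrix.SpecialLinearGroup.coe_mul, Matrix.SpecialLinearGroup.coe_mul]
  congr 1
  rw [← Matrix.coe_units_inv, ← Matrix.SpecialLinearGroup.coe_GL_coe_matrix]
  rfl

/-- A parabolic isometry with fixed point `p` acts as a translation on `1 / (z - p)`. -/
theorem IsParabolic.exists_translation {γ : PSL(2, ℝ)} (hγ : IsParabolic γ) {p : ℝ}
    (hp : γ • (p : OnePoint ℝ) = p) :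
    ∃ τ : ℝ, τ ≠ 0 ∧ ∀ z : ℍ, 1 / (((γ • z : ℍ) : ℂ) - p) = 1 / (z - p) + τ := by
  obtain ⟨A, rfl, hA, hdisc⟩ := hγ
  have hd := det_sl A
  rw [Matrix.discr_fin_two, Matrix.trace_fin_two, A.det_coe] at hdisc
  rw [isom_smul_coe] at hp
  split_ifs at hp with h0
  · exact absurd hp.symm (OnePoint.coe_ne_infty p)
  rw [OnePoint.coe_eq_coe, div_eq_iff h0] at hp
  have h1 : (A 0 0 - A 1 0 * p) * (A 1 0 * p + A 1 1) = 1 := by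
    linear_combination hd + A 1 0 * hp
  -- These are the two eigenvalues; zero discriminant makes them equal, so both are `1` or both are
  -- `-1`.
  have h2 : A 0 0 - A 1 0 * p = A 1 0 * p + A 1 1 := by
    have : (A 0 0 - A 1 0 * p - (A 1 0 * p + A 1 1)) ^ 2 = 0 := by
      linear_combination hdisc - 4 * h1
    linarith [pow_eq_zero_iff (two_ne_zero) |>.1 this]
  have h3 : (A 1 0 * p + A 1 1) * (A 1 0 * p + A 1 1) = 1 := by
    rw [h2] at h1
    exact h1
  have hc : A 1 0 ≠ 0 := by
    intro hc
    rw [hc] at h2 hp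
    simp only [zero_mul, sub_zero, zero_add] at h2 hp
    rw [h2] at hp
    refine hA ⟨A 0 0, ?_⟩
    ext i j
    fin_cases i <;> fin_cases j <;> simp
    · linarith
    · exact hc.symm
    · exact h2
  refine ⟨A 1 0 * (A 1 0 * p + A 1 1), mul_ne_zero hc h0, fun z => ?_⟩
  have hden := denom_ne_zero_of_sl A z
  have hz : (z - p : ℂ) ≠ 0 := sub_ne_zero.2 (ne_ofReal z _)
  have hε : ((A 1 0 : ℂ) * p + A 1 1) ≠ 0 := by exact_mod_cast h0
  have hp' : (A 0 0 : ℂ) * p + A 0 1 = p * (A 1 0 * p + A 1 1) := by exact_mod_cast hp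
  have h2' : (A 0 0 : ℂ) - A 1 0 * p = A 1 0 * p + A 1 1 := by exact_mod_cast h2
  have h3' : ((A 1 0 : ℂ) * p + A 1 1) * (A 1 0 * p + A 1 1) = 1 := by exact_mod_cast h3
  have e : ((isom A • z : ℍ) : ℂ) - p =
      (A 1 0 * p + A 1 1) * (z - p) / (A 1 0 * z + A 1 1) := by
    rw [coe_isom_smul, eq_div_iff hden, sub_mul, div_mul_cancel₀ _ hden]
    linear_combination hp' + (z - p) * h2'
  rw [e, one_div_div]
  push_cast
  rw [div_eq_iff (mul_ne_zero hε hz), add_mul, one_div, ← mul_assoc, mul_comm _ ((z : ℂ) - p)]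
  field_simp
  linear_combination (-A 1 0 * (z - p)) * h3'

theorem tendsto_iterate_of_translation {g : ℍ → ℍ} {p τ : ℝ} (hτ : τ ≠ 0)
    (hg : ∀ z : ℍ, 1 / ((g z : ℂ) - p) = 1 / (z - p) + τ) (z : ℍ) :
    Tendsto (fun k : ℕ => ((g^[k] z : ℍ) : ℂ)) atTop (𝓝 p) := by
  have h1 : ∀ k : ℕ, 1 / ((g^[k] z : ℍ) - p : ℂ) = 1 / (z - p) + k * τ := by
    intro k
    induction k with
    | zero => simp
    | succ k ih =>
      rw [Function.iterate_succ_apply', hg, ih]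
      push_cast
      ring
  have h2 : ∀ k : ℕ, ((g^[k] z : ℍ) : ℂ) = p + (1 / ((z : ℂ) - p) + k * τ)⁻¹ := by
    intro k
    rw [← h1, one_div, inv_inv]
    ring
  simp only [h2]
  have h3 : Tendsto (fun k : ℕ => (1 / ((z : ℂ) - p) + k * τ)) atTop (Bornology.cobounded ℂ) := by
    refine tendsto_const_add_cobounded _ |>.comp ?_
    rw [← tendsto_norm_atTop_iff_cobounded]
    simp only [norm_mul, Complex.norm_natCast, Complex.norm_real]
    exact tendsto_natCast_atTop_atTop.atTop_mul_const (norm_pos_iff.2 hτ)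
  have h4 := (tendsto_inv₀_cobounded.comp h3).const_add (p : ℂ)
  rw [add_zero] at h4
  exact h4

section

variable {N : ℕ} {v h : ℕ → ℝ}

/-- The half plane behind side `i` lies over the interval from `v (i - 1)` to `v i`; the guards drop
the bound at an end equal to `∞`. -/
theorem re_le_of_side_nonpos (hv : StrictMono v) {i : ℕ} (hi : i < N + 2) {z : ℍ}
    (hz : side N v i z ≤ 0) :
    (i ≤ N → z.re ≤ v i) ∧ (1 ≤ i → v (i - 1) ≤ z.re) := by
  rcases i with _ | k
  · rw [side_zero] at hz
    exact ⟨fun _ => by linarith, fun h => absurd h (by omega)⟩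
  · rcases (show k < N ∨ k = N by omega) with hk | rfl
    · have := re_lt_of_side_nonpos hv hk hz
      exact ⟨fun _ => this.2.le, fun _ => this.1.le⟩
    · rw [side_last] at hz
      exact ⟨fun h => absurd h (by omega), fun _ => by
        rw [Nat.add_sub_cancel]
        linarith⟩

theorem le_of_tendsto_side (hv : StrictMono v) {i : ℕ} (hi : i < N + 2) {z : ℕ → ℍ} {p : ℝ}
    (hz : Tendsto (fun k => (z k : ℂ)) atTop (𝓝 p)) (hs : ∀ k, side N v i (z (k + 1)) ≤ 0) :
    (i ≤ N → p ≤ v i) ∧ (1 ≤ i → v (i - 1) ≤ p) := by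
  have h1 : Tendsto (fun k => (z (k + 1)).re) atTop (𝓝 p) := by
    have := (Complex.continuous_re.tendsto (p : ℂ)).comp (hz.comp (tendsto_add_atTop_nat 1))
    exact this
  constructor
  · intro hi'
    exact le_of_tendsto h1 (Eventually.of_forall fun k => (re_le_of_side_nonpos hv hi (hs k)).1 hi')
  · intro hi'
    exact ge_of_tendsto h1 (Eventually.of_forall fun k => (re_le_of_side_nonpos hv hi (hs k)).2 hi')

/-- The function `r² |c z + d|² - |P z + Q|²` is affine in `(x, x² + y²)`. If it were nonpositive at
the three vertices `∞`, `u`, `w` of the ideal triangle, it would be so at `z`, whereas `heq` makes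
it positive there. -/
theorem vertex_in_disc {P Q c d r x y u w : ℝ} (hr : 0 < r) (huw : u < w) (hu : u ≤ x) (hw : x ≤ w)
    (hy : (x - u) * (w - x) ≤ y ^ 2) (hden : 0 < (c * x + d) ^ 2 + (c * y) ^ 2)
    (heq : (P * x + Q) ^ 2 + (P * y) ^ 2 = (r / 2) ^ 2 * ((c * x + d) ^ 2 + (c * y) ^ 2)) :
    P ^ 2 < r ^ 2 * c ^ 2 ∨ (P * u + Q) ^ 2 < r ^ 2 * (c * u + d) ^ 2 ∨
      (P * w + Q) ^ 2 < r ^ 2 * (c * w + d) ^ 2 := by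
  by_contra! hcon
  obtain ⟨h1, h2, h3⟩ := hcon
  have e : (w - u) * (r ^ 2 * ((c * x + d) ^ 2 + (c * y) ^ 2) - ((P * x + Q) ^ 2 + (P * y) ^ 2)) =
      (w - x) * (r ^ 2 * (c * u + d) ^ 2 - (P * u + Q) ^ 2) +
      (x - u) * (r ^ 2 * (c * w + d) ^ 2 - (P * w + Q) ^ 2) +
      (w - u) * (r ^ 2 * c ^ 2 - P ^ 2) * (y ^ 2 - (x - u) * (w - x)) := by ring
  have h4 := mul_nonneg (sub_nonneg.2 hw) (sub_nonneg.2 h2)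
  have h5 := mul_nonneg (sub_nonneg.2 hu) (sub_nonneg.2 h3)
  have h6 := mul_nonneg (mul_nonneg (sub_nonneg.2 huw.le) (sub_nonneg.2 h1)) (sub_nonneg.2 hy)
  rw [heq] at e
  have h7 : 0 < (w - u) * (r ^ 2 * ((c * x + d) ^ 2 + (c * y) ^ 2)) := by
    have := sub_pos.2 huw
    positivity
  linarith

theorem abs_div_sub_lt {n e m r : ℝ} (hr : 0 < r) (h : (n - m * e) ^ 2 < r ^ 2 * e ^ 2) :
    e ≠ 0 ∧ |n / e - m| < r := by
  have he : e ≠ 0 := by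
    rintro rfl
    nlinarith [sq_nonneg n]
  refine ⟨he, ?_⟩
  rw [← mul_pow, sq_lt_sq, abs_mul, abs_of_pos hr] at h
  rw [show n / e - m = (n - m * e) / e by field_simp, abs_div, div_lt_iff₀ (abs_pos.2 he)]
  exact h

variable (hv : StrictMono v) (hh : ∀ k, 0 < h k)
include hv hh

theorem cuspElt_smul_vertex {j : ℕ} (hj : j ≤ N) :
    cuspElt N v h j • (v j : OnePoint ℝ) = OnePoint.infty := by
  have h1 := hh j
  have h2 : 0 < √(h j) := Real.sqrt_pos.2 h1
  have hs : √(h j) * √(h j) = h j := Real.mul_self_sqrt h1.le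
  have hd : cuspX v h j / √(h j) * (-v j / √(h j)) -
      (-(cuspX v h j * v j + h j) / √(h j)) * (1 / √(h j)) = 1 := by
    field_simp
    rw [sq, hs]
    ring
  have e : cuspElt N v h j = isom (slMk _ _ _ _ hd) := by
    refine FaithfulSMul.eq_of_smul_eq_smul (α := ℍ) fun z => UpperHalfPlane.ext ?_
    rw [coe_cuspElt_smul hv hh hj, coe_isom_smul]
    have h3 : (z - v j : ℂ) ≠ 0 := sub_ne_zero.2 (ne_ofReal z _)
    have h4 : ((√(h j) : ℝ) : ℂ) ≠ 0 := by exact_mod_cast h2.ne'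
    simp only [slMk, Matrix.of_apply, Matrix.cons_val', Matrix.cons_val_zero,
      Matrix.cons_val_one, Matrix.cons_val_fin_one]
    push_cast
    have e1 : (1 / ((√(h j) : ℝ) : ℂ) * z + -v j / ((√(h j) : ℝ) : ℂ)) =
      (z - v j) / ((√(h j) : ℝ) : ℂ) := by ring
    rw [e1]
    field_simp
    ring
  rw [e, isom_smul_coe, if_pos]
  simp only [slMk, Matrix.of_apply, Matrix.cons_val', Matrix.cons_val_zero,
      Matrix.cons_val_one, Matrix.cons_val_fin_one]
  ring

theorem cuspElt_last_eq :
    cuspElt N v h (N + 1) = isom (slMk 1 (-cuspWidth N v h) 0 1 (by norm_num)) := by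
  refine FaithfulSMul.eq_of_smul_eq_smul (α := ℍ) fun z => UpperHalfPlane.ext ?_
  rw [cuspElt_last_smul hv hh, coe_isom_smul]
  simp [slMk]
  ring

theorem isParabolic_cuspElt_last (hN : 1 ≤ N) : IsParabolic (cuspElt N v h (N + 1)) := by
  refine ⟨_, (cuspElt_last_eq hv hh).symm, ?_⟩
  rw [Matrix.isParabolic_iff_of_upperTriangular (by simp [slMk])]
  have := cuspWidth_pos hv hh hN
  simp [slMk, this.ne']

theorem cuspElt_last_smul_infty :
    cuspElt N v h (N + 1) • (OnePoint.infty : OnePoint ℝ) = OnePoint.infty := by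
  rw [cuspElt_last_eq hv hh, slMk_smul_infty, if_pos rfl]

/-- The cusps form the orbit of `∞`. -/
theorem mem_cusps_iff (hN : 1 ≤ N) (x : OnePoint ℝ) :
    x ∈ cusps (cuspGroup N v h) ↔ ∃ γ ∈ cuspGroup N v h, γ • (OnePoint.infty : OnePoint ℝ) = x := by
  have sp := sidePairing hv hh hN
  constructor
  · rintro ⟨γ, hγ, hpar, hx⟩
    obtain ⟨δ, hδ, hcase⟩ := sp.exists_conj hγ
    have hpar' := hpar.conj δ
    have hx' : (δ * γ * δ⁻¹) • δ • x = δ • x := by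
      rw [mul_smul, mul_smul, inv_smul_smul, hx]
    set g := δ * γ * δ⁻¹ with hg
    rcases hp : δ • x with _ | p
    · exact ⟨δ⁻¹, inv_mem hδ, by rw [inv_smul_eq_iff, hp]; rfl⟩
    have hp' : δ • x = (p : OnePoint ℝ) := hp
    rw [hp'] at hx'
    obtain ⟨τ, hτ, htr⟩ := hpar'.exists_translation hx'
    suffices ∃ k ≤ N, p = v k by
      obtain ⟨k, hk, rfl⟩ := this
      refine ⟨(cuspElt N v h k * δ)⁻¹, inv_mem (mul_mem (cuspElt_mem (by omega)) hδ), ?_⟩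
      rw [inv_smul_eq_iff, mul_smul, hp', cuspElt_smul_vertex hv hh hk]
    -- A translation in `1 / (z - p)` has no fixed point in `ℍ`, which excludes the identity and the
    -- half-turns.
    have hfix : ∀ z : ℍ, g • z ≠ z := by
      intro z hz
      have := htr z
      rw [hz, left_eq_add] at this
      exact hτ (by exact_mod_cast this)
    rcases hcase with h1 | ⟨i, h1⟩ | ⟨i, j, hij, h1⟩
    · exact absurd (by rw [h1, one_smul]) (hfix I)
    · exact absurd (by rw [h1, rho_smul_self]) (hfix (center N v h i))
    · obtain ⟨z, hz⟩ := openPoly_nonempty hv hN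
      have h2 : ∀ z, 0 ≤ side N v i z → side N v j (g⁻¹ • z) < 0 := by
        intro z hz
        by_contra hneg
        have := h1 _ (not_lt.1 hneg)
        rw [smul_inv_smul] at this
        exact absurd hz (not_le.2 this)
      have htr' : ∀ z : ℍ, 1 / (((g⁻¹ • z : ℍ) : ℂ) - p) = 1 / (z - p) + ((-τ : ℝ) : ℂ) := by
        intro z
        have := htr (g⁻¹ • z)
        rw [smul_inv_smul] at this
        rw [this]
        push_cast
        ring
      -- Forward iterates stay behind side `i`, backward ones behind side `j`, and both tend to `p`.
      -- Two different closed half planes share a real boundary point only at a common vertex.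
      have hi : ∀ k, side N v i ((fun z => g • z)^[k + 1] z) < 0 := by
        intro k
        induction k with
        | zero => exact h1 z (hz j).le
        | succ k ih =>
          rw [Function.iterate_succ_apply']
          exact h1 _ (sp.pos_of_nonpos hij.symm ih.le).le
      have hj : ∀ k, side N v j ((fun z => g⁻¹ • z)^[k + 1] z) < 0 := by
        intro k
        induction k with
        | zero => exact h2 z (hz i).le
        | succ k ih =>
          rw [Function.iterate_succ_apply']
          exact h2 _ (sp.pos_of_nonpos hij ih.le).le
      have hpi := le_of_tendsto_side hv i.2 (tendsto_iterate_of_translation hτ htr z)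
        fun k => (hi k).le
      have hpj := le_of_tendsto_side hv j.2
        (tendsto_iterate_of_translation (neg_ne_zero.2 hτ) htr' z) fun k => (hj k).le
      have hij' : (i : ℕ) ≠ j := fun h => hij (Fin.ext h)
      have hi2 := i.2
      have hj2 := j.2
      rcases lt_or_gt_of_ne hij' with hlt | hlt
      · refine ⟨i, by omega, le_antisymm (hpi.1 (by omega)) ?_⟩
        exact (hv.monotone (show (i : ℕ) ≤ j - 1 by omega)).trans (hpj.2 (by omega))
      · refine ⟨j, by omega, le_antisymm (hpj.1 (by omega)) ?_⟩
        exact (hv.monotone (show (j : ℕ) ≤ i - 1 by omega)).trans (hpi.2 (by omega))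
  · rintro ⟨γ, hγ, rfl⟩
    refine ⟨γ * cuspElt N v h (N + 1) * γ⁻¹,
      mul_mem (mul_mem hγ (cuspElt_mem (by omega))) (inv_mem hγ),
      (isParabolic_cuspElt_last hv hh hN).conj γ, ?_⟩
    rw [mul_smul, mul_smul, inv_smul_smul, cuspElt_last_smul_infty hv hh]

/-- The orbit of `∞` meets every interval. -/
theorem exists_smul_infty_near (hN : 1 ≤ N) (m : ℝ) {r : ℝ} (hr : 0 < r) :
    ∃ γ ∈ cuspGroup N v h, ∃ x : ℝ, γ • (OnePoint.infty : OnePoint ℝ) = x ∧ |x - m| < r := by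
  -- An image of an ideal triangle that contains `m + i r / 2` has a vertex within `r` of `m`, and
  -- all its vertices are in the orbit of `∞`.
  obtain ⟨γ, hγ, hz⟩ := exists_smul_mem_cuspPoly hv hh hN ⟨⟨m, r / 2⟩, half_pos hr⟩
  set z : ℍ := ⟨⟨m, r / 2⟩, half_pos hr⟩ with hzdef
  obtain ⟨A, hA⟩ := isom_surjective γ⁻¹
  set w := γ • z with hw
  have hwz : isom A • w = z := by rw [hA, hw, inv_smul_smul]
  have hAmem : isom A ∈ cuspGroup N v h := hA ▸ inv_mem hγ
  have hden := denom_ne_zero_of_sl A w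
  have h1 := coe_isom_smul A w
  rw [hwz, eq_div_iff hden] at h1
  have h2 : ((A 0 0 * w + A 0 1 : ℂ) - m * (A 1 0 * w + A 1 1)) =
      ((r / 2 : ℝ) : ℂ) * Complex.I * (A 1 0 * w + A 1 1) := by
    have e : (z : ℂ) = m + ((r / 2 : ℝ) : ℂ) * Complex.I := by
      apply Complex.ext <;> simp [hzdef]
    rw [← h1, e]
    ring
  have h3 := congrArg Complex.normSq h2
  rw [Complex.normSq_mul, Complex.normSq_mul, Complex.normSq_ofReal, Complex.normSq_I] at h3
  have h4 := Complex.normSq_pos.2 hden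
  simp only [Complex.normSq_apply, Complex.add_re, Complex.add_im, Complex.mul_re, Complex.mul_im,
    Complex.sub_re, Complex.sub_im, Complex.ofReal_re, Complex.ofReal_im, coe_re, coe_im,
    zero_mul, sub_zero, add_zero] at h3 h4
  obtain ⟨hz0, hz1⟩ := closedPoly_re hz
  obtain ⟨k, hk, hku, hkw⟩ := exists_strip hN hz0 hz1
  have hside := closedPoly_side hz hk
  have hvert : ∀ j ≤ N, ((A 0 0 - m * A 1 0) * v j + (A 0 1 - m * A 1 1)) ^ 2 <
      r ^ 2 * (A 1 0 * v j + A 1 1) ^ 2 → ∃ γ ∈ cuspGroup N v h, ∃ x : ℝ,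
        γ • (OnePoint.infty : OnePoint ℝ) = x ∧ |x - m| < r := by
    intro j hj hlt
    obtain ⟨h5, h6⟩ := abs_div_sub_lt (n := A 0 0 * v j + A 0 1) (m := m) hr
      (lt_of_eq_of_lt (by ring) hlt)
    refine ⟨isom A * (cuspElt N v h j)⁻¹, mul_mem hAmem (inv_mem (cuspElt_mem (by omega))), _, ?_, h6⟩
    rw [mul_smul, ← cuspElt_smul_vertex hv hh hj, inv_smul_smul, isom_smul_coe, if_neg h5]
  rcases vertex_in_disc (P := A 0 0 - m * A 1 0) (Q := A 0 1 - m * A 1 1) (c := A 1 0) (d := A 1 1)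
    hr (hv (Nat.lt_succ_self k)) hku hkw hside (by linarith) (by linarith) with h5 | h5 | h5
  · obtain ⟨h6, h7⟩ := abs_div_sub_lt hr h5
    refine ⟨isom A, hAmem, _, ?_, h7⟩
    rw [isom_smul_infty, if_neg h6]
  · exact hvert k hk.le h5
  · exact hvert (k + 1) hk h5

/-- Every neighbourhood contains a point of the orbit of `∞`, and the stabilizer of that point is
infinite, containing conjugates of all powers of the translation. -/
theorem ordinarySet_eq_empty (hN : 1 ≤ N) : ordinarySet (cuspGroup N v h) = ∅ := by
  rw [Set.eq_empty_iff_forall_notMem]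
  rintro x ⟨U, hU, hfin⟩
  have h1 : ∃ γ ∈ cuspGroup N v h, γ • (OnePoint.infty : OnePoint ℝ) ∈ U := by
    rcases x with _ | x
    · exact ⟨1, one_mem _, by rw [one_smul]; exact mem_of_mem_nhds hU⟩
    · have h2 : ((↑) : ℝ → OnePoint ℝ) ⁻¹' U ∈ 𝓝 x :=
        (OnePoint.continuous_coe.tendsto x) hU
      obtain ⟨r, hr, hrU⟩ := Metric.mem_nhds_iff.1 h2
      obtain ⟨γ, hγ, y, h3, h4⟩ := exists_smul_infty_near hv hh hN x hr
      exact ⟨γ, hγ, by rw [h3]; exact hrU h4⟩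
  obtain ⟨γ, hγ, hγU⟩ := h1
  let g : cuspGroup N v h := ⟨γ, hγ⟩
  let T : cuspGroup N v h := ⟨cuspElt N v h (N + 1), cuspElt_mem (by omega)⟩
  have hT : ∀ m : ℤ, (T ^ m) • (OnePoint.infty : OnePoint ℝ) = OnePoint.infty := by
    intro m
    have : T ∈ MulAction.stabilizer (cuspGroup N v h) (OnePoint.infty : OnePoint ℝ) :=
      cuspElt_last_smul_infty hv hh
    exact zpow_mem this m
  refine Set.infinite_of_injective_forall_mem (f := fun m : ℤ => g * T ^ m * g⁻¹) ?_ ?_ hfin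
  · intro m m' hmm
    have h2 : T ^ m = T ^ m' := mul_left_cancel (mul_right_cancel hmm)
    have h3 := congrArg (fun t : cuspGroup N v h => ((t : PSL(2, ℝ)) • I).re) h2
    simp only [T, Subgroup.coe_zpow, cuspElt_last_zpow_smul hv hh, vadd_re, add_left_inj,
      neg_inj] at h3
    exact_mod_cast mul_right_cancel₀ (cuspWidth_pos hv hh hN).ne' h3
  · intro m
    refine ⟨γ • OnePoint.infty, ⟨γ • OnePoint.infty, hγU, ?_⟩, hγU⟩
    change (g * T ^ m * g⁻¹) • g • (OnePoint.infty : OnePoint ℝ) = _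
    rw [mul_smul, mul_smul, inv_smul_smul, hT]
    rfl

end

end HypPlane

/-! ### Coordinates on an ideal triangle folded along its bottom side. -/

namespace HypPlane

open UpperHalfPlane Topology Filter

/-- A coordinate on `[u, w]` with values in `[-1, 1]`, exchanged with its negative by the half-turn about the
center on the semicircle with end points `u` and `w`. -/
noncomputable def stripSigma (u w p q x : ℝ) : ℝ :=
  ((x - u) * q - (w - x) * p) / ((x - u) * q + (w - x) * p)

/-- The height above the semicircle with end points `u` and `w`. -/
noncomputable def stripEta (u w p q : ℝ) (z : ℍ) : ℝ :=
  ((z.re - u) * (z.re - w) + z.im ^ 2) * (w - u) / ((z.re - u) * q + (w - z.re) * p)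

/-- The radial coordinate on the ideal triangle with vertices `u`, `w`, `∞` folded along its bottom side. -/
noncomputable def stripR (u w p q : ℝ) (z : ℍ) : ℝ :=
  stripEta u w p q z + 1 - |stripSigma u w p q z.re|

/-- The horizontal coordinate on the ideal triangle with vertices `u`, `w`, `∞` folded along its bottom
side. -/
noncomputable def stripX (u w p q : ℝ) (z : ℍ) : ℝ :=
  stripSigma u w p q z.re * stripEta u w p q z / stripR u w p q z

/-- The ideal triangle with vertices `u`, `w`, `∞`. -/
def strip (u w : ℝ) : Set ℍ := {z | (u ≤ z.re ∧ z.re ≤ w) ∧ (z.re - u) * (w - z.re) ≤ z.im ^ 2}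

section

variable {u w p q : ℝ} (huw : u < w) (hp : 0 < p) (hq : 0 < q)
include huw hp hq

theorem strip_denom_pos {x : ℝ} (h1 : u ≤ x) (h2 : x ≤ w) : 0 < (x - u) * q + (w - x) * p := by
  rcases h1.eq_or_lt with rfl | h
  · have := mul_pos (sub_pos.2 huw) hp
    linarith
  · have h3 := mul_pos (sub_pos.2 h) hq
    have h4 := mul_nonneg (sub_nonneg.2 h2) hp.le
    linarith

theorem one_sub_stripSigma {x : ℝ} (h1 : u ≤ x) (h2 : x ≤ w) :
    1 - stripSigma u w p q x = 2 * ((w - x) * p) / ((x - u) * q + (w - x) * p) := by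
  have := (strip_denom_pos huw hp hq h1 h2).ne'
  rw [stripSigma, eq_div_iff this, sub_mul, div_mul_cancel₀ _ this]
  ring

theorem one_add_stripSigma {x : ℝ} (h1 : u ≤ x) (h2 : x ≤ w) :
    1 + stripSigma u w p q x = 2 * ((x - u) * q) / ((x - u) * q + (w - x) * p) := by
  have := (strip_denom_pos huw hp hq h1 h2).ne'
  rw [stripSigma, eq_div_iff this, add_mul, div_mul_cancel₀ _ this]
  ring

theorem abs_stripSigma_le {x : ℝ} (h1 : u ≤ x) (h2 : x ≤ w) : |stripSigma u w p q x| ≤ 1 := by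
  have h3 := strip_denom_pos huw hp hq h1 h2
  have h4 := one_sub_stripSigma huw hp hq h1 h2
  have h5 := one_add_stripSigma huw hp hq h1 h2
  have h6 := sub_nonneg.2 h1
  have h7 := sub_nonneg.2 h2
  have h8 : 0 ≤ 2 * ((w - x) * p) / ((x - u) * q + (w - x) * p) := by positivity
  have h9 : 0 ≤ 2 * ((x - u) * q) / ((x - u) * q + (w - x) * p) := by positivity
  rw [abs_le]
  constructor <;> linarith

theorem stripSigma_injOn {x x' : ℝ} (h1 : u ≤ x) (h2 : x ≤ w) (h1' : u ≤ x') (h2' : x' ≤ w)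
    (h : stripSigma u w p q x = stripSigma u w p q x') : x = x' := by
  have h3 := strip_denom_pos huw hp hq h1 h2
  have h4 := strip_denom_pos huw hp hq h1' h2'
  rw [stripSigma, stripSigma, div_eq_div_iff h3.ne' h4.ne'] at h
  have h5 : 2 * p * q * (w - u) * (x - x') = 0 := by linear_combination h
  have h6 : 2 * p * q * (w - u) ≠ 0 := by
    have := sub_pos.2 huw
    positivity
  linarith [(mul_eq_zero.1 h5).resolve_left h6]

theorem eq_right_of_stripSigma {x : ℝ} (h1 : u ≤ x) (h2 : x ≤ w) (h : stripSigma u w p q x = 1) :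
    x = w := by
  have h3 := strip_denom_pos huw hp hq h1 h2
  rw [stripSigma, div_eq_one_iff_eq h3.ne'] at h
  have h4 : p * (w - x) = 0 := by linarith
  linarith [(mul_eq_zero.1 h4).resolve_left hp.ne']

theorem eq_left_of_stripSigma {x : ℝ} (h1 : u ≤ x) (h2 : x ≤ w) (h : stripSigma u w p q x = -1) :
    x = u := by
  have h3 := strip_denom_pos huw hp hq h1 h2
  rw [stripSigma, div_eq_iff h3.ne'] at h
  have h4 : q * (x - u) = 0 := by linarith
  linarith [(mul_eq_zero.1 h4).resolve_left hq.ne']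

theorem stripEta_nonneg {z : ℍ} (hz : z ∈ strip u w) : 0 ≤ stripEta u w p q z := by
  obtain ⟨⟨h1, h2⟩, h3⟩ := hz
  have h4 := strip_denom_pos huw hp hq h1 h2
  have h5 := sub_pos.2 huw
  have h6 : 0 ≤ (z.re - u) * (z.re - w) + z.im ^ 2 := by linarith
  rw [stripEta]
  positivity

omit hq in
theorem stripSigma_left : stripSigma u w p q u = -1 := by
  have := mul_pos (sub_pos.2 huw) hp
  rw [stripSigma, sub_self, zero_mul, zero_sub, zero_add, neg_div, div_self this.ne']

omit hp in
theorem stripSigma_right : stripSigma u w p q w = 1 := by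
  have := mul_pos (sub_pos.2 huw) hq
  rw [stripSigma, sub_self, zero_mul, sub_zero, add_zero, div_self this.ne']

omit hq in
theorem stripR_left {z : ℍ} (hz : z.re = u) : stripR u w p q z = z.im ^ 2 / p := by
  have h1 : w - u ≠ 0 := (sub_pos.2 huw).ne'
  rw [stripR, hz, stripSigma_left huw hp, stripEta, hz]
  simp
  field_simp

omit hp in
theorem stripR_right {z : ℍ} (hz : z.re = w) : stripR u w p q z = z.im ^ 2 / q := by
  have h1 : w - u ≠ 0 := (sub_pos.2 huw).ne'
  rw [stripR, hz, stripSigma_right huw hq, stripEta, hz]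
  simp
  field_simp

omit hq in
theorem stripX_left {z : ℍ} (hz : z.re = u) : stripX u w p q z = -1 := by
  have h1 := stripR_left (q := q) huw hp hz
  have h2 : stripR u w p q z = stripEta u w p q z := by
    rw [stripR, hz, stripSigma_left huw hp]
    simp
  have h3 : stripR u w p q z ≠ 0 := by
    rw [h1]
    have := z.im_pos
    positivity
  rw [stripX, ← h2, hz, stripSigma_left huw hp, mul_div_assoc, div_self h3, mul_one]

omit hp in
theorem stripX_right {z : ℍ} (hz : z.re = w) : stripX u w p q z = 1 := by
  have h1 := stripR_right (p := p) huw hq hz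
  have h2 : stripR u w p q z = stripEta u w p q z := by
    rw [stripR, hz, stripSigma_right huw hq]
    simp
  have h3 : stripR u w p q z ≠ 0 := by
    rw [h1]
    have := z.im_pos
    positivity
  rw [stripX, ← h2, hz, stripSigma_right huw hq, mul_div_assoc, div_self h3, mul_one]

theorem stripR_pos {z : ℍ} (hz : z ∈ strip u w) : 0 < stripR u w p q z := by
  have h1 := stripEta_nonneg huw hp hq hz
  obtain ⟨⟨h2, h3⟩, -⟩ := id hz
  have h4 := abs_stripSigma_le huw hp hq h2 h3
  rcases h4.lt_or_eq with h5 | h5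
  · rw [stripR]
    linarith
  · have := z.im_pos
    rcases eq_or_eq_neg_of_abs_eq h5 with h6 | h6
    · rw [stripR_right huw hq (eq_right_of_stripSigma huw hp hq h2 h3 h6)]
      positivity
    · rw [stripR_left huw hp (eq_left_of_stripSigma huw hp hq h2 h3 h6)]
      positivity

/-- With `σ`, `η`, `R` for the three functions, `R - |σ| η = (1 - |σ|) (1 + η)`. Equality therefore
occurs only for `|σ| = 1`, on the vertical sides. -/
theorem abs_stripX_le {z : ℍ} (hz : z ∈ strip u w) : |stripX u w p q z| ≤ 1 := by
  have h1 := stripEta_nonneg huw hp hq hz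
  have h2 := abs_stripSigma_le huw hp hq hz.1.1 hz.1.2
  have h3 := stripR_pos huw hp hq hz
  rw [stripX, abs_div, abs_of_pos h3, div_le_one h3, abs_mul, abs_of_nonneg h1, stripR]
  nlinarith

theorem stripSigma_of_abs_stripX {z : ℍ} (hz : z ∈ strip u w) (h : |stripX u w p q z| = 1) :
    stripSigma u w p q z.re = stripX u w p q z := by
  have h1 := stripEta_nonneg huw hp hq hz
  have h2 := abs_stripSigma_le huw hp hq hz.1.1 hz.1.2
  have h3 := stripR_pos huw hp hq hz
  rw [stripX, abs_div, abs_of_pos h3, div_eq_one_iff_eq h3.ne', abs_mul, abs_of_nonneg h1] at h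
  have h4 : |stripSigma u w p q z.re| = 1 := by
    have : (1 - |stripSigma u w p q z.re|) * (1 + stripEta u w p q z) = 0 := by
      rw [stripR] at h
      linear_combination -h
    have h5 := (mul_eq_zero.1 this).resolve_right (by linarith)
    linarith
  have h5 : stripR u w p q z = stripEta u w p q z := by
    rw [← h, h4, one_mul]
  rw [stripX, ← h5, mul_div_assoc, div_self h3.ne', mul_one]

theorem re_eq_right_of_stripX {z : ℍ} (hz : z ∈ strip u w) (h : stripX u w p q z = 1) :
    z.re = w := by
  have := stripSigma_of_abs_stripX huw hp hq hz (by rw [h, abs_one])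
  exact eq_right_of_stripSigma huw hp hq hz.1.1 hz.1.2 (this.trans h)

theorem re_eq_left_of_stripX {z : ℍ} (hz : z ∈ strip u w) (h : stripX u w p q z = -1) :
    z.re = u := by
  have := stripSigma_of_abs_stripX huw hp hq hz (by rw [h, abs_neg, abs_one])
  exact eq_left_of_stripSigma huw hp hq hz.1.1 hz.1.2 (this.trans h)

theorem eq_of_stripSigma_of_stripEta {z z' : ℍ} (hz : z ∈ strip u w) (hz' : z' ∈ strip u w)
    (hσ : stripSigma u w p q z.re = stripSigma u w p q z'.re)
    (hη : stripEta u w p q z = stripEta u w p q z') : z = z' := by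
  have h1 := stripSigma_injOn huw hp hq hz.1.1 hz.1.2 hz'.1.1 hz'.1.2 hσ
  have h2 := strip_denom_pos huw hp hq hz.1.1 hz.1.2
  have h3 := sub_pos.2 huw
  rw [stripEta, stripEta, ← h1, div_left_inj' h2.ne', mul_left_inj' h3.ne', add_right_inj] at hη
  exact ext_re_im h1 ((sq_eq_sq₀ z.im_pos.le z'.im_pos.le).1 hη)

/-- The coordinates `stripX` and `stripR` determine a point of the ideal triangle up to the folding of the
bottom side. -/
theorem strip_coords_inj {z z' : ℍ} (hz : z ∈ strip u w) (hz' : z' ∈ strip u w)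
    (hX : stripX u w p q z = stripX u w p q z') (hR : stripR u w p q z = stripR u w p q z') :
    z = z' ∨ (stripEta u w p q z = 0 ∧ stripEta u w p q z' = 0 ∧
      stripSigma u w p q z'.re = -stripSigma u w p q z.re) := by
  have h1 := stripEta_nonneg huw hp hq hz
  have h1' := stripEta_nonneg huw hp hq hz'
  have h3 := stripR_pos huw hp hq hz
  rw [stripX, stripX, ← hR, div_left_inj' h3.ne'] at hX
  rw [stripR, stripR] at hR
  have key := eq_of_stripSigma_of_stripEta huw hp hq hz hz'
  generalize stripEta u w p q z = η at *
  generalize stripEta u w p q z' = η' at *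
  generalize stripSigma u w p q z.re = σ at *
  generalize stripSigma u w p q z'.re = σ' at *
  have hX' := congrArg abs hX
  rw [abs_mul, abs_mul, abs_of_nonneg h1, abs_of_nonneg h1'] at hX'
  -- Equal `R` fixes `η - |σ|` and equal `X` fixes `|σ| η`, so both `|σ|` and `η` agree. The sign of
  -- `σ` is lost only where `η = 0`.
  have h4 : (|σ| - |σ'|) * (η + |σ'|) = 0 := by
    have : η' = η - |σ| + |σ'| := by linarith
    rw [this] at hX'
    linear_combination hX'
  have h5 : |σ| = |σ'| := by
    rcases mul_eq_zero.1 h4 with h | h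
    · linarith
    · have h6 := abs_nonneg σ
      have h7 := abs_nonneg σ'
      linarith
  have h6 : η = η' := by linarith
  rcases abs_eq_abs.1 h5 with h | h
  · exact Or.inl (key h h6)
  · rw [h, ← h6] at hX
    have h7 : σ' * η = 0 := by linarith
    rcases mul_eq_zero.1 h7 with h8 | h8
    · exact Or.inl (key (by rw [h, h8, neg_zero]) h6)
    · exact Or.inr ⟨h8, h6 ▸ h8, by rw [h, neg_neg]⟩

/-- The numbers `t = |σ|` and `η` solve `η - t = R - 1` and `t η = R |X|`, a quadratic system; `σ`
then gives the real part and `η` the height. -/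
theorem exists_strip_coords {X R : ℝ} (hX : |X| ≤ 1) (hR : 0 < R) :
    ∃ z ∈ strip u w, stripX u w p q z = X ∧ stripR u w p q z = R := by
  -- `S` is the sum `η + t`.
  set S := √((R - 1) ^ 2 + 4 * R * |X|) with hS
  have hX0 := abs_nonneg X
  have hin : 0 ≤ (R - 1) ^ 2 + 4 * R * |X| := by positivity
  have hS2 : S ^ 2 = (R - 1) ^ 2 + 4 * R * |X| := Real.sq_sqrt hin
  have hS0 : |R - 1| ≤ S := Real.abs_le_sqrt (by nlinarith [mul_nonneg hR.le hX0])
  have hS1 : S ≤ R + 1 := by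
    rw [hS, Real.sqrt_le_left (by linarith)]
    nlinarith
  rw [abs_le] at hS0
  set t := (1 - R + S) / 2 with ht
  set η := (R - 1 + S) / 2 with hη
  have ht0 : 0 ≤ t := by rw [ht]; linarith
  have ht1 : t ≤ 1 := by rw [ht]; linarith
  have hη0 : 0 ≤ η := by rw [hη]; linarith
  have htη : t * η = R * |X| := by rw [ht, hη]; linear_combination hS2 / 4
  have hηt : η + 1 - t = R := by rw [ht, hη]; ring
  obtain ⟨σ, hσ, hσX⟩ : ∃ σ : ℝ, |σ| = t ∧ σ * η = X * R := by
    rcases le_total 0 X with h | h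
    · exact ⟨t, abs_of_nonneg ht0, by rw [htη, abs_of_nonneg h, mul_comm]⟩
    · exact ⟨-t, by rw [abs_neg, abs_of_nonneg ht0], by
        rw [neg_mul, htη, abs_of_nonpos h]
        ring⟩
  have hσ' := abs_le.1 (hσ.le.trans ht1)
  have hL := sub_pos.2 huw
  have hE : 0 < q * (1 - σ) + p * (1 + σ) := by
    rcases hσ'.2.lt_or_eq with h | h
    · have h1 := mul_pos hq (sub_pos.2 h)
      have h2 := mul_nonneg hp.le (show 0 ≤ 1 + σ by linarith)
      linarith
    · rw [h]
      linarith
  set x := (u * q * (1 - σ) + w * p * (1 + σ)) / (q * (1 - σ) + p * (1 + σ)) with hx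
  have hxu : x - u = (w - u) * p * (1 + σ) / (q * (1 - σ) + p * (1 + σ)) := by
    rw [hx]
    field_simp
    ring
  have hwx : w - x = (w - u) * q * (1 - σ) / (q * (1 - σ) + p * (1 + σ)) := by
    rw [hx]
    field_simp
    ring
  have h1σ : 0 ≤ 1 + σ := by linarith
  have h2σ : 0 ≤ 1 - σ := by linarith
  have hxu0 : 0 ≤ x - u := by rw [hxu]; positivity
  have hwx0 : 0 ≤ w - x := by rw [hwx]; positivity
  have hD := strip_denom_pos huw hp hq (sub_nonneg.1 hxu0) (sub_nonneg.1 hwx0)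
  set D := (x - u) * q + (w - x) * p with hDdef
  have hDval : D = 2 * (w - u) * p * q / (q * (1 - σ) + p * (1 + σ)) := by
    rw [hDdef, hxu, hwx]
    field_simp
    ring
  -- The squared height must be positive. If `η = 0`, then `|σ| = 1 - R < 1` keeps `x` off the end
  -- points.
  have hc : 0 < η * D / (w - u) + (x - u) * (w - x) := by
    rcases hη0.lt_or_eq with h | h
    · have := mul_nonneg hxu0 hwx0
      positivity
    · have hlt : |σ| < 1 := by linarith
      rw [abs_lt] at hlt
      have h1 : 0 < x - u := by
        rw [hxu]
        have : 0 < 1 + σ := by linarith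
        positivity
      have h2 : 0 < w - x := by
        rw [hwx]
        have : 0 < 1 - σ := by linarith
        positivity
      have h3 := mul_pos h1 h2
      have h4 : 0 ≤ η * D / (w - u) := by positivity
      linarith
  have hzre := ptOfSq_re (a := x) hc
  have hzim := ptOfSq_im_sq (a := x) hc
  set z := ptOfSq x (η * D / (w - u) + (x - u) * (w - x)) with hz
  have hσz : stripSigma u w p q z.re = σ := by
    rw [hzre, stripSigma, div_eq_iff hD.ne']
    change _ = σ * D
    rw [hDval, hxu, hwx]
    field_simp
    ring
  have hηz : stripEta u w p q z = η := by
    rw [stripEta, hzre, hzim]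
    change _ / D = _
    field_simp
    ring
  have hRz : stripR u w p q z = R := by rw [stripR, hσz, hηz, hσ, hηt]
  refine ⟨z, ⟨⟨by rw [hzre]; linarith, by rw [hzre]; linarith⟩, ?_⟩, ?_, hRz⟩
  · rw [hzre, hzim]
    have : 0 ≤ η * D / (w - u) := by positivity
    linarith
  · rw [stripX, hRz, hσz, hηz, hσX]
    field_simp

theorem continuousOn_stripR : ContinuousOn (stripR u w p q) (strip u w) ∧
    ContinuousOn (stripX u w p q) (strip u w) := by
  have hre : ContinuousOn UpperHalfPlane.re (strip u w) := continuous_re.continuousOn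
  have him : ContinuousOn UpperHalfPlane.im (strip u w) := continuous_im.continuousOn
  have h0 : ∀ z ∈ strip u w, (z.re - u) * q + (w - z.re) * p ≠ 0 := fun z hz =>
    (strip_denom_pos huw hp hq hz.1.1 hz.1.2).ne'
  have h1 : ContinuousOn (fun z : ℍ => stripSigma u w p q z.re) (strip u w) := by
    unfold stripSigma
    exact ContinuousOn.div (by fun_prop) (by fun_prop) h0
  have h2 : ContinuousOn (stripEta u w p q) (strip u w) := by
    unfold stripEta
    exact ContinuousOn.div (by fun_prop) (by fun_prop) h0
  have h3 : ContinuousOn (stripR u w p q) (strip u w) := by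
    unfold stripR
    exact (h2.add continuousOn_const).sub h1.abs
  exact ⟨h3, (h1.mul h2).div h3 fun z hz => (stripR_pos huw hp hq hz).ne'⟩

/-- The half-turn about the center on the semicircle changes the sign of `stripSigma`. -/
theorem stripSigma_flip {x y a b m : ℝ} (hux : u ≤ x) (hxw : x ≤ w)
    (ha : a = (q * u + p * w) / (p + q)) (hb : b = p * q * (w - u) ^ 2 / (p + q) ^ 2)
    (hm : m = (x - a) ^ 2 + y ^ 2) (hm0 : 0 < m) (hy : y ^ 2 = (x - u) * (w - x))
    (hx1 : u ≤ a - b * (x - a) / m) (hx2 : a - b * (x - a) / m ≤ w) :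
    stripSigma u w p q (a - b * (x - a) / m) = -stripSigma u w p q x := by
  have hD := strip_denom_pos huw hp hq hux hxw
  have hD' := strip_denom_pos huw hp hq hx1 hx2
  have hpq : p + q ≠ 0 := by positivity
  -- On the semicircle the squared distance to `a` is affine in `x`.
  have hm' : m * (p + q) ^ 2 = (w - u) * (p * q * (w - u) + (q ^ 2 - p ^ 2) * (x - a)) := by
    rw [hm, hy, ha]
    field_simp
    ring
  rw [stripSigma, stripSigma, ← neg_div, div_eq_div_iff hD'.ne' hD.ne']
  have e : b * (x - a) / m * m = b * (x - a) := div_mul_cancel₀ _ hm0.ne'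
  have ha' : a * (p + q) = q * u + p * w := by rw [ha]; field_simp
  have hb' : b * (p + q) ^ 2 = p * q * (w - u) ^ 2 := by rw [hb]; field_simp
  set τ := b * (x - a) / m with hτ
  have h1 : τ * (p * q * (w - u) + (q ^ 2 - p ^ 2) * (x - a)) = p * q * (w - u) * (x - a) := by
    have hL : w - u ≠ 0 := (sub_pos.2 huw).ne'
    apply mul_left_cancel₀ hL
    linear_combination (-τ) * hm' + (p + q) ^ 2 * e + (x - a) * hb'
  have e1 : (a - τ - u) * q - (w - (a - τ)) * p = -(τ * (p + q)) := by linear_combination ha'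
  have e2 : (x - u) * q - (w - x) * p = (p + q) * (x - a) := by linear_combination ha'
  rw [e1, e2]
  apply mul_left_cancel₀ hpq
  linear_combination (-2 * (p + q)) * h1 + (p + q) * (q - p) * (x - a - τ) * ha'

end

end HypPlane

/-! ### The folding map, assembled from the triangles by the complex cosine. -/

namespace HypPlane

open UpperHalfPlane Topology Filter

/-- On the strip of width `π` the cosine identifies nothing except `l` with `-l` on the two edges.
These edges will be the vertical sides of the polygon, folded by their half-turns. -/
theorem cos_strip_inj {θ θ' l l' : ℝ} (h0 : 0 ≤ θ) (h1 : θ ≤ Real.pi) (h0' : 0 ≤ θ') (h1' : θ' ≤ Real.pi)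
    (h : Complex.cos (θ + l * Complex.I) = Complex.cos (θ' + l' * Complex.I)) :
    θ' = θ ∧ (l' = l ∨ ((θ = 0 ∨ θ = Real.pi) ∧ l' = -l)) := by
  have hpi := Real.pi_pos
  obtain ⟨k, hk | hk⟩ := Complex.cos_eq_cos_iff.1 h
  · have hr := congrArg Complex.re hk
    have hi := congrArg Complex.im hk
    simp at hr hi
    have : k = 0 := by
      have h2 : (k : ℝ) < 1 := by nlinarith
      have h3 : (-1 : ℝ) < k := by nlinarith
      have h2' : k < 1 := by exact_mod_cast h2
      have h3' : -1 < k := by exact_mod_cast h3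
      omega
    subst this
    simp at hr
    exact ⟨hr, Or.inl hi⟩
  · have hr := congrArg Complex.re hk
    have hi := congrArg Complex.im hk
    simp at hr hi
    have : k = 0 ∨ k = 1 := by
      have h2 : (k : ℝ) < 2 := by nlinarith
      have h3 : (-1 : ℝ) < k := by nlinarith
      have h2' : k < 2 := by exact_mod_cast h2
      have h3' : -1 < k := by exact_mod_cast h3
      omega
    rcases this with rfl | rfl
    · simp at hr
      exact ⟨by linarith, Or.inr ⟨Or.inl (by linarith), hi⟩⟩
    · simp at hr
      exact ⟨by linarith, Or.inr ⟨Or.inr (by linarith), hi⟩⟩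

/-- Since `|cos (θ + i l)|² = cos² θ + sinh² l`. This is the source of properness. -/
theorem abs_le_norm_cos (θ l : ℝ) : |l| ≤ ‖Complex.cos (θ + l * Complex.I)‖ := by
  have h1 : ‖Complex.cos (θ + l * Complex.I)‖ ^ 2 = Real.cos θ ^ 2 + Real.sinh l ^ 2 := by
    rw [Complex.cos_add_mul_I, ← Complex.normSq_eq_norm_sq, ← Complex.ofReal_cos, ← Complex.ofReal_cosh,
      ← Complex.ofReal_sin, ← Complex.ofReal_sinh, Complex.normSq_apply]
    simp [-Complex.ofReal_cos, -Complex.ofReal_cosh, -Complex.ofReal_sin, -Complex.ofReal_sinh]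
    have h2 := Real.cosh_sq l
    have h3 := Real.sin_sq_add_cos_sq θ
    linear_combination Real.cos θ ^ 2 * h2 + Real.sinh l ^ 2 * h3
  have h2 : |l| ≤ |Real.sinh l| := by
    rw [Real.abs_sinh]
    exact Real.self_le_sinh_iff.2 (abs_nonneg l)
  refine h2.trans (abs_le_of_sq_le_sq ?_ (norm_nonneg _))
  rw [h1]
  nlinarith [sq_nonneg (Real.cos θ)]

theorem exists_cos_strip (w : ℂ) : ∃ θ l : ℝ, 0 ≤ θ ∧ θ ≤ Real.pi ∧
    Complex.cos (θ + l * Complex.I) = w := by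
  obtain ⟨ζ, rfl⟩ := Complex.cos_surjective w
  have hpi := Real.pi_pos
  obtain ⟨m, ⟨h1, h2⟩, -⟩ := existsUnique_sub_zsmul_mem_Ico (mul_pos two_pos hpi) ζ.re (-Real.pi)
  rw [zsmul_eq_mul] at h1 h2
  have h3 : Complex.cos ((ζ.re - m * (2 * Real.pi) : ℝ) + ζ.im * Complex.I) = Complex.cos ζ := by
    rw [← Complex.cos_sub_int_mul_two_pi ζ m]
    congr 1
    apply Complex.ext <;> simp
  rcases le_total 0 (ζ.re - m * (2 * Real.pi)) with h | h
  · exact ⟨_, _, h, by linarith, h3⟩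
  · refine ⟨-(ζ.re - m * (2 * Real.pi)), -ζ.im, by linarith, by linarith, ?_⟩
    rw [← h3, ← Complex.cos_neg]
    congr 1
    push_cast
    ring

/-- The angular coordinate on the `k`-th ideal triangle. -/
noncomputable def foldAngle (v h : ℕ → ℝ) (k : ℕ) (z : ℍ) : ℝ :=
  k + (1 + stripX (v k) (v (k + 1)) (h k) (h (k + 1)) z) / 2

/-- The radial coordinate on the `k`-th ideal triangle. -/
noncomputable def foldRadius (v h : ℕ → ℝ) (k : ℕ) (z : ℍ) : ℝ :=
  stripR (v k) (v (k + 1)) (h k) (h (k + 1)) z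

/-- The quotient map on the `k`-th ideal triangle. -/
noncomputable def foldPiece (N : ℕ) (v h : ℕ → ℝ) (k : ℕ) (z : ℍ) : ℂ :=
  Complex.cos ((foldAngle v h k z * Real.pi / N : ℝ) + Real.log (foldRadius v h k z) * Complex.I)

open Classical in
/-- The map that folds the ideal polygon onto the plane. -/
noncomputable def foldMap (N : ℕ) (v h : ℕ → ℝ) (z : ℍ) : ℂ :=
  if H : ∃ k < N, z ∈ strip (v k) (v (k + 1)) then foldPiece N v h H.choose z else 0

theorem isClosed_strip (u w : ℝ) : IsClosed (strip u w) := by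
  have h1 := continuous_re
  have h2 := continuous_im
  refine ((isClosed_le continuous_const h1).inter (isClosed_le h1 continuous_const)).inter ?_
  exact isClosed_le ((h1.sub continuous_const).mul (continuous_const.sub h1)) (h2.pow 2)

theorem mem_strip_left {u w : ℝ} (huw : u ≤ w) {z : ℍ} (hz : z.re = u) : z ∈ strip u w := by
  refine ⟨⟨hz.ge, hz.le.trans huw⟩, ?_⟩
  rw [hz, sub_self, zero_mul]
  positivity

theorem mem_strip_right {u w : ℝ} (huw : u ≤ w) {z : ℍ} (hz : z.re = w) : z ∈ strip u w := by
  refine ⟨⟨huw.trans hz.ge, hz.le⟩, ?_⟩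
  rw [hz, sub_self, mul_zero]
  positivity

section

variable {N : ℕ} {v h : ℕ → ℝ}

theorem exists_mem_strip (hN : 1 ≤ N) {z : ℍ} (hz : z ∈ cuspPoly N v) :
    ∃ k < N, z ∈ strip (v k) (v (k + 1)) := by
  obtain ⟨h0, h1⟩ := closedPoly_re hz
  obtain ⟨k, hk, h2, h3⟩ := exists_strip hN h0 h1
  exact ⟨k, hk, ⟨h2, h3⟩, closedPoly_side hz hk⟩

theorem mem_cuspPoly_of_mem_strip (hv : StrictMono v) {k : ℕ} (hk : k < N) {z : ℍ}
    (hz : z ∈ strip (v k) (v (k + 1))) : z ∈ cuspPoly N v := by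
  intro i
  refine forall_fin_add_two (p := fun i => 0 ≤ side N v i z) ?_ (fun j hj => ?_) ?_ i
  · rw [side_zero]
    linarith [hz.1.1, hv.monotone (Nat.zero_le k)]
  · rw [side_succ hj]
    rcases lt_trichotomy j k with hjk | rfl | hjk
    · have h1 : v (j + 1) ≤ v k := hv.monotone hjk
      have h2 : v j < v (j + 1) := hv (Nat.lt_succ_self j)
      have := mul_nonneg (show 0 ≤ z.re - v j by linarith [hz.1.1])
        (show 0 ≤ z.re - v (j + 1) by linarith [hz.1.1])
      positivity
    · linarith [hz.2]
    · have h1 : v (k + 1) ≤ v j := hv.monotone hjk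
      have h2 : v j < v (j + 1) := hv (Nat.lt_succ_self j)
      have := mul_nonneg_of_nonpos_of_nonpos (show z.re - v j ≤ 0 by linarith [hz.1.2])
        (show z.re - v (j + 1) ≤ 0 by linarith [hz.1.2])
      positivity
  · rw [side_last]
    linarith [hz.1.2, hv.monotone (show k + 1 ≤ N from hk)]

variable (hv : StrictMono v) (hh : ∀ k, 0 < h k)
include hv hh

theorem foldAngle_mem {k : ℕ} {z : ℍ} (hz : z ∈ strip (v k) (v (k + 1))) :
    k ≤ foldAngle v h k z ∧ foldAngle v h k z ≤ k + 1 := by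
  have := abs_le.1 (abs_stripX_le (hv k.lt_succ_self) (hh k) (hh (k + 1)) hz)
  rw [foldAngle]
  constructor <;> linarith

theorem fold_left {k : ℕ} {z : ℍ} (hz : z.re = v k) :
    foldAngle v h k z = k ∧ foldRadius v h k z = z.im ^ 2 / h k := by
  refine ⟨?_, stripR_left (hv k.lt_succ_self) (hh k) hz⟩
  rw [foldAngle, stripX_left (hv k.lt_succ_self) (hh k) hz]
  ring

theorem fold_right {k : ℕ} {z : ℍ} (hz : z.re = v (k + 1)) :
    foldAngle v h k z = (k + 1 : ℕ) ∧ foldRadius v h k z = z.im ^ 2 / h (k + 1) := by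
  refine ⟨?_, stripR_right (hv k.lt_succ_self) (hh (k + 1)) hz⟩
  rw [foldAngle, stripX_right (hv k.lt_succ_self) (hh (k + 1)) hz]
  push_cast
  ring

theorem re_eq_left_of_foldAngle {k : ℕ} {z : ℍ} (hz : z ∈ strip (v k) (v (k + 1)))
    (h1 : foldAngle v h k z = k) : z.re = v k :=
  re_eq_left_of_stripX (hv k.lt_succ_self) (hh k) (hh (k + 1)) hz (by rw [foldAngle] at h1; linarith)

theorem re_eq_right_of_foldAngle {k : ℕ} {z : ℍ} (hz : z ∈ strip (v k) (v (k + 1)))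
    (h1 : foldAngle v h k z = k + 1) : z.re = v (k + 1) :=
  re_eq_right_of_stripX (hv k.lt_succ_self) (hh k) (hh (k + 1)) hz (by rw [foldAngle] at h1; linarith)

/-- Different triangles meet only along a vertical line over a vertex, where both radii are the
squared height divided by the same `h`. This makes `foldMap` independent of the triangle chosen. -/
theorem fold_eq_of_mem {k l : ℕ} {z : ℍ} (hk : z ∈ strip (v k) (v (k + 1)))
    (hl : z ∈ strip (v l) (v (l + 1))) :
    foldAngle v h k z = foldAngle v h l z ∧ foldRadius v h k z = foldRadius v h l z := by
  wlog hkl : k ≤ l generalizing k l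
  · have := this hl hk (by omega)
    exact ⟨this.1.symm, this.2.symm⟩
  rcases hkl.eq_or_lt with rfl | hlt
  · exact ⟨rfl, rfl⟩
  · have h1 : v l ≤ v (k + 1) := hl.1.1.trans hk.1.2
    have h2 : l ≤ k + 1 := hv.le_iff_le.1 h1
    obtain rfl : l = k + 1 := by omega
    have h3 : z.re = v (k + 1) := le_antisymm hk.1.2 hl.1.1
    have h4 := fold_right hv hh h3
    have h5 := fold_left hv hh h3
    exact ⟨h4.1.trans h5.1.symm, h4.2.trans h5.2.symm⟩

theorem foldMap_eq {k : ℕ} (hk : k < N) {z : ℍ} (hz : z ∈ strip (v k) (v (k + 1))) :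
    foldMap N v h z = foldPiece N v h k z := by
  have H : ∃ k < N, z ∈ strip (v k) (v (k + 1)) := ⟨k, hk, hz⟩
  have h1 := fold_eq_of_mem hv hh H.choose_spec.2 hz
  rw [foldMap, dif_pos H, foldPiece, foldPiece, h1.1, h1.2]

/-- The angles of triangle `k` fill `[k, k + 1]`; equality across two triangles forces the point of
the first onto the common vertical line. -/
theorem exists_common_strip {k l : ℕ} (hk : k < N) (hl : l < N) {z z' : ℍ}
    (hz : z ∈ strip (v k) (v (k + 1))) (hz' : z' ∈ strip (v l) (v (l + 1)))
    (hA : foldAngle v h k z = foldAngle v h l z') :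
    ∃ m < N, z ∈ strip (v m) (v (m + 1)) ∧ z' ∈ strip (v m) (v (m + 1)) := by
  wlog hkl : k ≤ l generalizing k l z z'
  · obtain ⟨m, hm, h1, h2⟩ := this hl hk hz' hz hA.symm (by omega)
    exact ⟨m, hm, h2, h1⟩
  rcases hkl.eq_or_lt with rfl | hlt
  · exact ⟨k, hk, hz, hz'⟩
  · have h1 := (foldAngle_mem hv hh hz).2
    have h2 := (foldAngle_mem hv hh hz').1
    have h3 : (k : ℝ) + 1 ≤ l := by exact_mod_cast hlt
    have h4 : (l : ℝ) = k + 1 := by linarith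
    have h5 : l = k + 1 := by exact_mod_cast h4
    subst h5
    have h6 : z.re = v (k + 1) := re_eq_right_of_foldAngle hv hh hz (by linarith)
    exact ⟨k + 1, hl, mem_strip_left (hv (Nat.lt_succ_self _)).le h6, hz'⟩

theorem foldRadius_pos {k : ℕ} {z : ℍ} (hz : z ∈ strip (v k) (v (k + 1))) :
    0 < foldRadius v h k z :=
  stripR_pos (hv k.lt_succ_self) (hh k) (hh (k + 1)) hz

theorem continuousOn_foldMap (hN : 1 ≤ N) : ContinuousOn (foldMap N v h) (cuspPoly N v) := by
  have h1 : ∀ k : Fin N, ContinuousOn (foldMap N v h) (strip (v k) (v (k + 1))) := by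
    intro k
    have h2 := continuousOn_stripR (hv k.1.lt_succ_self) (hh k) (hh (k + 1))
    have h3 : ContinuousOn (foldPiece N v h k) (strip (v k) (v (k + 1))) := by
      unfold foldPiece
      have hA : ContinuousOn (foldAngle v h k) (strip (v k) (v (k + 1))) := by
        unfold foldAngle
        exact continuousOn_const.add ((continuousOn_const.add h2.2).div_const 2)
      have hR : ContinuousOn (fun z => Real.log (foldRadius v h k z)) (strip (v k) (v (k + 1))) :=
        h2.1.log fun z hz => (foldRadius_pos hv hh hz).ne'
      refine Complex.continuous_cos.comp_continuousOn ?_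
      refine (Complex.continuous_ofReal.comp_continuousOn ((hA.mul continuousOn_const).div_const _)).add ?_
      exact (Complex.continuous_ofReal.comp_continuousOn hR).mul continuousOn_const
    exact h3.congr fun z hz => foldMap_eq hv hh k.2 hz
  refine ((locallyFinite_of_finite _).continuousOn_iUnion (fun k => isClosed_strip _ _) h1).mono ?_
  intro z hz
  obtain ⟨k, hk, hzk⟩ := exists_mem_strip hN hz
  exact Set.mem_iUnion.2 ⟨⟨k, hk⟩, hzk⟩

theorem exists_foldMap_eq (hN : 1 ≤ N) (w : ℂ) : ∃ z ∈ cuspPoly N v, foldMap N v h z = w := by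
  obtain ⟨θ, l, h0, h1, rfl⟩ := exists_cos_strip w
  have hpi := Real.pi_pos
  have hN0 : (0 : ℝ) < N := by exact_mod_cast hN
  -- The integers play the role of the vertices here: the rescaled angle selects its triangle.
  obtain ⟨k, hk, h2, h3⟩ := exists_strip (v := fun n => (n : ℝ)) (x := θ * N / Real.pi) hN
    (by simp; positivity) (by rw [div_le_iff₀ hpi]; nlinarith)
  push_cast at h3
  obtain ⟨z, hz, hX, hR⟩ := exists_strip_coords (hv k.lt_succ_self) (hh k) (hh (k + 1))
    (X := 2 * (θ * N / Real.pi - k) - 1) (R := Real.exp l)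
    (abs_le.2 ⟨by linarith, by linarith⟩) (Real.exp_pos l)
  refine ⟨z, mem_cuspPoly_of_mem_strip hv hk hz, ?_⟩
  have h4 : foldAngle v h k z = θ * N / Real.pi := by
    rw [foldAngle, hX]
    ring
  have h5 : foldRadius v h k z = Real.exp l := hR
  rw [foldMap_eq hv hh hk hz, foldPiece, h4, h5, Real.log_exp]
  congr 3
  field_simp

end

end HypPlane

/-! ### Properness and fibers of the folding map. -/

namespace HypPlane

open UpperHalfPlane Topology Filter

section

variable {u w p q a b : ℝ} (huw : u < w) (ha : 0 < a) (hp : a ≤ p ∧ p ≤ b) (hq : a ≤ q ∧ q ≤ b)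
include huw ha hp hq

omit huw ha in
theorem strip_denom_bounds {x : ℝ} (h1 : u ≤ x) (h2 : x ≤ w) :
    (w - u) * a ≤ (x - u) * q + (w - x) * p ∧ (x - u) * q + (w - x) * p ≤ (w - u) * b := by
  have h3 := mul_le_mul_of_nonneg_left hq.1 (sub_nonneg.2 h1)
  have h4 := mul_le_mul_of_nonneg_left hp.1 (sub_nonneg.2 h2)
  have h5 := mul_le_mul_of_nonneg_left hq.2 (sub_nonneg.2 h1)
  have h6 := mul_le_mul_of_nonneg_left hp.2 (sub_nonneg.2 h2)
  constructor <;> linarith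

/-- With `stripR_le_im_sq`, this compares the radius with the squared height in both directions,
uniformly over the triangles; bounded `|log R|` then means bounded heights away from zero. -/
theorem im_sq_le_stripR {z : ℍ} (hz : z ∈ strip u w) :
    z.im ^ 2 ≤ stripR u w p q z * b + (w - u) ^ 2 := by
  have hp0 := ha.trans_le hp.1
  have hq0 := ha.trans_le hq.1
  have hD := strip_denom_pos huw hp0 hq0 hz.1.1 hz.1.2
  have hDb := (strip_denom_bounds hp hq hz.1.1 hz.1.2).2
  have hσ := abs_stripSigma_le huw hp0 hq0 hz.1.1 hz.1.2
  have hη : stripEta u w p q z ≤ stripR u w p q z := by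
    rw [stripR]
    linarith
  have hL := sub_pos.2 huw
  have h4 := mul_le_mul hη hDb hD.le (stripR_pos huw hp0 hq0 hz).le
  have h5 : (z.re - u) * (z.re - w) + z.im ^ 2 ≤ stripR u w p q z * b := by
    refine le_of_mul_le_mul_right ?_ hL
    rw [stripEta, div_mul_cancel₀ _ hD.ne'] at h4
    linarith
  have h6 : (z.re - u) * (w - z.re) ≤ (w - u) * (w - u) :=
    mul_le_mul (by linarith [hz.1.2]) (by linarith [hz.1.1]) (by linarith [hz.1.2]) hL.le
  linarith

theorem stripR_le_im_sq {δ : ℝ} (hδ : 0 < δ) (hδw : δ ≤ w - u) {z : ℍ} (hz : z ∈ strip u w) :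
    stripR u w p q z ≤ z.im ^ 2 * (1 / a + 4 * b ^ 2 / (δ ^ 2 * a ^ 2)) := by
  have hp0 := ha.trans_le hp.1
  have hq0 := ha.trans_le hq.1
  have hb := hp0.trans_le hp.2
  have hD := strip_denom_pos huw hp0 hq0 hz.1.1 hz.1.2
  have hDa := (strip_denom_bounds hp hq hz.1.1 hz.1.2).1
  have hη := stripEta_nonneg huw hp0 hq0 hz
  have hσ := abs_stripSigma_le huw hp0 hq0 hz.1.1 hz.1.2
  have h2 := one_sub_stripSigma huw hp0 hq0 hz.1.1 hz.1.2
  have h3 := one_add_stripSigma huw hp0 hq0 hz.1.1 hz.1.2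
  have hL := sub_pos.2 huw
  have h4 : stripEta u w p q z ≤ z.im ^ 2 * (1 / a) := by
    rw [stripEta, mul_one_div, div_le_div_iff₀ hD ha, mul_assoc]
    have h5 := mul_nonneg (sub_nonneg.2 hz.1.1) (sub_nonneg.2 hz.1.2)
    refine mul_le_mul (by linarith) hDa (by positivity) (by positivity)
  have h5 : 1 - |stripSigma u w p q z.re| ≤ z.im ^ 2 * (4 * b ^ 2 / (δ ^ 2 * a ^ 2)) := by
    -- Passing from `1 - |σ|` to `(1 - σ) (1 + σ)` produces the product of the distances to `u` and
    -- `w`, which the squared height dominates.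
    have h6 : 1 - |stripSigma u w p q z.re| ≤
        (1 - stripSigma u w p q z.re) * (1 + stripSigma u w p q z.re) := by
      have h7 := abs_nonneg (stripSigma u w p q z.re)
      have h8 := mul_nonneg h7 (sub_nonneg.2 hσ)
      have h9 := sq_abs (stripSigma u w p q z.re)
      linarith
    refine h6.trans ?_
    rw [h2, h3, div_mul_div_comm, mul_div_assoc', div_le_div_iff₀ (mul_pos hD hD) (by positivity)]
    have h8 : δ * a ≤ (z.re - u) * q + (w - z.re) * p :=
      (mul_le_mul_of_nonneg_right hδw ha.le).trans hDa
    have h9 := mul_self_le_mul_self (by positivity) h8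
    have h10 : p * q ≤ b * b := mul_le_mul hp.2 hq.2 hq0.le hb.le
    have h11 : (z.re - u) * (w - z.re) * (p * q) ≤ z.im ^ 2 * (b * b) :=
      mul_le_mul hz.2 h10 (mul_pos hp0 hq0).le (by positivity)
    have h12 := mul_le_mul h11 h9 (by positivity) (by positivity)
    linarith
  rw [stripR]
  linarith

end

theorem rho_smul_of_re {x c : ℝ} (hc : 0 < c) {z : ℍ} (hz : z.re = x) :
    (rho (ptOfSq x c) • z).re = x ∧ (rho (ptOfSq x c) • z).im = c / z.im := by
  have := z.im_ne_zero
  rw [rho_smul_re, rho_smul_im, ptOfSq_re hc, ptOfSq_im_sq hc, hz]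
  refine ⟨by simp, ?_⟩
  field_simp
  simp

theorem eq_rho_smul_of_re {x c : ℝ} (hc : 0 < c) {z z' : ℍ} (hz : z.re = x) (hz' : z'.re = x)
    (hR : Real.log (z'.im ^ 2 / c) = -Real.log (z.im ^ 2 / c)) : z' = rho (ptOfSq x c) • z := by
  have h1 := rho_smul_of_re hc hz
  have h2 := z.im_pos
  have h3 := z'.im_pos
  refine ext_re_im (hz'.trans h1.1.symm) ?_
  rw [h1.2]
  rw [← Real.log_inv] at hR
  have h4 := Real.log_injOn_pos (show 0 < z'.im ^ 2 / c by positivity)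
    (show 0 < (z.im ^ 2 / c)⁻¹ by positivity) hR
  rw [inv_div, div_eq_div_iff hc.ne' (by positivity), ← mul_pow, ← sq] at h4
  rw [eq_div_iff h2.ne']
  exact (sq_eq_sq₀ (by positivity) hc.le).1 h4

section

variable {N : ℕ} {v h : ℕ → ℝ}

theorem stripEta_eq_zero_iff (hv : StrictMono v) {k : ℕ} (hk : k < N) {p q : ℝ} (hp : 0 < p) (hq : 0 < q)
    {z : ℍ} (hz : z ∈ strip (v k) (v (k + 1))) :
    stripEta (v k) (v (k + 1)) p q z = 0 ↔ side N v (k + 1) z = 0 := by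
  have huw := hv k.lt_succ_self
  have h1 := strip_denom_pos huw hp hq hz.1.1 hz.1.2
  have h2 := sub_pos.2 huw
  rw [stripEta, side_succ hk, div_eq_zero_iff, mul_eq_zero]
  simp only [Nat.succ_eq_add_one] at h1 h2
  simp [h1.ne', h2.ne']

theorem mem_strip_of_side_eq_zero (hv : StrictMono v) {k : ℕ} (hk : k < N) {z : ℍ}
    (hz : side N v (k + 1) z = 0) : z ∈ strip (v k) (v (k + 1)) := by
  have h1 := re_lt_of_side_nonpos hv hk hz.le
  rw [side_succ hk] at hz
  exact ⟨⟨h1.1.le, h1.2.le⟩, by linarith⟩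

variable (hv : StrictMono v) (hh : ∀ k, 0 < h k)
include hv hh

theorem side_rho_eq_zero (hN : 1 ≤ N) {k : ℕ} (hk : k < N) {z : ℍ}
    (hz : side N v (k + 1) z = 0) : side N v (k + 1) (rho (center N v h (k + 1)) • z) = 0 :=
  (sidePairing hv hh hN).flip_zero (i := ⟨k + 1, by omega⟩) hz

theorem stripSigma_rho (hN : 1 ≤ N) {k : ℕ} (hk : k < N) {z : ℍ} (hz : side N v (k + 1) z = 0) :
    stripSigma (v k) (v (k + 1)) (h k) (h (k + 1)) (rho (center N v h (k + 1)) • z).re =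
      -stripSigma (v k) (v (k + 1)) (h k) (h (k + 1)) z.re := by
  have h1 := mem_strip_of_side_eq_zero hv hk hz
  have h2 := mem_strip_of_side_eq_zero hv hk (side_rho_eq_zero hv hh hN hk hz)
  have h3 : z.im ^ 2 = (z.re - v k) * (v (k + 1) - z.re) := by
    rw [side_succ hk] at hz
    linarith
  have h4 := h2.1
  rw [rho_smul_re] at h4 ⊢
  exact stripSigma_flip (hv k.lt_succ_self) (hh k) (hh (k + 1)) h1.1.1 h1.1.2
    (center_succ_re hv hh hk) (center_succ_im_sq hv hh hk) rfl (sq_add_sq_im_pos z _) h3 h4.1 h4.2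

/-- On the bottom side `η = 0` and the half-turn negates `σ`; there `X` vanishes and `R = 1 - |σ|`
is even. -/
theorem foldMap_rho_succ (hN : 1 ≤ N) {k : ℕ} (hk : k < N) {z : ℍ} (hz : side N v (k + 1) z = 0) :
    foldMap N v h (rho (center N v h (k + 1)) • z) = foldMap N v h z := by
  have h0 := side_rho_eq_zero hv hh hN hk hz
  have h1 := mem_strip_of_side_eq_zero hv hk hz
  have h2 := mem_strip_of_side_eq_zero hv hk h0
  have h3 := (stripEta_eq_zero_iff hv hk (hh k) (hh (k + 1)) h1).2 hz
  have h4 := (stripEta_eq_zero_iff hv hk (hh k) (hh (k + 1)) h2).2 h0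
  have h5 := stripSigma_rho hv hh hN hk hz
  rw [foldMap_eq hv hh hk h1, foldMap_eq hv hh hk h2, foldPiece, foldPiece, foldAngle, foldAngle,
    foldRadius, foldRadius, stripX, stripX, stripR, stripR, h3, h4, h5]
  simp

/-- The half-turn inverts the radius, so it negates the logarithm, and at angle zero the cosine does
not see the sign. The last side is the same at angle `π`. -/
theorem foldMap_rho_zero (hN : 1 ≤ N) {z : ℍ} (hz : side N v 0 z = 0) :
    foldMap N v h (rho (center N v h 0) • z) = foldMap N v h z := by
  have h1 : z.re = v 0 := by rw [side_zero] at hz; linarith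
  have h2 := rho_smul_of_re (hh 0) h1
  have h3 := hh 0
  have h4 := z.im_pos
  rw [← center_zero_def (N := N) (v := v)] at h2
  rw [foldMap_eq hv hh hN (mem_strip_left (hv (Nat.lt_succ_self 0)).le h1),
    foldMap_eq hv hh hN (mem_strip_left (hv (Nat.lt_succ_self 0)).le h2.1), foldPiece, foldPiece,
    (fold_left hv hh h1).1, (fold_left hv hh h1).2, (fold_left hv hh h2.1).1, (fold_left hv hh h2.1).2, h2.2]
  have h5 : Real.log ((h 0 / z.im) ^ 2 / h 0) = -Real.log (z.im ^ 2 / h 0) := by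
    rw [← Real.log_inv]
    congr 1
    field_simp
  rw [h5, ← Complex.cos_neg]
  simp

theorem foldMap_rho_last (hN : 1 ≤ N) {z : ℍ} (hz : side N v (N + 1) z = 0) :
    foldMap N v h (rho (center N v h (N + 1)) • z) = foldMap N v h z := by
  obtain ⟨M, rfl⟩ : ∃ M, N = M + 1 := ⟨N - 1, by omega⟩
  have h1 : z.re = v (M + 1) := by rw [side_last] at hz; linarith
  have h2 := rho_smul_of_re (hh (M + 1)) h1
  have h3 := hh (M + 1)
  have h4 := z.im_pos
  rw [← center_last (v := v)] at h2
  rw [foldMap_eq hv hh M.lt_succ_self (mem_strip_right (hv M.lt_succ_self).le h1),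
    foldMap_eq hv hh M.lt_succ_self (mem_strip_right (hv M.lt_succ_self).le h2.1), foldPiece, foldPiece,
    (fold_right hv hh h1).1, (fold_right hv hh h1).2, (fold_right hv hh h2.1).1,
    (fold_right hv hh h2.1).2, h2.2]
  have h5 : Real.log ((h (M + 1) / z.im) ^ 2 / h (M + 1)) = -Real.log (z.im ^ 2 / h (M + 1)) := by
    rw [← Real.log_inv]
    congr 1
    field_simp
  have h6 : ((M + 1 : ℕ) : ℝ) * Real.pi / (M + 1 : ℕ) = Real.pi := by
    field_simp
  rw [h5, h6, add_comm, Complex.cos_add_pi, add_comm (Real.pi : ℂ), Complex.cos_add_pi,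
    ← Complex.cos_neg]
  simp

theorem foldMap_rho (hN : 1 ≤ N) (i : Fin (N + 2)) {z : ℍ} (hz : side N v i z = 0) :
    foldMap N v h (rho (center N v h i) • z) = foldMap N v h z := by
  revert hz
  exact forall_fin_add_two (p := fun i => side N v i z = 0 →
    foldMap N v h (rho (center N v h i) • z) = foldMap N v h z) (foldMap_rho_zero hv hh hN)
    (fun k hk => foldMap_rho_succ hv hh hN hk) (foldMap_rho_last hv hh hN) i

theorem eq_or_eq_rho_of_foldMap_eq (hN : 1 ≤ N) {z z' : ℍ} (hz : z ∈ cuspPoly N v)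
    (hz' : z' ∈ cuspPoly N v) (hF : foldMap N v h z = foldMap N v h z') :
    z = z' ∨ ∃ i : Fin (N + 2), z' = rho (center N v h i) • z := by
  obtain ⟨k, hk, hzk⟩ := exists_mem_strip hN hz
  obtain ⟨l, hl, hzl⟩ := exists_mem_strip hN hz'
  rw [foldMap_eq hv hh hk hzk, foldMap_eq hv hh hl hzl] at hF
  have hpi := Real.pi_pos
  have hN0 : (0 : ℝ) < N := by exact_mod_cast hN
  have bound : ∀ {k : ℕ} {z : ℍ}, k < N → z ∈ strip (v k) (v (k + 1)) →
      0 ≤ foldAngle v h k z * Real.pi / N ∧ foldAngle v h k z * Real.pi / N ≤ Real.pi := by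
    intro k z hk hz
    have h1 := foldAngle_mem hv hh hz
    have h2 : (0 : ℝ) ≤ k := k.cast_nonneg
    have h3 : (k : ℝ) + 1 ≤ N := by exact_mod_cast hk
    have h4 : 0 ≤ foldAngle v h k z := h2.trans h1.1
    refine ⟨by positivity, ?_⟩
    rw [div_le_iff₀ hN0, mul_comm Real.pi]
    exact mul_le_mul_of_nonneg_right (h1.2.trans h3) hpi.le
  obtain ⟨hA, hB⟩ := cos_strip_inj (bound hk hzk).1 (bound hk hzk).2 (bound hl hzl).1 (bound hl hzl).2 hF
  have hA' : foldAngle v h k z = foldAngle v h l z' := by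
    rw [div_left_inj' hN0.ne', mul_left_inj' hpi.ne'] at hA
    exact hA.symm
  obtain ⟨m, hm, h1, h2⟩ := exists_common_strip hv hh hk hl hzk hzl hA'
  have e1 := fold_eq_of_mem hv hh hzk h1
  have e2 := fold_eq_of_mem hv hh hzl h2
  rw [e1.1, e1.2, e2.2] at hB
  rw [e1.1, e2.1] at hA'
  clear hF hA hzk hzl e1 e2 hk hl k l
  have p1 := foldRadius_pos hv hh h1
  have p2 := foldRadius_pos hv hh h2
  -- Either the radii agree and only the bottom side can be folded, or the logarithms are opposite,
  -- which happens only on the two outer vertical sides.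
  rcases hB with hB | ⟨hB, hR⟩
  · have hR := Real.log_injOn_pos p2 p1 hB
    have hX : stripX (v m) (v (m + 1)) (h m) (h (m + 1)) z =
        stripX (v m) (v (m + 1)) (h m) (h (m + 1)) z' := by
      rw [foldAngle, foldAngle] at hA'
      linarith
    rcases strip_coords_inj (hv m.lt_succ_self) (hh m) (hh (m + 1)) h1 h2 hX hR.symm with h3 | ⟨h3, h4, h5⟩
    · exact Or.inl h3
    · right
      have h6 := (stripEta_eq_zero_iff hv hm (hh m) (hh (m + 1)) h1).1 h3
      have h7 := side_rho_eq_zero hv hh hN hm h6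
      have h8 := mem_strip_of_side_eq_zero hv hm h7
      refine ⟨⟨m + 1, by omega⟩, ?_⟩
      refine eq_of_stripSigma_of_stripEta (hv m.lt_succ_self) (hh m) (hh (m + 1)) h2 h8 ?_ ?_
      · exact h5.trans (stripSigma_rho hv hh hN hm h6).symm
      · exact h4.trans ((stripEta_eq_zero_iff hv hm (hh m) (hh (m + 1)) h8).2 h7).symm
  · right
    have b1 := foldAngle_mem hv hh h1
    rcases hB with hB | hB
    · have h3 : foldAngle v h m z = 0 := by
        rcases div_eq_zero_iff.1 hB with h | h
        · exact (mul_eq_zero.1 h).resolve_right hpi.ne'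
        · exact absurd h hN0.ne'
      have h4 : (m : ℝ) ≤ 0 := h3 ▸ b1.1
      obtain rfl : m = 0 := by exact_mod_cast (Nat.cast_nonpos.1 h4)
      have r1 := re_eq_left_of_foldAngle hv hh h1 (by rw [h3]; simp)
      have r2 := re_eq_left_of_foldAngle hv hh h2 (by rw [← hA', h3]; simp)
      rw [(fold_left hv hh r1).2, (fold_left hv hh r2).2] at hR
      refine ⟨0, ?_⟩
      exact eq_rho_smul_of_re (hh 0) r1 r2 hR
    · have h3 : foldAngle v h m z = N := by
        rw [div_eq_iff hN0.ne', mul_comm Real.pi] at hB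
        exact mul_right_cancel₀ hpi.ne' hB
      have h4 : (N : ℝ) ≤ m + 1 := h3 ▸ b1.2
      have h5 : N ≤ m + 1 := by exact_mod_cast h4
      obtain rfl : N = m + 1 := by omega
      have r1 := re_eq_right_of_foldAngle hv hh h1 (by rw [h3]; simp)
      have r2 := re_eq_right_of_foldAngle hv hh h2 (by rw [← hA', h3]; simp)
      rw [(fold_right hv hh r1).2, (fold_right hv hh r2).2] at hR
      refine ⟨Fin.last _, ?_⟩
      have := eq_rho_smul_of_re (hh (m + 1)) r1 r2 hR
      rwa [← center_last (v := v)] at this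

/-- The folding map is proper. -/
theorem exists_isCompact_of_foldMap_le (hN : 1 ≤ N) (C : ℝ) : ∃ K : Set ℍ, IsCompact K ∧
    ∀ z ∈ cuspPoly N v, ‖foldMap N v h z‖ ≤ C → z ∈ K := by
  obtain ⟨δ, hδ, hδv⟩ := exists_gap hv N
  obtain ⟨a, ha, b, hab⟩ := exists_bounds hh N
  have hb : 0 < b := (hh 0).trans_le (hab 0 (Nat.zero_le N)).2
  set c := Real.exp (-C) / (1 / a + 4 * b ^ 2 / (δ ^ 2 * a ^ 2)) with hc
  set d := Real.exp C * b + (v N - v 0) ^ 2 with hd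
  have hc0 : 0 < c := by positivity
  have hd0 : 0 < d := by positivity
  refine ⟨_, isCompact_box (v 0) (v N) (√c) (√d) (Real.sqrt_pos.2 hc0), ?_⟩
  intro z hz hF
  obtain ⟨k, hk, hzk⟩ := exists_mem_strip hN hz
  rw [foldMap_eq hv hh hk hzk, foldPiece] at hF
  -- The radius lies between `exp (-C)` and `exp C`.
  have h1 := abs_le.1 ((abs_le_norm_cos _ _).trans hF)
  have hR0 := foldRadius_pos hv hh hzk
  have hR1 : foldRadius v h k z ≤ Real.exp C := (Real.log_le_iff_le_exp hR0).1 h1.2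
  have hR2 : Real.exp (-C) ≤ foldRadius v h k z := (Real.le_log_iff_exp_le hR0).1 h1.1
  have hlo : v 0 ≤ v k := hv.monotone (Nat.zero_le k)
  have hhi : v (k + 1) ≤ v N := hv.monotone hk
  have hL := sub_pos.2 (hv k.lt_succ_self)
  have h2 := im_sq_le_stripR (hv k.lt_succ_self) ha (hab k hk.le) (hab (k + 1) hk) hzk
  have h3 := stripR_le_im_sq (hv k.lt_succ_self) ha (hab k hk.le) (hab (k + 1) hk) hδ (hδv k hk) hzk
  have h4 : z.im ^ 2 ≤ d := by
    have h5 := mul_le_mul_of_nonneg_right hR1 hb.le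
    have h6 : (v (k + 1) - v k) ^ 2 ≤ (v N - v 0) ^ 2 := pow_le_pow_left₀ hL.le (by linarith) 2
    rw [hd]
    exact h2.trans (add_le_add h5 h6)
  have h5 : c ≤ z.im ^ 2 := by
    rw [hc, div_le_iff₀ (by positivity)]
    exact hR2.trans h3
  obtain ⟨⟨hx1, hx2⟩, -⟩ := hzk
  exact ⟨⟨by linarith, by linarith⟩, (Real.sqrt_le_left z.im_pos.le).2 h5,
    (Real.le_sqrt' z.im_pos).2 h4⟩

theorem isClosed_image_foldMap (hN : 1 ≤ N) {A : Set ℍ} (hA : A ⊆ cuspPoly N v) (hcl : IsClosed A) :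
    IsClosed (foldMap N v h '' A) := by
  refine isClosed_of_closure_subset fun w hw => ?_
  obtain ⟨K, hK, hKz⟩ := exists_isCompact_of_foldMap_le hv hh hN (‖w‖ + 1)
  have h1 : IsCompact (foldMap N v h '' (K ∩ A)) :=
    (hK.inter_right hcl).image_of_continuousOn
      ((continuousOn_foldMap hv hh hN).mono (Set.inter_subset_right.trans hA))
  have h2 : w ∈ closure (Metric.ball w 1 ∩ foldMap N v h '' A) :=
    Metric.isOpen_ball.inter_closure ⟨Metric.mem_ball_self one_pos, hw⟩
  have h3 : Metric.ball w 1 ∩ foldMap N v h '' A ⊆ foldMap N v h '' (K ∩ A) := by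
    rintro _ ⟨hb, z, hz, rfl⟩
    refine ⟨z, ⟨hKz z (hA hz) ?_, hz⟩, rfl⟩
    rw [Metric.mem_ball, dist_eq_norm] at hb
    linarith [norm_le_norm_add_norm_sub' (foldMap N v h z) w]
  exact Set.image_mono Set.inter_subset_right (closure_minimal h3 h1.isClosed h2)

/-- The quotient of the plane by the group of the decorated polygon is a plane. -/
theorem nonempty_quotient_cuspGroup_homeomorph (hN : 1 ≤ N) :
    Nonempty (Quotient (MulAction.orbitRel (cuspGroup N v h) ℍ) ≃ₜ ℂ) :=
  (sidePairing hv hh hN).nonempty_quotient_homeomorph (exists_smul_mem_cuspPoly hv hh hN)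
    (foldMap N v h) (continuousOn_foldMap hv hh hN)
    (fun _ hA hcl => isClosed_image_foldMap hv hh hN hA hcl) (exists_foldMap_eq hv hh hN)
    (fun i _ hz => foldMap_rho hv hh hN i hz)
    fun _ hz _ hz' hF => eq_or_eq_rho_of_foldMap_eq hv hh hN hz hz' hF

end

end HypPlane

/-! ### Consequences of a fundamental domain, and transport by conjugation. -/

namespace HypPlane

open UpperHalfPlane Topology Filter

/-- For `p` in `D`, only `δ` itself takes `p` into the open set `δ • D`, and the orbit map is
continuous. -/
theorem IsFundamentalDomain.isFuchsian {Γ : Subgroup PSL(2, ℝ)} {D : Set ℍ} (hD : IsFundamentalDomain Γ D) :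
    IsFuchsian Γ := by
  obtain ⟨p, hp⟩ := hD.isConnected.nonempty
  refine discreteTopology_iff_isOpen_singleton.2 fun δ => ?_
  have h1 : ({δ} : Set Γ) = {γ : Γ | (δ : PSL(2, ℝ))⁻¹ • (γ : PSL(2, ℝ)) • p ∈ D} := by
    ext γ
    rw [Set.mem_singleton_iff, Set.mem_ofPred_eq]
    constructor
    · rintro rfl
      rwa [inv_smul_smul]
    · intro h
      by_contra hne
      refine Set.disjoint_left.1 (hD.disjoint _ (mul_mem (inv_mem δ.2) γ.2) fun h' => hne ?_)
        (Set.smul_mem_smul_set hp) (by rwa [mul_smul])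
      exact Subtype.ext (inv_mul_eq_one.1 h').symm
  rw [h1]
  refine hD.isOpen.preimage ?_
  exact (continuous_const_smul (δ : PSL(2, ℝ))⁻¹).comp
    ((continuous_smul_const p).comp continuous_subtype_val)

/-- The images of `D` miss only images of its null frontier, and countability keeps their union
null. -/
theorem IsFundamentalDomain.hasFiniteCovolume {Γ : Subgroup PSL(2, ℝ)} {D : Set ℍ}
    (hD : IsFundamentalDomain Γ D) (hΓ : (Γ : Set PSL(2, ℝ)).Countable)
    (hvol : MeasureTheory.volume D < ⊤) : HasFiniteCovolume Γ := by
  have : Countable Γ := hΓ.to_subtype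
  refine ⟨D, ⟨hD.isOpen.measurableSet.nullMeasurableSet, ?_, ?_⟩, hvol⟩
  · have h1 : MeasureTheory.volume (⋃ γ : Γ, γ • frontier D) = 0 := by
      refine MeasureTheory.measure_iUnion_null fun γ => ?_
      rw [Subgroup.smul_def, MeasureTheory.measure_smul, hD.null_frontier]
    rw [MeasureTheory.ae_iff]
    refine MeasureTheory.measure_mono_null (fun z hz => ?_) h1
    obtain ⟨γ, hγ, h2⟩ := hD.covers z
    refine Set.mem_iUnion.2 ⟨⟨γ, hγ⟩, ?_⟩
    rw [Set.mem_smul_set_iff_inv_smul_mem] at h2 ⊢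
    rw [hD.isOpen.frontier_eq]
    exact ⟨h2, fun h3 => hz ⟨⟨γ, hγ⟩⁻¹, h3⟩⟩
  · intro a b hab
    refine Disjoint.aedisjoint (Set.disjoint_left.2 fun z ha hb => ?_)
    rw [Set.mem_smul_set_iff_inv_smul_mem] at ha hb
    refine Set.disjoint_left.1 (hD.disjoint ((b⁻¹ * a : Γ) : PSL(2, ℝ)) (b⁻¹ * a).2 fun h => hab ?_)
      (Set.smul_mem_smul_set ha) ?_
    · exact (inv_mul_eq_one.1 (Subtype.ext h)).symm
    · change (b⁻¹ * a) • a⁻¹ • z ∈ D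
      rwa [mul_smul, smul_inv_smul]

/-- The group `γ Γ γ⁻¹`. -/
def conjGroup (γ : PSL(2, ℝ)) (Γ : Subgroup PSL(2, ℝ)) : Subgroup PSL(2, ℝ) :=
  Γ.map (MulAut.conj γ).toMonoidHom

section

variable {γ : PSL(2, ℝ)} {Γ : Subgroup PSL(2, ℝ)}

theorem mem_conjGroup {δ : PSL(2, ℝ)} : δ ∈ conjGroup γ Γ ↔ γ⁻¹ * δ * γ ∈ Γ := by
  constructor
  · rintro ⟨ε, hε, rfl⟩
    simpa [mul_assoc] using hε
  · intro h
    exact ⟨_, h, by simp [mul_assoc]⟩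

theorem conj_mem_conjGroup {δ : PSL(2, ℝ)} (hδ : δ ∈ Γ) : γ * δ * γ⁻¹ ∈ conjGroup γ Γ :=
  ⟨δ, hδ, rfl⟩

theorem conjGroup_closure_rho {ι : Type*} (f : ι → ℍ) :
    conjGroup γ (Subgroup.closure (Set.range fun i => rho (f i))) =
      Subgroup.closure (Set.range fun i => rho (γ • f i)) := by
  rw [conjGroup, MonoidHom.map_closure, ← Set.range_comp]
  congr 2
  funext i
  exact rho_conj γ (f i)

theorem IsFundamentalDomain.conj {D : Set ℍ} (hD : IsFundamentalDomain Γ D) (γ : PSL(2, ℝ)) :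
    IsFundamentalDomain (conjGroup γ Γ) (γ • D) where
  isOpen := hD.isOpen.smul γ
  isConnected := hD.isConnected.image _ (continuous_const_smul γ).continuousOn
  null_frontier := by
    have : frontier (γ • D) = γ • frontier D := ((Homeomorph.smul γ).image_frontier D).symm
    rw [this, MeasureTheory.measure_smul, hD.null_frontier]
  disjoint δ hδ h1 := by
    have h2 := hD.disjoint _ (mem_conjGroup.1 hδ) fun h => h1 (by
      rw [mul_assoc, inv_mul_eq_one] at h
      exact mul_eq_right.1 h.symm)
    have h3 : δ • γ • D = γ • (γ⁻¹ * δ * γ) • D := by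
      rw [smul_smul, smul_smul, mul_assoc, mul_inv_cancel_left]
    rw [h3, Set.disjoint_smul_set]
    exact h2
  covers z := by
    obtain ⟨δ, hδ, h⟩ := hD.covers (γ⁻¹ • z)
    refine ⟨_, conj_mem_conjGroup hδ, ?_⟩
    have : closure (γ • D) = γ • closure D := ((Homeomorph.smul γ).image_closure D).symm
    rw [this, smul_smul, inv_mul_cancel_right, mul_smul, Set.mem_smul_set_iff_inv_smul_mem]
    exact h
  locally_finite K hK := by
    have h1 := hD.locally_finite (γ⁻¹ • K) (hK.image (continuous_const_smul γ⁻¹))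
    let φ : conjGroup γ Γ → Γ := fun δ => ⟨γ⁻¹ * δ * γ, mem_conjGroup.1 δ.2⟩
    have hφ : Function.Injective φ := fun a b hab => by
      have := congrArg Subtype.val hab
      exact Subtype.ext (mul_left_cancel (mul_right_cancel this))
    refine (h1.preimage hφ.injOn).subset ?_
    rintro δ ⟨z, hz, hzK⟩
    refine ⟨γ⁻¹ • z, ?_, Set.smul_mem_smul_set hzK⟩
    have : closure (γ • D) = γ • closure D := ((Homeomorph.smul γ).image_closure D).symm
    rw [this] at hz
    rw [Subgroup.smul_def, Set.mem_smul_set_iff_inv_smul_mem, Set.mem_smul_set_iff_inv_smul_mem] at hz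
    rw [Subgroup.smul_def, Set.mem_smul_set_iff_inv_smul_mem]
    change (γ⁻¹ * δ * γ)⁻¹ • γ⁻¹ • z ∈ _
    simpa [mul_smul] using hz

theorem HasFiniteCovolume.conj (h : HasFiniteCovolume Γ) (γ : PSL(2, ℝ)) :
    HasFiniteCovolume (conjGroup γ Γ) := by
  obtain ⟨D, hD, hvol⟩ := h
  refine ⟨(MulAction.toPerm γ : Equiv.Perm ℍ) '' D, ?_, ?_⟩
  · let e : conjGroup γ Γ ≃ Γ :=
      { toFun := fun δ => ⟨γ⁻¹ * δ * γ, mem_conjGroup.1 δ.2⟩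
        invFun := fun δ => ⟨γ * δ * γ⁻¹, conj_mem_conjGroup δ.2⟩
        left_inv := fun δ => Subtype.ext (by simp [mul_assoc])
        right_inv := fun δ => Subtype.ext (by simp [mul_assoc]) }
    refine hD.image_of_equiv (MulAction.toPerm γ)
      (MeasureTheory.measurePreserving_smul γ⁻¹ MeasureTheory.volume).quasiMeasurePreserving e fun δ z => ?_
    change γ • (γ⁻¹ * δ * γ) • z = (δ : PSL(2, ℝ)) • γ • z
    rw [mul_smul, mul_smul, smul_inv_smul]
  · change MeasureTheory.volume (γ • D) < ⊤
    rwa [MeasureTheory.measure_smul]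

theorem nonempty_quotient_conjGroup_homeomorph (γ : PSL(2, ℝ)) (Γ : Subgroup PSL(2, ℝ)) :
    Nonempty (Quotient (MulAction.orbitRel (conjGroup γ Γ) ℍ) ≃ₜ
      Quotient (MulAction.orbitRel Γ ℍ)) := by
  have hrel : ∀ a b : ℍ, MulAction.orbitRel (conjGroup γ Γ) ℍ a b ↔
      MulAction.orbitRel Γ ℍ ((MulAction.toPerm γ⁻¹ : Equiv.Perm ℍ) a)
        ((MulAction.toPerm γ⁻¹ : Equiv.Perm ℍ) b) := by
    intro a b
    constructor
    · rintro ⟨δ, rfl⟩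
      refine ⟨⟨_, mem_conjGroup.1 δ.2⟩, ?_⟩
      change (γ⁻¹ * δ * γ) • γ⁻¹ • b = γ⁻¹ • (δ : PSL(2, ℝ)) • b
      rw [mul_smul, mul_smul, smul_inv_smul]
    · rintro ⟨δ, hδ⟩
      refine ⟨⟨_, conj_mem_conjGroup (γ := γ) δ.2⟩, ?_⟩
      have h1 : (δ : PSL(2, ℝ)) • γ⁻¹ • b = γ⁻¹ • a := hδ
      change (γ * δ * γ⁻¹) • b = a
      rw [mul_smul, mul_smul, h1, smul_inv_smul]
  refine ⟨⟨Quotient.congr (MulAction.toPerm γ⁻¹) hrel, ?_, ?_⟩⟩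
  · refine isQuotientMap_quotient_mk'.continuous_iff.2 ?_
    exact continuous_quotient_mk'.comp (continuous_const_smul γ⁻¹)
  · refine isQuotientMap_quotient_mk'.continuous_iff.2 ?_
    refine continuous_quotient_mk'.comp (f := fun z => (γ⁻¹)⁻¹ • z) ?_
    exact continuous_const_smul _

theorem ListsOrbits.conj {X : Type*} [MulAction PSL(2, ℝ) X] {S T : Set X} {r : ℕ} {c : Fin r → X}
    (h : ListsOrbits Γ S c) (hT : ∀ x, x ∈ T ↔ γ⁻¹ • x ∈ S) :
    ListsOrbits (conjGroup γ Γ) T fun i => γ • c i := by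
  refine ⟨fun i => (hT _).2 (by rw [inv_smul_smul]; exact h.1 i), fun x hx => ?_⟩
  obtain ⟨i, ⟨δ, hδ, hi⟩, huniq⟩ := h.2 _ ((hT x).1 hx)
  refine ⟨i, ⟨_, conj_mem_conjGroup hδ, ?_⟩, ?_⟩
  · rw [mul_smul, mul_smul, inv_smul_smul, hi, smul_inv_smul]
  · rintro j ⟨ε, hε, hj⟩
    refine huniq j ⟨_, mem_conjGroup.1 hε, ?_⟩
    rw [mul_smul, mul_smul, hj]

theorem conj_smul_eq_iff {X : Type*} [MulAction PSL(2, ℝ) X] {δ : PSL(2, ℝ)} {x : X} :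
    (γ⁻¹ * δ * γ) • γ⁻¹ • x = γ⁻¹ • x ↔ δ • x = x := by
  rw [mul_smul, mul_smul, smul_inv_smul]
  exact (MulAction.injective γ⁻¹).eq_iff

theorem mem_ellipticPoints_conjGroup {z : ℍ} :
    z ∈ ellipticPoints (conjGroup γ Γ) ↔ γ⁻¹ • z ∈ ellipticPoints Γ := by
  constructor
  · rintro ⟨δ, hδ, h1, h2⟩
    refine ⟨_, mem_conjGroup.1 hδ, fun h => h1 ?_, conj_smul_eq_iff.2 h2⟩
    rw [mul_assoc, inv_mul_eq_one] at h
    exact mul_eq_right.1 h.symm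
  · rintro ⟨δ, hδ, h1, h2⟩
    refine ⟨_, conj_mem_conjGroup hδ, fun h => h1 ?_, ?_⟩
    · rw [mul_inv_eq_one] at h
      exact mul_eq_left.1 h
    · rw [mul_smul, mul_smul, h2, smul_inv_smul]

theorem mem_cusps_conjGroup {x : OnePoint ℝ} : x ∈ cusps (conjGroup γ Γ) ↔ γ⁻¹ • x ∈ cusps Γ := by
  constructor
  · rintro ⟨δ, hδ, h1, h2⟩
    have := h1.conj γ⁻¹
    rw [inv_inv] at this
    exact ⟨_, mem_conjGroup.1 hδ, this, conj_smul_eq_iff.2 h2⟩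
  · rintro ⟨δ, hδ, h1, h2⟩
    refine ⟨_, conj_mem_conjGroup hδ, h1.conj γ, ?_⟩
    rw [mul_smul, mul_smul, h2, smul_inv_smul]

theorem mem_HFix_conjGroup {x : OnePoint ℝ} (hx : γ⁻¹ • x ∈ HFix Γ) : x ∈ HFix (conjGroup γ Γ) := by
  obtain ⟨δ, hδ, h1, h2⟩ := hx
  refine ⟨_, conj_mem_conjGroup hδ, h1.conj γ, ?_⟩
  rw [mul_smul, mul_smul, h2, smul_inv_smul]

theorem card_stabilizer_conjGroup (z : ℍ) :
    Nat.card (MulAction.stabilizer (conjGroup γ Γ) (γ • z)) = Nat.card (MulAction.stabilizer Γ z) := by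
  refine Nat.card_congr
    { toFun := fun δ => ⟨⟨γ⁻¹ * δ.1 * γ, mem_conjGroup.1 δ.1.2⟩, ?_⟩
      invFun := fun δ => ⟨⟨γ * δ.1 * γ⁻¹, conj_mem_conjGroup δ.1.2⟩, ?_⟩
      left_inv := fun δ => Subtype.ext (Subtype.ext (by simp [mul_assoc]))
      right_inv := fun δ => Subtype.ext (Subtype.ext (by simp [mul_assoc])) }
  · have h : (δ.1 : PSL(2, ℝ)) • γ • z = γ • z := δ.2
    change (γ⁻¹ * δ.1 * γ) • z = z
    rw [mul_smul, mul_smul, h, inv_smul_smul]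
  · have h : (δ.1 : PSL(2, ℝ)) • z = z := δ.2
    change (γ * δ.1 * γ⁻¹) • γ • z = γ • z
    rw [mul_smul, mul_smul, inv_smul_smul, h]

theorem smul_mem_nhds_coe {γ : PSL(2, ℝ)} {y y' : ℝ} (hy : γ • (y : OnePoint ℝ) = y') {U : Set (OnePoint ℝ)}
    (hU : U ∈ 𝓝 (y : OnePoint ℝ)) : γ • U ∈ 𝓝 (y' : OnePoint ℝ) := by
  obtain ⟨A, hA⟩ := isom_surjective γ⁻¹
  have h1 : isom A • (y' : OnePoint ℝ) = y := by rw [hA, ← hy, inv_smul_smul]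
  rw [isom_smul_coe] at h1
  have h2 : A 1 0 * y' + A 1 1 ≠ 0 := fun h => by
    rw [if_pos h] at h1
    exact OnePoint.infty_ne_coe _ h1
  rw [if_neg h2, OnePoint.coe_eq_coe] at h1
  rw [OnePoint.nhds_coe_eq, Filter.mem_map] at hU ⊢
  have h3 : ContinuousAt (fun x : ℝ => A 1 0 * x + A 1 1) y' := by fun_prop
  have h4 : ContinuousAt (fun x : ℝ => (A 0 0 * x + A 0 1) / (A 1 0 * x + A 1 1)) y' :=
    ContinuousAt.div (by fun_prop) h3 h2
  filter_upwards [h4.preimage_mem_nhds (by rwa [h1]), h3.eventually_ne h2] with x hx hx'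
  rw [Set.mem_preimage, Set.mem_smul_set_iff_inv_smul_mem, ← hA, isom_smul_coe, if_neg hx']
  exact hx

theorem ordinarySet_conjGroup (h : ordinarySet Γ = ∅) (γ : PSL(2, ℝ)) :
    ordinarySet (conjGroup γ Γ) = ∅ := by
  rw [Set.eq_empty_iff_forall_notMem] at h ⊢
  rintro x ⟨U, hU, hfin⟩
  -- Neighbourhoods are transported only between real points, so a point of the interior avoiding
  -- `∞` and `γ • ∞` replaces `x`.
  obtain ⟨y, hyU, y', hy'⟩ : ∃ y : ℝ, (y : OnePoint ℝ) ∈ interior U ∧ ∃ y' : ℝ,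
      γ⁻¹ • (y : OnePoint ℝ) = y' := by
    have ho : IsOpen (((↑) : ℝ → OnePoint ℝ) ⁻¹' interior U) :=
      isOpen_interior.preimage OnePoint.continuous_coe
    obtain ⟨y0, hy0⟩ := OnePoint.denseRange_coe.exists_mem_open isOpen_interior
      ⟨x, mem_interior_iff_mem_nhds.2 hU⟩
    have hd : Dense {y : ℝ | γ • (OnePoint.infty : OnePoint ℝ) ≠ (y : OnePoint ℝ)} := by
      by_cases hp : ∃ p : ℝ, γ • (OnePoint.infty : OnePoint ℝ) = (p : OnePoint ℝ)
      · obtain ⟨p, hp⟩ := hp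
        refine (dense_compl_singleton p).mono fun y hy => ?_
        rw [Set.mem_ofPred_eq, hp]
        exact fun h => hy (OnePoint.coe_injective h).symm
      · push Not at hp
        convert dense_univ
        exact Set.eq_univ_of_forall hp
    obtain ⟨y, hy, hyU⟩ := hd.exists_mem_open ho ⟨y0, hy0⟩
    refine ⟨y, hyU, ?_⟩
    have : γ⁻¹ • (y : OnePoint ℝ) ≠ OnePoint.infty := fun h => hy (by rw [← h, smul_inv_smul])
    obtain ⟨y', hy'⟩ := OnePoint.ne_infty_iff_exists.1 this
    exact ⟨y', hy'.symm⟩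
  refine h y' ⟨_, smul_mem_nhds_coe hy' (mem_interior_iff_mem_nhds.1 hyU), ?_⟩
  let φ : Γ → conjGroup γ Γ := fun δ => ⟨γ * δ * γ⁻¹, conj_mem_conjGroup δ.2⟩
  have hφ : Function.Injective φ := fun a b hab => by
    have := congrArg Subtype.val hab
    exact Subtype.ext (mul_left_cancel (mul_right_cancel this))
  refine (hfin.preimage hφ.injOn).subset ?_
  rintro δ ⟨z, hz, hzU⟩
  rw [Subgroup.smul_def, Set.mem_smul_set_iff_inv_smul_mem, Set.mem_smul_set_iff_inv_smul_mem] at hz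
  rw [Set.mem_smul_set_iff_inv_smul_mem] at hzU
  refine ⟨γ • z, ?_, by simpa using hzU⟩
  rw [Subgroup.smul_def, Set.mem_smul_set_iff_inv_smul_mem]
  change (γ * δ * γ⁻¹)⁻¹ • γ • z ∈ U
  simpa [mul_smul] using hz

theorem boundaryIntervals_eq_empty_iff : boundaryIntervals Γ = ∅ ↔ ordinarySet Γ = ∅ := by
  constructor
  · intro h
    rw [Set.eq_empty_iff_forall_notMem] at h ⊢
    exact fun x hx => h _ ⟨x, hx, rfl⟩
  · intro h
    rw [Set.eq_empty_iff_forall_notMem] at h ⊢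
    rintro _ ⟨x, hx, rfl⟩
    exact h x hx

theorem listsOrbits_zero_iff {X : Type*} [MulAction PSL(2, ℝ) X] {S : Set X} :
    (∃ c : Fin 0 → X, ListsOrbits Γ S c) ↔ S = ∅ := by
  constructor
  · rintro ⟨c, -, h⟩
    rw [Set.eq_empty_iff_forall_notMem]
    intro x hx
    obtain ⟨i, -⟩ := h x hx
    exact i.elim0
  · rintro rfl
    exact ⟨Fin.elim0, fun i => i.elim0, fun x hx => hx.elim⟩

theorem HasGenusZeroSignature.conj {r s : ℕ} {m : Fin r → ℕ} (h : HasGenusZeroSignature Γ m s 0)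
    (hF : IsFuchsian (conjGroup γ Γ)) : HasGenusZeroSignature (conjGroup γ Γ) m s 0 where
  fuchsian := hF
  genus_zero := by
    obtain ⟨F, hF, ⟨e⟩⟩ := h.genus_zero
    obtain ⟨e'⟩ := nonempty_quotient_conjGroup_homeomorph γ Γ
    exact ⟨F, hF, ⟨e'.trans e⟩⟩
  cone_points := by
    obtain ⟨c, hc, hm⟩ := h.cone_points
    refine ⟨_, hc.conj (γ := γ) fun _ => mem_ellipticPoints_conjGroup, fun i => ⟨(hm i).1, ?_⟩⟩
    rw [card_stabilizer_conjGroup, (hm i).2]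
  punctures := by
    obtain ⟨c, hc⟩ := h.punctures
    exact ⟨_, hc.conj (γ := γ) fun _ => mem_cusps_conjGroup⟩
  boundary_curves := by
    have := h.boundary_curves
    rw [listsOrbits_zero_iff, boundaryIntervals_eq_empty_iff] at this ⊢
    exact ordinarySet_conjGroup this γ

theorem smul_idealPolygon {n : ℕ} (γ : PSL(2, ℝ)) (v : Fin (n + 1) → OnePoint ℝ) :
    γ • idealPolygon v = idealPolygon fun i => γ • v i := by
  ext z
  rw [Set.mem_smul_set_iff_inv_smul_mem, idealPolygon, idealPolygon, Set.mem_ofPred_eq, Set.mem_ofPred_eq]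
  refine forall_congr' fun i => ?_
  rw [← smul_leftSide, Set.mem_smul_set_iff_inv_smul_mem]

theorem InCyclicOrder.smul {n : ℕ} {v : Fin (n + 1) → OnePoint ℝ} (h : InCyclicOrder v) (γ : PSL(2, ℝ)) :
    InCyclicOrder fun i => γ • v i := by
  obtain ⟨δ, t, ht, h1, h2⟩ := h
  refine ⟨δ * γ⁻¹, t, ht, fun i => ?_, ?_⟩
  · rw [mul_smul, inv_smul_smul, h1]
  · rw [mul_smul, inv_smul_smul, h2]

end

/-- `Γ` is a Fuchsian group of finite covolume and signature `(0 : 2, …, 2 ; 1 ; 0)`, generated by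
half-turns about points on the sides of an ideal polygon that is a fundamental domain, and with the
points of `Y` among its hyperbolic fixed points. -/
def IsIdealHalfTurnGroup (n : ℕ) (Y : Set (OnePoint ℝ)) (Γ : Subgroup PSL(2, ℝ)) : Prop :=
  IsFuchsian Γ ∧ HasFiniteCovolume Γ ∧ HasGenusZeroSignature Γ (fun _ : Fin (n + 1) => 2) 1 0 ∧
    Y ⊆ HFix Γ ∧ ∃ (v : Fin (n + 1) → OnePoint ℝ) (f : Fin (n + 1) → ℍ), InCyclicOrder v ∧
      (∀ i, f i ∈ geodesic (v (i - 1)) (v i)) ∧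
      Γ = Subgroup.closure (Set.range fun i => rho (f i)) ∧ IsFundamentalDomain Γ (idealPolygon v)

theorem IsIdealHalfTurnGroup.conj {n : ℕ} {Y : Set (OnePoint ℝ)} {Γ : Subgroup PSL(2, ℝ)}
    (h : IsIdealHalfTurnGroup n Y Γ) (γ : PSL(2, ℝ)) :
    IsIdealHalfTurnGroup n (γ • Y) (conjGroup γ Γ) := by
  obtain ⟨-, h1, h2, h3, v, f, h4, h5, h6, h7⟩ := h
  have h8 := h7.conj γ
  rw [smul_idealPolygon] at h8
  refine ⟨h8.isFuchsian, h1.conj γ, h2.conj h8.isFuchsian, fun y hy => ?_, _, fun i => γ • f i,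
    h4.smul γ, fun i => ?_, ?_, h8⟩
  · rw [Set.mem_smul_set_iff_inv_smul_mem] at hy
    exact mem_HFix_conjGroup (h3 hy)
  · rw [← smul_geodesic]
    exact Set.smul_mem_smul_set (h5 i)
  · rw [h6, conjGroup_closure_rho]

theorem IsIdealHalfTurnGroup.countable {n : ℕ} {Y : Set (OnePoint ℝ)} {Γ : Subgroup PSL(2, ℝ)}
    (h : IsIdealHalfTurnGroup n Y Γ) : (Γ : Set PSL(2, ℝ)).Countable := by
  obtain ⟨-, -, -, -, v, f, -, -, rfl, -⟩ := h
  exact countable_halfTurnGroup (f := f)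

end HypPlane

/-! ### Prescribing the hyperbolic fixed points, and counting the groups. -/

namespace HypPlane

open UpperHalfPlane Topology Filter

/-- The vertices `v 0 < ⋯ < v N` and `∞` of the ideal polygon. -/
def idealVertex (N : ℕ) (v : ℕ → ℝ) (i : Fin (N + 1 + 1)) : OnePoint ℝ :=
  if (i : ℕ) ≤ N then (v i : OnePoint ℝ) else OnePoint.infty

section

variable {N : ℕ} {v h : ℕ → ℝ}

theorem idealVertex_of_le {i : Fin (N + 1 + 1)} {k : ℕ} (hi : (i : ℕ) = k) (hk : k ≤ N) :
    idealVertex N v i = (v k : OnePoint ℝ) := by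
  rw [idealVertex, if_pos (by omega), hi]

theorem idealVertex_of_eq {i : Fin (N + 1 + 1)} (hi : (i : ℕ) = N + 1) :
    idealVertex N v i = OnePoint.infty := by
  rw [idealVertex, if_neg (by omega)]

theorem inCyclicOrder_idealVertex (hv : StrictMono v) : InCyclicOrder (idealVertex N v) := by
  refine ⟨1, fun i => v i, fun i j hij => hv hij, fun i => ?_, ?_⟩
  · rw [one_smul]
    exact idealVertex_of_le rfl (Nat.lt_succ_iff.1 i.2)
  · rw [one_smul]
    exact idealVertex_of_eq rfl

theorem idealVertex_cases (i : Fin (N + 1 + 1)) :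
    ((i : ℕ) = 0 ∧ idealVertex N v (i - 1) = OnePoint.infty ∧ idealVertex N v i = (v 0 : OnePoint ℝ)) ∨
    (∃ k < N, (i : ℕ) = k + 1 ∧ idealVertex N v (i - 1) = (v k : OnePoint ℝ) ∧
      idealVertex N v i = (v (k + 1) : OnePoint ℝ)) ∨
    ((i : ℕ) = N + 1 ∧ idealVertex N v (i - 1) = (v N : OnePoint ℝ) ∧
      idealVertex N v i = OnePoint.infty) := by
  have h1 := Fin.coe_sub_one i
  by_cases h0 : i = 0
  · rw [if_pos h0] at h1
    have h2 : (i : ℕ) = 0 := by rw [h0]; rfl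
    exact Or.inl ⟨h2, idealVertex_of_eq h1, idealVertex_of_le h2 (Nat.zero_le N)⟩
  · rw [if_neg h0] at h1
    have h2 : (i : ℕ) ≠ 0 := fun h => h0 (Fin.ext h)
    have h3 := i.2
    rcases (show (i : ℕ) - 1 < N ∨ (i : ℕ) = N + 1 by omega) with hk | hk
    · exact Or.inr (Or.inl ⟨i - 1, hk, by omega, idealVertex_of_le h1 hk.le,
        idealVertex_of_le (by omega) hk⟩)
    · exact Or.inr (Or.inr ⟨hk, idealVertex_of_le (by omega) le_rfl, idealVertex_of_eq hk⟩)

theorem leftSide_idealVertex (hv : StrictMono v) (i : Fin (N + 1 + 1)) :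
    leftSide (idealVertex N v (i - 1)) (idealVertex N v i) = {z | 0 < side N v i z} := by
  rcases idealVertex_cases (N := N) (v := v) i with ⟨h0, h1, h2⟩ | ⟨k, hk, h0, h1, h2⟩ | ⟨h0, h1, h2⟩
  · rw [h1, h2, h0, leftSide_infty_coe]
    rfl
  · rw [h1, h2, h0, leftSide_coe_coe (hv k.lt_succ_self)]
    simp only [side_succ hk]
  · rw [h1, h2, h0, leftSide_coe_infty]
    simp only [side_last]

theorem mem_geodesic_idealVertex (hv : StrictMono v) (i : Fin (N + 1 + 1)) {z : ℍ}
    (hz : side N v i z = 0) : z ∈ geodesic (idealVertex N v (i - 1)) (idealVertex N v i) := by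
  rcases idealVertex_cases (N := N) (v := v) i with ⟨h0, h1, h2⟩ | ⟨k, hk, h0, h1, h2⟩ | ⟨h0, h1, h2⟩
  · rw [h0, side_zero] at hz
    rw [h1, h2]
    exact mem_geodesic_infty_coe (by linarith)
  · rw [h0, side_succ hk] at hz
    rw [h1, h2]
    exact mem_geodesic_coe_coe (hv k.lt_succ_self) hz
  · rw [h0, side_last] at hz
    rw [h1, h2]
    exact mem_geodesic_coe_infty (by linarith)

theorem idealPolygon_idealVertex (hv : StrictMono v) :
    idealPolygon (idealVertex N v) = openPoly fun i : Fin (N + 2) => side N v i := by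
  ext z
  refine forall_congr' fun i => ?_
  rw [leftSide_idealVertex hv i]
  rfl

variable (hv : StrictMono v) (hh : ∀ k, 0 < h k)
include hv hh

theorem isFundamentalDomain_idealVertex (hN : 1 ≤ N) :
    IsFundamentalDomain (cuspGroup N v h) (idealPolygon (idealVertex N v)) := by
  rw [idealPolygon_idealVertex hv]
  exact (sidePairing hv hh hN).isFundamentalDomain (exists_smul_mem_cuspPoly hv hh hN)
    (closure_openPoly hv hN) (isConnected_openPoly hv hN) (volume_frontier_openPoly hv hN)

theorem hasGenusZeroSignature_cuspGroup (hN : 1 ≤ N) :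
    HasGenusZeroSignature (cuspGroup N v h) (fun _ : Fin (N + 1 + 1) => 2) 1 0 where
  fuchsian := (isFundamentalDomain_idealVertex hv hh hN).isFuchsian
  genus_zero := by
    obtain ⟨e⟩ := nonempty_quotient_cuspGroup_homeomorph hv hh hN
    obtain ⟨e'⟩ := nonempty_homeomorph_compl_infty
    exact ⟨{OnePoint.infty}, rfl, ⟨e.trans e'⟩⟩
  cone_points := by
    have sp := sidePairing hv hh hN
    have hmem := fun z => sp.mem_ellipticPoints_iff (exists_smul_mem_cuspPoly hv hh hN) (z := z)
    refine ⟨fun i => center N v h i, ⟨fun i => (hmem _).2 ⟨i, 1, one_mem _, one_smul _ _⟩, fun z hz => ?_⟩,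
      fun i => ⟨le_rfl, sp.card_stabilizer i⟩⟩
    obtain ⟨i, hi⟩ := (hmem z).1 hz
    refine ⟨i, hi, ?_⟩
    rintro j ⟨δ, hδ, hj⟩
    obtain ⟨γ, hγ, rfl⟩ := hi
    refine sp.eq_of_smul_center (γ := γ⁻¹ * δ) (mul_mem (inv_mem hγ) hδ) ?_
    rw [mul_smul, hj, inv_smul_smul]
  punctures := by
    have hmem := mem_cusps_iff hv hh hN
    refine ⟨fun _ => OnePoint.infty, fun _ => (hmem _).2 ⟨1, one_mem _, one_smul _ _⟩, fun x hx => ?_⟩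
    exact ⟨0, (hmem x).1 hx, fun j _ => Subsingleton.elim j 0⟩
  boundary_curves :=
    listsOrbits_zero_iff.2 (boundaryIntervals_eq_empty_iff.2 (ordinarySet_eq_empty hv hh hN))

theorem isIdealHalfTurnGroup_cuspGroup (hN : 1 ≤ N) {Y : Set (OnePoint ℝ)}
    (hY : Y ⊆ HFix (cuspGroup N v h)) : IsIdealHalfTurnGroup (N + 1) Y (cuspGroup N v h) := by
  have hD := isFundamentalDomain_idealVertex hv hh hN
  refine ⟨hD.isFuchsian, hD.hasFiniteCovolume countable_halfTurnGroup ?_,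
    hasGenusZeroSignature_cuspGroup hv hh hN, hY, idealVertex N v, fun i => center N v h i,
    inCyclicOrder_idealVertex hv, fun i => mem_geodesic_idealVertex hv i (side_center hv hh), rfl, hD⟩
  rw [idealPolygon_idealVertex hv]
  exact volume_openPoly_lt_top hv hN

omit hv hh in
-- Displays the width as affine in a common factor of the weights, which `exists_weights` uses to
-- prescribe it.
theorem cuspWidth_eq_sum (N : ℕ) (v h : ℕ → ℝ) : cuspWidth N v h =
    v N - v 0 + ∑ j ∈ Finset.range N, (h j + h (j + 1)) / (v (j + 1) - v j) := by
  have : cuspX v h N = v 0 - ∑ j ∈ Finset.range N, (h j + h (j + 1)) / (v (j + 1) - v j) := by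
    induction N with
    | zero => simp [cuspX]
    | succ N ih => rw [cuspX, ih, Finset.sum_range_succ]; ring
  rw [cuspWidth, this]
  ring

omit hv hh in
/-- The half-turn about a point below the line through `u` and `w` moves the point `y` by `C`. -/
theorem half_turn_shift {u w y C r a b2 : ℝ} (hu : u < y) (hw : y < w) (hC : w - u < C)
    (hr : r = (w - y) * (C - (w - y)) / ((y - u) * (C + (y - u))))
    (ha : a = (r * u + w) / (1 + r)) (hb : b2 = r * (w - u) ^ 2 / (1 + r) ^ 2) :
    y ≠ a ∧ a - b2 / (y - a) = y + C ∧ 4 * b2 < C ^ 2 := by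
  obtain ⟨p, rfl⟩ : ∃ p, u = y - p := ⟨y - u, by ring⟩
  obtain ⟨q, rfl⟩ : ∃ q, w = y + q := ⟨w - y, by ring⟩
  have hp : 0 < p := by linarith
  have hq : 0 < q := by linarith
  have hCq : 0 < C - q := by linarith
  have hCp : 0 < C + p := by linarith
  have e1 : y + q - y = q := by ring
  have e2 : y - (y - p) = p := by ring
  rw [e1, e2] at hr
  have hr0 : 0 < r := by rw [hr]; positivity
  have h1r : 1 + r = (p + q) * (C + p - q) / (p * (C + p)) := by
    rw [hr]
    field_simp
    ring
  have hK : 0 < C + p - q := by linarith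
  have hya : y - a = -(p * q / (C + p - q)) := by
    rw [ha, h1r, hr]
    field_simp
    ring
  have hne : y - a ≠ 0 := by
    rw [hya, neg_ne_zero]
    positivity
  have hb' : b2 = p * q * (C - q) * (C + p) / (C + p - q) ^ 2 := by
    rw [hb, h1r, hr]
    field_simp
    ring
  refine ⟨sub_ne_zero.1 hne, ?_, ?_⟩
  · have ha' : a = y + p * q / (C + p - q) := by linarith
    rw [hya, hb', ha']
    field_simp
    ring
  -- The center is no higher than the top of its semicircle: `4 r ≤ (1 + r)²`.
  · have h2 : 4 * b2 ≤ (p + q) ^ 2 := by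
      rw [hb, mul_div_assoc', div_le_iff₀ (by positivity)]
      have : y + q - (y - p) = p + q := by ring
      rw [this]
      nlinarith [mul_nonneg (sq_nonneg (p + q)) (sq_nonneg (1 - r))]
    have h3 : (p + q) ^ 2 < C ^ 2 := by
      refine pow_lt_pow_left₀ (by linarith) (by positivity) two_ne_zero
    linarith

/-- The half-turn moves `y` to the right by the cusp width and the translation moves it back. The
product has trace `-C / f.im` for the width `C`, and `4 f.im² < C²` makes it hyperbolic. -/
theorem mem_HFix_cuspGroup {k : ℕ} (hk : k < N) {y : ℝ} (hu : v k < y) (hw : y < v (k + 1))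
    (hC : v (k + 1) - v k < cuspWidth N v h)
    (hr : h (k + 1) = h k * ((v (k + 1) - y) * (cuspWidth N v h - (v (k + 1) - y)) /
      ((y - v k) * (cuspWidth N v h + (y - v k))))) :
    (y : OnePoint ℝ) ∈ HFix (cuspGroup N v h) := by
  set f := center N v h (k + 1) with hf
  have hk0 := hh k
  set r := (v (k + 1) - y) * (cuspWidth N v h - (v (k + 1) - y)) /
      ((y - v k) * (cuspWidth N v h + (y - v k))) with hrdef
  obtain ⟨h1, h2, h3⟩ := half_turn_shift hu hw hC hrdef (a := f.re) (b2 := f.im ^ 2)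
    (by rw [hf, center_succ_re hv hh hk, hr]; field_simp)
    (by rw [hf, center_succ_im_sq hv hh hk, hr]; field_simp)
  have him := f.im_ne_zero
  refine ⟨cuspElt N v h (N + 1) * rho f, mul_mem (cuspElt_mem (by omega)) (rho_center_mem (by omega)),
    ?_, ?_⟩
  · rw [cuspElt_last_eq hv hh]
    refine ⟨_, isom_mul _ _, ?_⟩
    rw [Matrix.IsHyperbolic, Matrix.discr_fin_two, Matrix.SpecialLinearGroup.det_coe]
    have : Matrix.trace ((slMk 1 (-cuspWidth N v h) 0 1 (by norm_num) * rhoMatrix f : SL(2, ℝ)) :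
        Matrix (Fin 2) (Fin 2) ℝ) = -(cuspWidth N v h / f.im) := by
      rw [Matrix.SpecialLinearGroup.coe_mul, Matrix.trace_fin_two]
      simp [slMk, rhoMatrix, Matrix.mul_apply, Fin.sum_univ_two]
      ring
    rw [this, neg_sq, div_pow, mul_one, sub_pos, lt_div_iff₀ (by positivity)]
    exact h3
  · have h4 : rho f • (y : OnePoint ℝ) = ((y + cuspWidth N v h : ℝ) : OnePoint ℝ) := by
      have h5 : y - f.re ≠ 0 := sub_ne_zero.2 h1
      have h6 : 1 / f.im * y + -f.re / f.im ≠ 0 := by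
        rw [show 1 / f.im * y + -f.re / f.im = (y - f.re) / f.im by ring]
        exact div_ne_zero h5 him
      rw [rho, isom_smul_coe]
      simp only [rhoMatrix, Matrix.of_apply, Matrix.cons_val', Matrix.cons_val_zero,
        Matrix.cons_val_one, Matrix.cons_val_fin_one]
      rw [if_neg h6, OnePoint.coe_eq_coe, ← h2,
        show 1 / f.im * y + -f.re / f.im = (y - f.re) / f.im by ring,
        show f.re / f.im * y + -(f.re ^ 2 + f.im ^ 2) / f.im =
          (f.re * (y - f.re) - f.im ^ 2) / f.im by ring, div_div_div_cancel_right₀ him, sub_div,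
        mul_div_cancel_right₀ _ h5]
    rw [mul_smul, h4, cuspElt_last_eq hv hh, isom_smul_coe]
    simp [slMk]

end

theorem exists_strictMono_extend (Y : Finset ℝ) :
    ∃ y : ℕ → ℝ, StrictMono y ∧ ∀ x ∈ Y, ∃ k < Y.card, y k = x := by
  obtain ⟨M, hM⟩ := Y.bddAbove
  let e := Y.orderEmbOfFin rfl
  -- The values from `Y.card` on are fillers above the bound `M`, keeping the sequence increasing.
  refine ⟨fun k => if hk : k < Y.card then e ⟨k, hk⟩ else M + k + 1, strictMono_nat_of_lt_succ fun k => ?_,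
    fun x hx => ?_⟩
  · by_cases h1 : k + 1 < Y.card
    · have h2 : k < Y.card := by omega
      simp only [h1, h2, dif_pos]
      exact e.strictMono (Nat.lt_succ_self k)
    · by_cases h2 : k < Y.card
      · simp only [h1, h2, dif_pos, dif_neg, not_false_eq_true]
        have h3 : e ⟨k, h2⟩ ≤ M := hM (Y.orderEmbOfFin_mem rfl _)
        push_cast
        linarith [(Nat.cast_nonneg k : (0 : ℝ) ≤ k)]
      · simp only [h1, h2, dif_neg, not_false_eq_true]
        push_cast
        linarith
  · have : x ∈ Set.range e := by rw [Finset.range_orderEmbOfFin]; exact hx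
    obtain ⟨⟨k, hk⟩, rfl⟩ := this
    exact ⟨k, hk, dif_pos hk⟩

theorem exists_interlacing {y : ℕ → ℝ} (hy : StrictMono y) :
    ∃ v : ℕ → ℝ, StrictMono v ∧ ∀ k, v k < y k ∧ y k < v (k + 1) := by
  have h1 : ∀ k, y k < y (k + 1) := fun k => hy k.lt_succ_self
  let v : ℕ → ℝ := fun k => Nat.casesOn k (y 0 - 1) fun j => (y j + y (j + 1)) / 2
  have h2 : ∀ k, v k < y k ∧ y k < v (k + 1) := by
    intro k
    refine ⟨?_, show y k < (y k + y (k + 1)) / 2 by linarith [h1 k]⟩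
    rcases k with _ | k
    · exact sub_one_lt (y 0)
    · change (y k + y (k + 1)) / 2 < y (k + 1)
      linarith [h1 k]
  exact ⟨v, strictMono_nat_of_lt_succ fun k => (h2 k).1.trans (h2 k).2, h2⟩

/-- The ratios determine the weights up to a common factor, and `cuspWidth N v h - (v N - v 0)` is
proportional to that factor. -/
theorem exists_weights {N : ℕ} {v : ℕ → ℝ} (hv : StrictMono v) (hN : 1 ≤ N) {r : ℕ → ℝ}
    (hr : ∀ k < N, 0 < r k) {C : ℝ} (hC : v N - v 0 < C) :
    ∃ h : ℕ → ℝ, (∀ k, 0 < h k) ∧ (∀ k < N, h (k + 1) = h k * r k) ∧ cuspWidth N v h = C := by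
  let H : ℕ → ℝ := fun k => ∏ j ∈ Finset.range k, if j < N then r j else 1
  have hH : ∀ k, 0 < H k := fun k => Finset.prod_pos fun j _ => by
    split_ifs with hj
    · exact hr j hj
    · exact one_pos
  set S := ∑ j ∈ Finset.range N, (H j + H (j + 1)) / (v (j + 1) - v j) with hS
  have hS0 : 0 < S := Finset.sum_pos (fun j _ =>
    div_pos (add_pos (hH j) (hH (j + 1))) (sub_pos.2 (hv j.lt_succ_self))) ⟨0, Finset.mem_range.2 hN⟩
  have hs : 0 < (C - (v N - v 0)) / S := div_pos (sub_pos.2 hC) hS0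
  refine ⟨fun k => (C - (v N - v 0)) / S * H k, fun k => mul_pos hs (hH k), fun k hk => ?_, ?_⟩
  · simp only [H, Finset.prod_range_succ, if_pos hk]
    ring
  · rw [cuspWidth_eq_sum]
    have : ∑ j ∈ Finset.range N, ((C - (v N - v 0)) / S * H j + (C - (v N - v 0)) / S * H (j + 1)) /
        (v (j + 1) - v j) = (C - (v N - v 0)) / S * S := by
      rw [hS, Finset.mul_sum]
      refine Finset.sum_congr rfl fun j _ => ?_
      ring
    rw [this, div_mul_cancel₀ _ hS0.ne']
    ring

/-- For every large `C` there is a group with cusp width `C`. -/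
theorem exists_isIdealHalfTurnGroup (Y : Finset ℝ) (hY : 1 ≤ Y.card) :
    ∃ L : ℝ, ∀ C, L < C → ∃ Γ : Subgroup PSL(2, ℝ),
      IsIdealHalfTurnGroup (Y.card + 1) (((↑) : ℝ → OnePoint ℝ) '' Y) Γ ∧
      isom (slMk 1 (-C) 0 1 (by norm_num)) ∈ Γ := by
  obtain ⟨y, hy, hyY⟩ := exists_strictMono_extend Y
  obtain ⟨v, hv, hvy⟩ := exists_interlacing hy
  refine ⟨v Y.card - v 0, fun C hC => ?_⟩
  have hgap : ∀ k < Y.card, v (k + 1) - v k < C := by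
    intro k hk
    have h1 : v 0 ≤ v k := hv.monotone (Nat.zero_le k)
    have h2 : v (k + 1) ≤ v Y.card := hv.monotone hk
    linarith
  obtain ⟨h, hh, hr, hw⟩ := exists_weights hv hY
    (r := fun k => (v (k + 1) - y k) * (C - (v (k + 1) - y k)) / ((y k - v k) * (C + (y k - v k))))
    (fun k hk => by
      have h1 := hvy k
      have h2 := hgap k hk
      exact div_pos (mul_pos (by linarith) (by linarith)) (mul_pos (by linarith) (by linarith))) hC
  refine ⟨cuspGroup Y.card v h, isIdealHalfTurnGroup_cuspGroup hv hh hY ?_, ?_⟩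
  · rintro _ ⟨x, hx, rfl⟩
    obtain ⟨k, hk, rfl⟩ := hyY x hx
    refine mem_HFix_cuspGroup hv hh hk (hvy k).1 (hvy k).2 ?_ ?_
    · rw [hw]
      exact hgap k hk
    · rw [hw]
      exact hr k hk
  · have := cuspElt_last_eq hv hh (N := Y.card)
    rw [hw] at this
    rw [← this]
    exact cuspElt_mem (by omega)

theorem isom_translation_injective :
    Function.Injective fun C : ℝ => isom (slMk 1 (-C) 0 1 (by norm_num)) := by
  intro C C' hCC
  have := congrArg (fun γ : PSL(2, ℝ) => γ • ((0 : ℝ) : OnePoint ℝ)) hCC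
  simp only [isom_smul_coe] at this
  simpa [slMk] using this

/-- Some isometry takes a given finite subset of the boundary circle into the real line. -/
theorem exists_image_coe_eq (Y : Finset (OnePoint ℝ)) :
    ∃ (γ : PSL(2, ℝ)) (Y' : Finset ℝ), Y'.card = Y.card ∧
      γ • (((↑) : ℝ → OnePoint ℝ) '' Y') = (Y : Set (OnePoint ℝ)) := by
  classical
  obtain ⟨t, ht⟩ : ∃ t : ℝ, (t : OnePoint ℝ) ∉ Y := by
    have h1 : (((↑) : ℝ → OnePoint ℝ) ⁻¹' (Y : Set (OnePoint ℝ))).Finite :=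
      Y.finite_toSet.preimage OnePoint.coe_injective.injOn
    obtain ⟨t, ht⟩ := h1.infinite_compl.nonempty
    exact ⟨t, ht⟩
  set δ : PSL(2, ℝ) := isom (slMk 0 (-1) 1 (-t) (by norm_num)) with hδ
  have h1 : δ • (t : OnePoint ℝ) = OnePoint.infty := by
    rw [hδ, isom_smul_coe, if_pos]
    simp [slMk]
  have h2 : ∀ x ∈ Y, ∃ x' : ℝ, (x' : OnePoint ℝ) = δ • x := by
    intro x hx
    rw [← OnePoint.ne_infty_iff_exists, ← h1]
    exact fun h => ht (MulAction.injective δ h ▸ hx)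
  choose! g hg using h2
  refine ⟨δ⁻¹, Y.image g, Finset.card_image_of_injOn fun a ha b hb hab => ?_, ?_⟩
  · have h3 := hg a ha
    rw [hab, hg b hb] at h3
    exact (MulAction.injective δ h3).symm
  · ext x
    rw [Set.mem_inv_smul_set_iff, Finset.coe_image, Set.image_image]
    constructor
    · rintro ⟨a, ha, h3⟩
      exact MulAction.injective δ ((hg a ha).symm.trans h3) ▸ ha
    · intro hx
      exact ⟨x, hx, hg x hx⟩

/-- Finitely many countable groups have a countable union, yet it would contain a conjugated
translation for every large width. -/
theorem infinite_isIdealHalfTurnGroup (Y : Finset (OnePoint ℝ)) (hY : 1 ≤ Y.card) :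
    {Γ | IsIdealHalfTurnGroup (Y.card + 1) (Y : Set (OnePoint ℝ)) Γ}.Infinite := by
  intro hfin
  obtain ⟨γ, Y', hcard, himg⟩ := exists_image_coe_eq Y
  obtain ⟨L, hL⟩ := exists_isIdealHalfTurnGroup Y' (by omega)
  set G := {Γ | IsIdealHalfTurnGroup (Y.card + 1) (Y : Set (OnePoint ℝ)) Γ} with hG
  have h1 : (⋃ Γ ∈ G, (Γ : Set PSL(2, ℝ))).Countable :=
    hfin.countable.biUnion fun Γ hΓ => IsIdealHalfTurnGroup.countable hΓ
  -- The exponential parametrizes all widths above `L` injectively by the real line.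
  let φ : ℝ → PSL(2, ℝ) := fun t =>
    γ * isom (slMk 1 (-(L + Real.exp t)) 0 1 (by norm_num)) * γ⁻¹
  have h2 : Set.MapsTo φ Set.univ (⋃ Γ ∈ G, (Γ : Set PSL(2, ℝ))) := by
    intro t _
    obtain ⟨Γ, hΓ, hT⟩ := hL (L + Real.exp t) (by linarith [Real.exp_pos t])
    have h3 := hΓ.conj γ
    rw [himg, hcard] at h3
    exact Set.mem_biUnion h3 (conj_mem_conjGroup hT)
  have h4 : Function.Injective φ := by
    intro t t' htt
    have h5 := isom_translation_injective (mul_left_cancel (mul_right_cancel htt))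
    exact Real.exp_injective (add_left_cancel h5)
  exact Cardinal.not_countable_real (h2.countable_of_injOn h4.injOn h1)

end HypPlane

theorem mainTheorem5 (n : ℕ) (hn : 2 ≤ n) (Y : Finset (OnePoint ℝ)) (hY : Y.card + 1 = n) :
    {Γ : Subgroup PSL(2, ℝ) |
      HypPlane.IsFuchsian Γ ∧
      HypPlane.HasFiniteCovolume Γ ∧
      HypPlane.HasGenusZeroSignature Γ (fun _ : Fin (n + 1) => 2) 1 0 ∧
      (Y : Set (OnePoint ℝ)) ⊆ HypPlane.HFix Γ ∧
      ∃ (v : Fin (n + 1) → OnePoint ℝ) (f : Fin (n + 1) → ℍ),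
        HypPlane.InCyclicOrder v ∧
        (∀ i, f i ∈ HypPlane.geodesic (v (i - 1)) (v i)) ∧
        Γ = Subgroup.closure (Set.range fun i => HypPlane.rho (f i)) ∧
        HypPlane.IsFundamentalDomain Γ (HypPlane.idealPolygon v)}.Infinite := by
  obtain rfl : n = Y.card + 1 := hY.symm
  exact HypPlane.infinite_isIdealHalfTurnGroup Y (by omega)
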